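/- There is a deterministic real-RAM algorithm that, given a finite sequence $P$ of $n$ points in the plane $\mathbb{R}^2$ (not necessarily distinct, counted with multiplicity) and an integer $k$ with $0 \le k \le n$, computes in $O(n\log n + nk\log k)$ worst-case time an axis-aligned rectangle $[x_1,x_2]\times[y_1,y_2]$ (closed and possibly degenerate, $x_1\le x_2$, $y_1\le y_2$) that contains at least $k$ of the points of $P$ and whose perimeter $2\bigl((x_2-x_1)+(y_2-y_1)\bigr)$ is the smallest among all axis-aligned rectangles containing at least $k$ points of $P$. Here the real RAM is a uniform machine with unit-cost exact real operations $+,-,\times,/$ and comparisons, indirect addressing and integer words of $O(\log n)$ bits, without floor function or randomness. The time bound means that there is a single program and a constant $C$, depending on neither $n$, $k$ nor $P$, such that the program halts after at most $C\,(n\log n + nk\log k + 1)$ steps (with $0\log 0 = 0$; the summand $1$ matters only for $n\le 1$, where the logarithms vanish). -/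

import Mathlib

/-! ## A real RAM

A uniform machine model with unit-cost steps: a program has finitely many scalar variables and
finitely many arrays, some holding natural numbers (the integer part of the machine, used for
counters and addresses) and some holding real numbers. Real arithmetic is exact; the operations on
reals are `+`, `-`, `*`, `/` and comparisons. There is no floor function, no conversion of reals to
integers and no randomness. -/

namespace RealRAM

/-- Expressions with natural-number value: literals, scalar variables, array reads (indirect
addressing), addition, truncated subtraction, multiplication, integer division. -/
inductive NExp where
  | lit (c : ℕ)
  | var (x : ℕ)
  | get (a : ℕ) (i : NExp)
  | add (e f : NExp)
  | sub (e f : NExp)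
  | mul (e f : NExp)
  | div (e f : NExp)

/-- Expressions with real value. Only rational literals are allowed, so that a program carries only
finitely many bits of information. -/
inductive RExp where
  | lit (q : ℚ)
  | var (x : ℕ)
  | get (a : ℕ) (i : NExp)
  | add (e f : RExp)
  | sub (e f : RExp)
  | mul (e f : RExp)
  | div (e f : RExp)

/-- Tests: comparisons of naturals, comparisons of reals, and their Boolean combinations. -/
inductive BExp where
  | nle (e f : NExp)
  | rle (e f : RExp)
  | not (b : BExp)
  | and (b c : BExp)
  | or (b c : BExp)

/-- Commands. `call j` executes the `j`-th procedure of the program; all variables are global, and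
procedures may be recursive. -/
inductive Cmd where
  | skip
  | nset (x : ℕ) (e : NExp)
  | rset (x : ℕ) (e : RExp)
  | nput (a : ℕ) (i e : NExp)
  | rput (a : ℕ) (i : NExp) (e : RExp)
  | seq (c d : Cmd)
  | cond (b : BExp) (c d : Cmd)
  | loop (b : BExp) (c : Cmd)
  | call (j : ℕ)

/-- A program: a main command and a finite list of procedures. -/
structure Program where
  main : Cmd
  procs : List Cmd

/-- Memory contents: scalar natural variables, scalar real variables, arrays of naturals and arrays
of reals (`na a i` and `ra a i` are the cells with index `i` of array number `a`). -/
@[ext] structure State where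
  nv : ℕ → ℕ
  rv : ℕ → ℝ
  na : ℕ → ℕ → ℕ
  ra : ℕ → ℕ → ℝ

def NExp.eval (s : State) : NExp → ℕ
  | lit c => c
  | var x => s.nv x
  | get a i => s.na a (i.eval s)
  | add e f => e.eval s + f.eval s
  | sub e f => e.eval s - f.eval s
  | mul e f => e.eval s * f.eval s
  | div e f => e.eval s / f.eval s

/-- Division by zero returns `0`. -/
noncomputable def RExp.eval (s : State) : RExp → ℝ
  | lit q => (q : ℝ)
  | var x => s.rv x
  | get a i => s.ra a (i.eval s)
  | add e f => e.eval s + f.eval s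
  | sub e f => e.eval s - f.eval s
  | mul e f => e.eval s * f.eval s
  | div e f => e.eval s / f.eval s

def BExp.eval (s : State) : BExp → Prop
  | nle e f => e.eval s ≤ f.eval s
  | rle e f => e.eval s ≤ f.eval s
  | not b => ¬ b.eval s
  | and b c => b.eval s ∧ c.eval s
  | or b c => b.eval s ∨ c.eval s

/-- The number of elementary operations (literals, reads, arithmetic) in an expression. -/
def NExp.size : NExp → ℕ
  | lit _ => 1
  | var _ => 1
  | get _ i => i.size + 1
  | add e f => e.size + f.size + 1
  | sub e f => e.size + f.size + 1
  | mul e f => e.size + f.size + 1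
  | div e f => e.size + f.size + 1

def RExp.size : RExp → ℕ
  | lit _ => 1
  | var _ => 1
  | get _ i => i.size + 1
  | add e f => e.size + f.size + 1
  | sub e f => e.size + f.size + 1
  | mul e f => e.size + f.size + 1
  | div e f => e.size + f.size + 1

def BExp.size : BExp → ℕ
  | nle e f => e.size + f.size + 1
  | rle e f => e.size + f.size + 1
  | not b => b.size + 1
  | and b c => b.size + c.size + 1
  | or b c => b.size + c.size + 1

/-- Overwrite cell `i` of array `a` by `v`. -/
def update₂ {α : Type} (m : ℕ → ℕ → α) (a i : ℕ) (v : α) : ℕ → ℕ → α :=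
  Function.update m a (Function.update (m a) i v)

/-- `Exec procs B c s s' t`: with the given procedures, command `c` started in memory `s` halts in
memory `s'` after `t` elementary steps, and every natural number that it stores is at most `B`
(the machine's integers are words holding the values `0, …, B`; a command that would store a larger
number has no execution). Each elementary operation in an evaluated expression costs one step, and
so does each `skip`, assignment, branch, loop test and call. -/
inductive Exec (procs : List Cmd) (B : ℕ) : Cmd → State → State → ℕ → Prop
  | skip (s : State) : Exec procs B .skip s s 1
  | nset (s : State) (x : ℕ) (e : NExp) (h : e.eval s ≤ B) :
      Exec procs B (.nset x e) s
        { s with nv := Function.update s.nv x (e.eval s) } (e.size + 1)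
  | rset (s : State) (x : ℕ) (e : RExp) :
      Exec procs B (.rset x e) s
        { s with rv := Function.update s.rv x (e.eval s) } (e.size + 1)
  | nput (s : State) (a : ℕ) (i e : NExp) (h : e.eval s ≤ B) :
      Exec procs B (.nput a i e) s
        { s with na := update₂ s.na a (i.eval s) (e.eval s) } (i.size + e.size + 1)
  | rput (s : State) (a : ℕ) (i : NExp) (e : RExp) :
      Exec procs B (.rput a i e) s
        { s with ra := update₂ s.ra a (i.eval s) (e.eval s) } (i.size + e.size + 1)
  | seq {c d : Cmd} {s s' s'' : State} {t t' : ℕ}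
      (h : Exec procs B c s s' t) (h' : Exec procs B d s' s'' t') :
      Exec procs B (.seq c d) s s'' (t + t')
  | condTrue {b : BExp} {c d : Cmd} {s s' : State} {t : ℕ}
      (hb : b.eval s) (h : Exec procs B c s s' t) :
      Exec procs B (.cond b c d) s s' (b.size + 1 + t)
  | condFalse {b : BExp} {c d : Cmd} {s s' : State} {t : ℕ}
      (hb : ¬ b.eval s) (h : Exec procs B d s s' t) :
      Exec procs B (.cond b c d) s s' (b.size + 1 + t)
  | loopFalse {b : BExp} {c : Cmd} {s : State} (hb : ¬ b.eval s) :
      Exec procs B (.loop b c) s s (b.size + 1)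
  | loopTrue {b : BExp} {c : Cmd} {s s' s'' : State} {t t' : ℕ}
      (hb : b.eval s) (h : Exec procs B c s s' t) (h' : Exec procs B (.loop b c) s' s'' t') :
      Exec procs B (.loop b c) s s'' (b.size + 1 + t + t')
  | call {j : ℕ} {c : Cmd} {s s' : State} {t : ℕ}
      (hj : procs[j]? = some c) (h : Exec procs B c s s' t) :
      Exec procs B (.call j) s s' (t + 1)

/-- The program `p`, started in memory `s`, halts in memory `s'` after `t` elementary steps, on a
machine whose integer words hold the values `0, …, B`. -/
def Program.RunsTo (p : Program) (B : ℕ) (s s' : State) (t : ℕ) : Prop :=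
  Exec p.procs B p.main s s' t

end RealRAM

/-! ## Smallest `k`-enclosing rectangles -/

/-- A closed axis-aligned rectangle `[x₁, x₂] × [y₁, y₂]`, possibly degenerate. -/
structure AxisRect where
  x₁ : ℝ
  x₂ : ℝ
  y₁ : ℝ
  y₂ : ℝ
  hx : x₁ ≤ x₂
  hy : y₁ ≤ y₂

namespace AxisRect

def toSet (R : AxisRect) : Set (ℝ × ℝ) := Set.Icc R.x₁ R.x₂ ×ˢ Set.Icc R.y₁ R.y₂

def perimeter (R : AxisRect) : ℝ := 2 * ((R.x₂ - R.x₁) + (R.y₂ - R.y₁))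

/-- `R` contains (at least) `k` of the points `P 0, …, P (n - 1)`. -/
def Encloses {n : ℕ} (R : AxisRect) (P : Fin n → ℝ × ℝ) (k : ℕ) : Prop :=
  k ≤ {i : Fin n | P i ∈ R.toSet}.ncard

/-- `R` has the smallest perimeter among all axis-aligned rectangles that enclose `k` of the given
points. -/
def IsSmallestPerimeter {n : ℕ} (R : AxisRect) (P : Fin n → ℝ × ℝ) (k : ℕ) : Prop :=
  R.Encloses P k ∧ ∀ R' : AxisRect, R'.Encloses P k → R.perimeter ≤ R'.perimeter

end AxisRect

/-- The initial memory for the input `(P, k)`: `n` and `k` are in the natural variables `0` and `1`,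
the `x`- and `y`-coordinates of the points are in cells `0, …, n - 1` of the real arrays `0` and
`1`; everything else is zero. -/
noncomputable def RealRAM.State.input {n : ℕ} (P : Fin n → ℝ × ℝ) (k : ℕ) : RealRAM.State where
  nv := fun x => if x = 0 then n else if x = 1 then k else 0
  rv := fun _ => 0
  na := fun _ _ => 0
  ra := fun a i =>
    if h : i < n then
      if a = 0 then (P ⟨i, h⟩).1 else if a = 1 then (P ⟨i, h⟩).2 else 0
    else 0

/-- The memory holds the rectangle `R` as output: its four sides are in the real variables
`0, 1, 2, 3`. -/
def RealRAM.State.Outputs (s : RealRAM.State) (R : AxisRect) : Prop :=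
  s.rv 0 = R.x₁ ∧ s.rv 1 = R.x₂ ∧ s.rv 2 = R.y₁ ∧ s.rv 3 = R.y₂

/-! The algorithm combines a divide and conquer on point sets, which ends in sets of `O(k)` points,
with a search of cost `O(m² log m)` on each final set of `m` points.

Splitting. Take a set of `m ≥ 28800 k` points, sorted in both directions, and put `d ≈ √(32 m k)`.
Among all stretches of `d` consecutive steps in either direction that avoid the outer eighths,
choose one with the largest coordinate difference `g`. If `g ≤ 0`, at least half of the points
coincide and a degenerate rectangle is optimal. Otherwise the central points lie in a box that is at
most `(m / d + 1) g` wide in both directions, and a grid with cells of side `2g/5` has so few cells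
that one of them holds `k` points (`exists_small_rect`). So the optimum is below `g`, and no
rectangle that small reaches across the chosen stretch. Two subsets that overlap exactly in the
stretch therefore contain between them every rectangle that matters (`isLowerBound_of_split`). The
sizes satisfy `l + r = m + d`. The weight `2m - 60 √(mk)` absorbs the overlap (`nodeWeight_split`),
so the sizes of the final sets sum to `O(n)`, and linear work per node costs `O(n log n)` in total.

Final sets. An optimal rectangle is given by a bottom rank `i` and a top rank `j` in the `y`-order
and an interval in the `x`-order. The pairs `(i, j)` are searched by halving both ranges
simultaneously. A node stands for a bottom block and a top block of length `h`. A point in one of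
the blocks is active, since it is in some of the slabs only. A point strictly between the blocks is
in all slabs, and points outside are in none. Hence only `O(h)` positions relative to the active
points can be told apart, and a deeper slab can lose only as many points of an interval as there are
active ones. It is enough to know, for each surplus `T` up to the number of active points, short
intervals with `k + T` live points, one for each pair of end positions. For fixed `T` both ends move
right together, so the sum `u` of the two positions determines the pair (`IsLiveInterval.pos_eq`).
The table has `O(h²)` cells, and each child obtains its table from its parent's in `O(h²)` time
(`IsTable.refine`, `enterNode_runs`). With four children per node every level costs `O(m²)`, hence
`O(m² log m)` in all (`solveNode_runs`).

With `m = O(k)` and total size `O(n)` the final sets cost `O(n k log k)`, and a tournament sort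
supplies the two orders in `O(n log n)`. Correctness and running time are proved together, by
Hoare-style triples `Runs` with a step bound and an automatic account of which variables and arrays
may have changed. -/

namespace RealRAM

-- Program logic: timed triples, weakest preconditions and frames.

infixr:60 " ;; " => Cmd.seq

/-- The value of a natural variable. -/
abbrev nvar : ℕ → NExp := NExp.var

/-- The value of a real variable. -/
abbrev rvar : ℕ → RExp := RExp.var

instance : Add NExp := ⟨NExp.add⟩
instance : Sub NExp := ⟨NExp.sub⟩
instance : Mul NExp := ⟨NExp.mul⟩
instance : Div NExp := ⟨NExp.div⟩
instance (c : ℕ) : OfNat NExp c := ⟨NExp.lit c⟩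
instance : Add RExp := ⟨RExp.add⟩
instance : Sub RExp := ⟨RExp.sub⟩
instance (c : ℕ) : OfNat RExp c := ⟨RExp.lit c⟩

section Eval

variable (s : State)

@[simp] theorem NExp.eval_add' (e f : NExp) : (e + f).eval s = e.eval s + f.eval s := rfl
@[simp] theorem NExp.eval_sub' (e f : NExp) : (e - f).eval s = e.eval s - f.eval s := rfl
@[simp] theorem NExp.eval_mul' (e f : NExp) : (e * f).eval s = e.eval s * f.eval s := rfl
@[simp] theorem NExp.eval_div' (e f : NExp) : (e / f).eval s = e.eval s / f.eval s := rfl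
@[simp] theorem NExp.eval_ofNat (c : ℕ) :
    (no_index (@OfNat.ofNat NExp c _)).eval s = @OfNat.ofNat ℕ c _ := rfl
@[simp] theorem NExp.eval_lit' (c : ℕ) : (NExp.lit c).eval s = c := rfl
@[simp] theorem NExp.eval_var' (x : ℕ) : (NExp.var x).eval s = s.nv x := rfl
@[simp] theorem NExp.eval_get' (a : ℕ) (i : NExp) : (NExp.get a i).eval s = s.na a (i.eval s) := rfl
@[simp] theorem RExp.eval_add' (e f : RExp) : (e + f).eval s = e.eval s + f.eval s := rfl
@[simp] theorem RExp.eval_sub' (e f : RExp) : (e - f).eval s = e.eval s - f.eval s := rfl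
@[simp] theorem RExp.eval_ofNat (c : ℕ) :
    (no_index (@OfNat.ofNat RExp c _)).eval s = (c : ℝ) := by
  change (((c : ℕ) : ℚ) : ℝ) = c
  simp
@[simp] theorem RExp.eval_lit' (q : ℚ) : (RExp.lit q).eval s = q := rfl
@[simp] theorem RExp.eval_var' (x : ℕ) : (RExp.var x).eval s = s.rv x := rfl
@[simp] theorem RExp.eval_get' (a : ℕ) (i : NExp) : (RExp.get a i).eval s = s.ra a (i.eval s) := rfl
@[simp] theorem BExp.eval_nle (e f : NExp) : (BExp.nle e f).eval s ↔ e.eval s ≤ f.eval s := Iff.rfl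
@[simp] theorem BExp.eval_rle (e f : RExp) : (BExp.rle e f).eval s ↔ e.eval s ≤ f.eval s := Iff.rfl
@[simp] theorem BExp.eval_not (b : BExp) : (BExp.not b).eval s ↔ ¬ b.eval s := Iff.rfl
@[simp] theorem BExp.eval_and (b c : BExp) : (BExp.and b c).eval s ↔ b.eval s ∧ c.eval s := Iff.rfl
@[simp] theorem BExp.eval_or (b c : BExp) : (BExp.or b c).eval s ↔ b.eval s ∨ c.eval s := Iff.rfl

@[simp] theorem NExp.size_add' (e f : NExp) : (e + f).size = e.size + f.size + 1 := rfl
@[simp] theorem NExp.size_sub' (e f : NExp) : (e - f).size = e.size + f.size + 1 := rfl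
@[simp] theorem NExp.size_mul' (e f : NExp) : (e * f).size = e.size + f.size + 1 := rfl
@[simp] theorem NExp.size_div' (e f : NExp) : (e / f).size = e.size + f.size + 1 := rfl
@[simp] theorem NExp.size_ofNat (c : ℕ) : (no_index (@OfNat.ofNat NExp c _)).size = 1 := rfl
@[simp] theorem NExp.size_var' (x : ℕ) : (NExp.var x).size = 1 := rfl
@[simp] theorem NExp.size_get' (a : ℕ) (i : NExp) : (NExp.get a i).size = i.size + 1 := rfl

end Eval

namespace State

/-- Assign a natural variable. -/
def setN (s : State) (x v : ℕ) : State := { s with nv := Function.update s.nv x v }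
/-- Assign a real variable. -/
noncomputable def setR (s : State) (x : ℕ) (v : ℝ) : State :=
  { s with rv := Function.update s.rv x v }
/-- Assign a cell of an array of naturals. -/
def putN (s : State) (a i v : ℕ) : State := { s with na := update₂ s.na a i v }
/-- Assign a cell of an array of reals. -/
noncomputable def putR (s : State) (a i : ℕ) (v : ℝ) : State := { s with ra := update₂ s.ra a i v }

variable (s : State) (x y a i a' i' v : ℕ) (r : ℝ)

@[simp] theorem nv_setN : (s.setN x v).nv y = if y = x then v else s.nv y := by
  simp [setN, Function.update_apply]
@[simp] theorem rv_setN : (s.setN x v).rv = s.rv := rfl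
@[simp] theorem na_setN : (s.setN x v).na = s.na := rfl
@[simp] theorem ra_setN : (s.setN x v).ra = s.ra := rfl
@[simp] theorem nv_setR : (s.setR x r).nv = s.nv := rfl
@[simp] theorem rv_setR : (s.setR x r).rv y = if y = x then r else s.rv y := by
  simp [setR, Function.update_apply]
@[simp] theorem na_setR : (s.setR x r).na = s.na := rfl
@[simp] theorem ra_setR : (s.setR x r).ra = s.ra := rfl
@[simp] theorem nv_putN : (s.putN a i v).nv = s.nv := rfl
@[simp] theorem rv_putN : (s.putN a i v).rv = s.rv := rfl
@[simp] theorem ra_putN : (s.putN a i v).ra = s.ra := rfl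
@[simp] theorem na_putN : (s.putN a i v).na a' i' = if a' = a ∧ i' = i then v else s.na a' i' := by
  by_cases h : a' = a
  · subst h
    simp [putN, update₂, Function.update_apply]
  · simp [putN, update₂, h]
@[simp] theorem nv_putR : (s.putR a i r).nv = s.nv := rfl
@[simp] theorem rv_putR : (s.putR a i r).rv = s.rv := rfl
@[simp] theorem na_putR : (s.putR a i r).na = s.na := rfl
@[simp] theorem ra_putR : (s.putR a i r).ra a' i' = if a' = a ∧ i' = i then r else s.ra a' i' := by
  by_cases h : a' = a
  · subst h
    simp [putR, update₂, Function.update_apply]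
  · simp [putR, update₂, h]

end State

/-- Command `c` started in `s` halts within `T` steps in a memory that satisfies `Q`. -/
def Runs (pr : List Cmd) (B : ℕ) (c : Cmd) (s : State) (T : ℕ) (Q : State → Prop) : Prop :=
  ∃ s' t, Exec pr B c s s' t ∧ t ≤ T ∧ Q s'

/-- Weakest precondition of commands without loops and calls. -/
def wp (B : ℕ) : Cmd → State → (State → Prop) → Prop
  | .skip, s, Q => Q s
  | .nset x e, s, Q => e.eval s ≤ B ∧ Q (s.setN x (e.eval s))
  | .rset x e, s, Q => Q (s.setR x (e.eval s))
  | .nput a i e, s, Q => e.eval s ≤ B ∧ Q (s.putN a (i.eval s) (e.eval s))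
  | .rput a i e, s, Q => Q (s.putR a (i.eval s) (e.eval s))
  | .seq c d, s, Q => wp B c s fun s' => wp B d s' Q
  | .cond b c d, s, Q => (b.eval s → wp B c s Q) ∧ (¬ b.eval s → wp B d s Q)
  | .loop _ _, _, _ => False
  | .call _, _, _ => False

/-- A bound for the running time of commands without loops and calls. -/
def Cmd.cost : Cmd → ℕ
  | .skip => 1
  | .nset _ e => e.size + 1
  | .rset _ e => e.size + 1
  | .nput _ i e => i.size + e.size + 1
  | .rput _ i e => i.size + e.size + 1
  | .seq c d => c.cost + d.cost
  | .cond b c d => b.size + 1 + (c.cost + d.cost)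
  | .loop _ _ => 0
  | .call _ => 0

/-- Codes of the variables and arrays that a command may modify; `pw j` are those of procedure
`j`. -/
def Cmd.writes (pw : ℕ → List ℕ) : Cmd → List ℕ
  | .skip => []
  | .nset x _ => [4 * x]
  | .rset x _ => [4 * x + 1]
  | .nput a _ _ => [4 * a + 2]
  | .rput a _ _ => [4 * a + 3]
  | .seq c d => c.writes pw ++ d.writes pw
  | .cond _ c d => c.writes pw ++ d.writes pw
  | .loop _ c => c.writes pw
  | .call j => pw j

/-- The memories agree outside the variables and arrays with codes in `W`. -/
structure Frame (W : List ℕ) (s s' : State) : Prop where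
  nv : ∀ x, 4 * x ∉ W → s'.nv x = s.nv x
  rv : ∀ x, 4 * x + 1 ∉ W → s'.rv x = s.rv x
  na : ∀ x, 4 * x + 2 ∉ W → s'.na x = s.na x
  ra : ∀ x, 4 * x + 3 ∉ W → s'.ra x = s.ra x

theorem Frame.refl (W : List ℕ) (s : State) : Frame W s s :=
  ⟨fun _ _ => rfl, fun _ _ => rfl, fun _ _ => rfl, fun _ _ => rfl⟩

theorem Frame.trans {W : List ℕ} {s s' s'' : State} (h : Frame W s s') (h' : Frame W s' s'') :
    Frame W s s'' :=
  ⟨fun x hx => (h'.nv x hx).trans (h.nv x hx), fun x hx => (h'.rv x hx).trans (h.rv x hx),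
    fun x hx => (h'.na x hx).trans (h.na x hx), fun x hx => (h'.ra x hx).trans (h.ra x hx)⟩

theorem Frame.mono {W W' : List ℕ} (hW : W ⊆ W') {s s' : State} (h : Frame W s s') :
    Frame W' s s' :=
  ⟨fun x hx => h.nv x fun h => hx (hW h), fun x hx => h.rv x fun h => hx (hW h),
    fun x hx => h.na x fun h => hx (hW h), fun x hx => h.ra x fun h => hx (hW h)⟩

/-- `pw` lists, for every procedure, all that it modifies. -/
def WritesOK (pr : List Cmd) (pw : ℕ → List ℕ) : Prop :=
  ∀ j c, pr[j]? = some c → c.writes pw ⊆ pw j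

/-- Procedures are recursive, so what a call modifies cannot be read off by structural recursion.
Any list `pw` closed under the procedure bodies will do, because the induction runs over the
execution and not over the program text. -/
theorem Exec.frame {pr : List Cmd} {pw : ℕ → List ℕ} (hpw : WritesOK pr pw) {B : ℕ} {c : Cmd}
    {s s' : State} {t : ℕ} (h : Exec pr B c s s' t) : Frame (c.writes pw) s s' := by
  induction h with
  | skip s => exact Frame.refl _ _
  | nset s x e h =>
    refine ⟨fun y hy => ?_, fun _ _ => rfl, fun _ _ => rfl, fun _ _ => rfl⟩
    have : y ≠ x := by rintro rfl; simp [Cmd.writes] at hy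
    simp [this]
  | rset s x e =>
    refine ⟨fun _ _ => rfl, fun y hy => ?_, fun _ _ => rfl, fun _ _ => rfl⟩
    have : y ≠ x := by rintro rfl; simp [Cmd.writes] at hy
    simp [this]
  | nput s x i e h =>
    refine ⟨fun _ _ => rfl, fun _ _ => rfl, fun y hy => ?_, fun _ _ => rfl⟩
    have : y ≠ x := by rintro rfl; simp [Cmd.writes] at hy
    simp [this, update₂]
  | rput s x i e =>
    refine ⟨fun _ _ => rfl, fun _ _ => rfl, fun _ _ => rfl, fun y hy => ?_⟩
    have : y ≠ x := by rintro rfl; simp [Cmd.writes] at hy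
    simp [this, update₂]
  | seq _ _ ih ih' =>
    exact (ih.mono (by simp [Cmd.writes])).trans (ih'.mono (by simp [Cmd.writes]))
  | condTrue _ _ ih => exact ih.mono (by simp [Cmd.writes])
  | condFalse _ _ ih => exact ih.mono (by simp [Cmd.writes])
  | loopFalse _ => exact Frame.refl _ _
  | loopTrue _ _ _ ih ih' => exact ih.trans ih'
  | call hj _ ih => exact ih.mono (hpw _ _ hj)

namespace Runs

variable {pr : List Cmd} {pw : ℕ → List ℕ} {B : ℕ} {c d : Cmd} {b : BExp} {s : State} {T T' : ℕ}
  {Q Q' : State → Prop}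

theorem mono (h : Runs pr B c s T Q) (hT : T ≤ T') (hQ : ∀ s', Q s' → Q' s') :
    Runs pr B c s T' Q' := by
  obtain ⟨s', t, h, ht, hq⟩ := h
  exact ⟨s', t, h, ht.trans hT, hQ _ hq⟩

theorem frame (hpw : WritesOK pr pw) (h : Runs pr B c s T Q) :
    Runs pr B c s T fun s' => Q s' ∧ Frame (c.writes pw) s s' := by
  obtain ⟨s', t, h, ht, hq⟩ := h
  exact ⟨s', t, h, ht, hq, h.frame hpw⟩

theorem seq (h : Runs pr B c s T fun s' => Runs pr B d s' T' Q) :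
    Runs pr B (.seq c d) s (T + T') Q := by
  obtain ⟨s', t, h, ht, s'', t', h', ht', hq⟩ := h
  exact ⟨s'', t + t', h.seq h', by omega, hq⟩

theorem cond (h : b.eval s → Runs pr B c s T Q) (h' : ¬ b.eval s → Runs pr B d s T Q) :
    Runs pr B (.cond b c d) s (b.size + 1 + T) Q := by
  by_cases hb : b.eval s
  · obtain ⟨s', t, h, ht, hq⟩ := h hb
    exact ⟨s', _, h.condTrue hb, by omega, hq⟩
  · obtain ⟨s', t, h, ht, hq⟩ := h' hb
    exact ⟨s', _, h.condFalse hb, by omega, hq⟩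

theorem call {j : ℕ} (hj : pr[j]? = some c) (h : Runs pr B c s T Q) :
    Runs pr B (.call j) s (T + 1) Q := by
  obtain ⟨s', t, h, ht, hq⟩ := h
  exact ⟨s', _, h.call hj, by omega, hq⟩

/-- Straight-line code has a cost that does not depend on the memory, up to the choice of branches,
for which `Cmd.cost` charges both. Loops and calls need no case, as their `wp` is `False`. -/
theorem of_wp : ∀ {c : Cmd} {s : State} {Q : State → Prop}, wp B c s Q → Runs pr B c s c.cost Q
  | .skip, s, Q, h => ⟨s, 1, .skip s, le_rfl, h⟩
  | .nset x e, s, Q, h => ⟨_, _, .nset s x e h.1, le_rfl, h.2⟩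
  | .rset x e, s, Q, h => ⟨_, _, .rset s x e, le_rfl, h⟩
  | .nput a i e, s, Q, h => ⟨_, _, .nput s a i e h.1, le_rfl, h.2⟩
  | .rput a i e, s, Q, h => ⟨_, _, .rput s a i e, le_rfl, h⟩
  | .seq c d, s, Q, h => by
    refine Runs.seq ?_
    exact (of_wp (c := c) h).mono le_rfl fun s' h' => of_wp h'
  | .cond b c d, s, Q, h =>
    Runs.cond (fun hb => (of_wp (h.1 hb)).mono (by omega) fun _ h => h)
      (fun hb => (of_wp (h.2 hb)).mono (by omega) fun _ h => h)

theorem seq' {T₀ : ℕ} (h : Runs pr B c s T Q') (h' : ∀ s', Q' s' → Runs pr B d s' T' Q)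
    (hT : T + T' ≤ T₀) : Runs pr B (.seq c d) s T₀ Q :=
  (Runs.seq (h.mono le_rfl h')).mono hT fun _ h => h

theorem straight (h : wp B c s Q) (hT : c.cost ≤ T) : Runs pr B c s T Q :=
  (of_wp h).mono hT fun _ h => h

/-- A loop whose `i`-th round leads from the invariant `I i` to `I (i + 1)`. -/
theorem loop_count (hpw : WritesOK pr pw) (I : ℕ → State → Prop) (N : ℕ)
    (hstep : ∀ i s', i < N → Frame (c.writes pw) s s' → I i s' →
      b.eval s' ∧ Runs pr B c s' T (I (i + 1)))
    (hend : ∀ s', Frame (c.writes pw) s s' → I N s' → ¬ b.eval s') (h0 : I 0 s) :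
    Runs pr B (.loop b c) s (N * (T + b.size + 1) + (b.size + 1))
      fun s' => I N s' ∧ Frame (c.writes pw) s s' := by
  -- Induction on the number `j` of rounds still to come. The frame relative to the initial memory
  -- is carried along so that `hstep` may use it.
  suffices H : ∀ j s', j ≤ N → Frame (c.writes pw) s s' → I (N - j) s' →
      Runs pr B (.loop b c) s' (j * (T + b.size + 1) + (b.size + 1))
        fun s' => I N s' ∧ Frame (c.writes pw) s s' from
    H N s le_rfl (Frame.refl _ _) (by simpa using h0)
  intro j
  induction j with
  | zero =>
    intro s' _ hf hI
    exact ⟨s', _, .loopFalse (hend s' hf hI), by omega, hI, hf⟩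
  | succ j ih =>
    intro s' hj hf hI
    obtain ⟨hb, hr⟩ := hstep _ s' (by omega) hf hI
    obtain ⟨s₁, t₁, h₁, ht₁, hI₁, hf₁⟩ := hr.frame hpw
    obtain ⟨s₂, t₂, h₂, ht₂, hQ⟩ := ih s₁ (by omega) (hf.trans hf₁)
      (by rwa [show N - (j + 1) + 1 = N - j by omega] at hI₁)
    exact ⟨s₂, _, .loopTrue hb h₁ h₂, by rw [Nat.add_mul, one_mul]; omega, hQ⟩

/-- A loop with a decreasing measure. -/
theorem loop_measure (hpw : WritesOK pr pw) (I : State → Prop) (μ : State → ℕ)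
    (hstep : ∀ s', Frame (c.writes pw) s s' → I s' → b.eval s' →
      Runs pr B c s' T fun s'' => I s'' ∧ μ s'' < μ s') (h0 : I s) :
    Runs pr B (.loop b c) s (μ s * (T + b.size + 1) + (b.size + 1))
      fun s' => (I s' ∧ ¬ b.eval s') ∧ Frame (c.writes pw) s s' := by
  suffices H : ∀ j s', μ s' ≤ j → Frame (c.writes pw) s s' → I s' →
      Runs pr B (.loop b c) s' (j * (T + b.size + 1) + (b.size + 1))
        fun s' => (I s' ∧ ¬ b.eval s') ∧ Frame (c.writes pw) s s' from
    H _ s le_rfl (Frame.refl _ _) h0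
  intro j
  induction j with
  | zero =>
    intro s' hj hf hI
    by_cases hb : b.eval s'
    · obtain ⟨_, _, _, _, _, h⟩ := hstep s' hf hI hb
      omega
    · exact ⟨s', _, .loopFalse hb, by omega, ⟨hI, hb⟩, hf⟩
  | succ j ih =>
    intro s' hj hf hI
    by_cases hb : b.eval s'
    · obtain ⟨s₁, t₁, h₁, ht₁, ⟨hI₁, hm⟩, hf₁⟩ := (hstep s' hf hI hb).frame hpw
      obtain ⟨s₂, t₂, h₂, ht₂, hQ⟩ := ih s₁ (by omega) (hf.trans hf₁) hI₁
      exact ⟨s₂, _, .loopTrue hb h₁ h₂, by rw [Nat.add_mul, one_mul]; omega, hQ⟩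
    · exact ⟨s', _, .loopFalse hb, by omega, ⟨hI, hb⟩, hf⟩

end Runs


/-! ### Sorting with a tournament tree -/

/-- The winner of the match between players `a` and `b`; players from `n` on always lose. -/
noncomputable def better (key : ℕ → ℝ) (n a b : ℕ) : ℕ :=
  open Classical in if a < n ∧ (n ≤ b ∨ key a ≤ key b) then a else b

/-- All inner nodes of the tree but `i` hold the winner of the match between their children. -/
def TreeOKBut (key : ℕ → ℝ) (n : ℕ) (w : ℕ → ℕ) (i : ℕ) : Prop :=
  ∀ j, 1 ≤ j → j < n → j ≠ i → w j = better key n (w (2 * j)) (w (2 * j + 1))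

theorem better_eq_or (key : ℕ → ℝ) (n a b : ℕ) : better key n a b = a ∨ better key n a b = b := by
  unfold better
  split_ifs <;> simp

theorem better_left {key : ℕ → ℝ} {n a b : ℕ} (ha : a < n) :
    better key n a b < n ∧ key (better key n a b) ≤ key a := by
  unfold better
  split_ifs with h
  · exact ⟨ha, le_rfl⟩
  · push Not at h
    exact ⟨(h ha).1, (h ha).2.le⟩

theorem better_right {key : ℕ → ℝ} {n a b : ℕ} (hb : b < n) :
    better key n a b < n ∧ key (better key n a b) ≤ key b := by
  unfold better
  split_ifs with h
  · exact ⟨h.1, h.2.resolve_left (by omega)⟩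
  · exact ⟨hb, le_rfl⟩

/-- On the way from a node up to the root the winners' keys can only decrease, and a player below
`n` is never beaten by an absent one. As `0` is not a node, the exception `0` means that all matches
are correct. -/
theorem TreeOKBut.root_le {key : ℕ → ℝ} {n : ℕ} {w : ℕ → ℕ} (h : TreeOKBut key n w 0) :
    ∀ j, 1 ≤ j → j < 2 * n → w j < n → w 1 < n ∧ key (w 1) ≤ key (w j) := by
  intro j
  induction j using Nat.strong_induction_on with
  | _ j ih =>
    intro h1 h2 hw
    rcases h1.eq_or_lt with rfl | h1
    · exact ⟨hw, le_rfl⟩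
    · have hp := h (j / 2) (by omega) (by omega) (by omega)
      have key : w (j / 2) < n ∧ key (w (j / 2)) ≤ key (w j) := by
        rw [hp]
        rcases Nat.even_or_odd' j with ⟨a, rfl | rfl⟩
        · rw [show 2 * a / 2 = a by omega]
          exact better_left hw
        · rw [show (2 * a + 1) / 2 = a by omega]
          exact better_right hw
      obtain ⟨h3, h4⟩ := ih (j / 2) (by omega) (by omega) (by omega) key.1
      exact ⟨h3, h4.trans key.2⟩

/-- Every inner node copies one of its children, so each entry descends from a leaf, and a leaf
holds its own player or the dummy `n`. The induction runs downwards from the largest index, with `d`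
bounding the distance to `2 n`. -/
theorem TreeOKBut.leaf {key : ℕ → ℝ} {n : ℕ} {w : ℕ → ℕ} (h : TreeOKBut key n w 0)
    (hl : ∀ x, x < n → w (n + x) = x ∨ w (n + x) = n) :
    ∀ d j, 1 ≤ j → j < 2 * n → 2 * n ≤ j + d → w j = n ∨ (w j < n ∧ w (n + w j) = w j) := by
  intro d
  induction d with
  | zero => intro j; omega
  | succ d ih =>
    intro j h1 h2 h3
    by_cases hj : j < n
    · rw [h j h1 hj (by omega)]
      rcases better_eq_or key n (w (2 * j)) (w (2 * j + 1)) with h | h <;> rw [h] <;>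
        exact ih _ (by omega) (by omega) (by omega)
    · rcases hl (j - n) (by omega) with h | h <;> rw [show n + (j - n) = j by omega] at h
      · right
        rw [h]
        refine ⟨by omega, ?_⟩
        rw [show n + (j - n) = j by omega, h]
      · exact .inl h

/-- Recompute tree node `nvar 30`; the keys are in real array `e`. -/
def sortCombine (e : ℕ) : Cmd :=
  .nset 33 (.get 20 (2 * nvar 30)) ;; .nset 34 (.get 20 (2 * nvar 30 + 1)) ;;
  .cond (.and (.not (.nle (nvar 0) (nvar 33)))
      (.or (.nle (nvar 0) (nvar 34)) (.rle (.get e (nvar 33)) (.get e (nvar 34)))))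
    (.nput 20 (nvar 30) (nvar 33)) (.nput 20 (nvar 30) (nvar 34))

theorem sortCombine_runs {pr : List Cmd} {B e n i : ℕ} {s : State} (hn : s.nv 0 = n)
    (hi : s.nv 30 = i) (h1 : s.na 20 (2 * i) ≤ B) (h2 : s.na 20 (2 * i + 1) ≤ B) :
    Runs pr B (sortCombine e) s 40 fun s' =>
      (∀ x, s'.na 20 x = if x = i then better (s.ra e) n (s.na 20 (2 * i)) (s.na 20 (2 * i + 1))
        else s.na 20 x) ∧ s'.nv 30 = i := by
  refine Runs.mono (Runs.of_wp (Q := _) ?_) (Nat.le_of_ble_eq_true rfl) fun _ h => h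
  simp only [sortCombine, wp]
  simp [hn, hi, h1, h2]
  constructor
  · intro h h' x
    have : better (s.ra e) n (s.na 20 (2 * i)) (s.na 20 (2 * i + 1)) = s.na 20 (2 * i) :=
      if_pos ⟨h, h'⟩
    rw [this]
  · intro h x
    have : better (s.ra e) n (s.na 20 (2 * i)) (s.na 20 (2 * i + 1)) = s.na 20 (2 * i + 1) :=
      if_neg fun h' => by
        obtain ⟨h1, h2⟩ := h h'.1
        rcases h'.2 with h3 | h3
        · omega
        · exact absurd h3 (not_le.2 h2)
    rw [this]

/-- Recompute the ancestors of tree node `nvar 30`. -/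
def sortClimb (e : ℕ) : Cmd :=
  .loop (.nle 2 (nvar 30)) (.nset 30 (nvar 30 / 2) ;; sortCombine e)

section

variable {pr : List Cmd} {pw : ℕ → List ℕ} (hpw : WritesOK pr pw)
include hpw

/-- Invariant: only the parent of the current node may hold a wrong winner. Recomputing that parent
moves the defect one level up, until the current node is `1`, whose "parent" `1 / 2 = 0` is no node.
The binary logarithm of the node index serves as measure. -/
theorem sortClimb_runs {B e n : ℕ} {s : State} (he : e < 2) (hB : 2 * n ≤ B) (hn : s.nv 0 = n)
    (hi : 1 ≤ s.nv 30) (hi' : s.nv 30 < 2 * n)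
    (hT : TreeOKBut (s.ra e) n (s.na 20) (s.nv 30 / 2))
    (hw : ∀ y, 1 ≤ y → y < 2 * n → s.na 20 y ≤ n) :
    Runs pr B (sortClimb e) s (Nat.log 2 (2 * n) * 48 + 4) fun s' =>
      (TreeOKBut (s.ra e) n (s'.na 20) 0 ∧ (∀ y, n ≤ y → s'.na 20 y = s.na 20 y)) ∧
        Frame [120, 132, 136, 82, 82] s s' := by
  have H := Runs.loop_measure (pr := pr) (B := B) (b := .nle 2 (nvar 30))
    (c := .nset 30 (nvar 30 / 2) ;; sortCombine e) (s := s) (T := 44) hpw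
    (fun s' => (1 ≤ s'.nv 30 ∧ s'.nv 30 < 2 * n ∧
      TreeOKBut (s.ra e) n (s'.na 20) (s'.nv 30 / 2) ∧
      (∀ y, 1 ≤ y → y < 2 * n → s'.na 20 y ≤ n) ∧ (∀ y, n ≤ y → s'.na 20 y = s.na 20 y)))
    (fun s' => Nat.log 2 (s'.nv 30)) ?_ ⟨hi, hi', hT, hw, fun _ _ => rfl⟩
  · refine H.mono ?_ ?_
    · have : Nat.log 2 (s.nv 30) ≤ Nat.log 2 (2 * n) := Nat.log_mono_right hi'.le
      change _ * 48 + 4 ≤ _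
      gcongr
    · rintro s' ⟨⟨⟨h1, h2, h3, h4, h5⟩, h6⟩, h7⟩
      have : s'.nv 30 = 1 := by simp at h6; omega
      rw [this] at h3
      exact ⟨⟨h3, h5⟩, h7⟩
  · rintro s' hf ⟨h1, h2, h3, h4, h5⟩ hb
    have hf : Frame [120, 132, 136, 82, 82] s s' := hf
    simp only [BExp.eval_nle, NExp.eval_ofNat, NExp.eval_var'] at hb
    have hra : s'.ra e = s.ra e := by
      apply hf.ra; simp; omega
    have hn' : s'.nv 0 = n := by rw [hf.nv 0 (by decide), hn]
    refine Runs.seq (T := 4) (T' := 40) (Runs.mono (Runs.of_wp (Q := fun s₁ => s₁ = s'.setN 30 (s'.nv 30 / 2)) ?_) le_rfl ?_)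
    · simp [wp]; omega
    · rintro _ rfl
      set i := s'.nv 30 with hidef
      refine (sortCombine_runs (n := n) (i := i / 2) (by simpa using hn') (by simp) ?_ ?_).mono
        le_rfl ?_
      · simp only [State.na_setN]
        have := h4 (2 * (i / 2)) (by omega) (by omega)
        omega
      · simp only [State.na_setN]
        have := h4 (2 * (i / 2) + 1) (by omega) (by omega)
        omega
      · rintro s₂ ⟨hs, hi2⟩
        simp only [State.na_setN, State.ra_setN, hra] at hs
        refine ⟨⟨by omega, by omega, ?_, ?_, ?_⟩, ?_⟩
        · rw [hi2]
          intro j hj1 hj2 hj3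
          rw [hs, hs, hs]
          by_cases hji : j = i / 2
          · subst hji
            rw [if_pos rfl, if_neg (by omega), if_neg (by omega)]
          · rw [if_neg hji, if_neg (by omega), if_neg (by omega)]
            exact h3 j hj1 hj2 hji
        · intro y hy1 hy2
          rw [hs]
          split_ifs
          · rcases better_eq_or (s.ra e) n (s'.na 20 (2 * (i / 2))) (s'.na 20 (2 * (i / 2) + 1))
              with h | h <;> rw [h] <;> exact h4 _ (by omega) (by omega)
          · exact h4 y hy1 hy2
        · intro y hy
          rw [hs, if_neg (by omega), h5 y hy]
        · rw [hi2]
          have := Nat.log_div_base 2 i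
          have := Nat.log_pos (b := 2) (by norm_num) hb
          omega

/-- Build the tournament tree for real array `e`. -/
def sortBuild (e : ℕ) : Cmd :=
  .nset 30 0 ;;
  .loop (.not (.nle (nvar 0) (nvar 30)))
    (.nput 20 (nvar 0 + nvar 30) (nvar 30) ;; .nset 30 (nvar 30 + 1)) ;;
  .loop (.nle 2 (nvar 30)) (.nset 30 (nvar 30 - 1) ;; sortCombine e)

/-- Inner nodes are computed from `n - 1` down to `1`. The children `2 i` and `2 i + 1` have larger
indices and are already correct. -/
theorem sortBuild_runs {B e n : ℕ} {s : State} (he : e < 2) (hB : 2 * n ≤ B) (hn : s.nv 0 = n)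
    (hn1 : 1 ≤ n) :
    Runs pr B (sortBuild e) s (n * 64 + 11) fun s' =>
      TreeOKBut (s.ra e) n (s'.na 20) 0 ∧ (∀ x, x < n → s'.na 20 (n + x) = x) := by
  refine Runs.mono (Runs.seq (T := 2) (T' := (n * 14 + 5) + (n * 48 + 4)) (Runs.mono
    (Runs.of_wp (Q := fun s₁ => s₁ = s.setN 30 0) (by simp [wp])) le_rfl ?_)) (by omega)
    fun _ h => h
  rintro s₁ rfl
  refine Runs.seq ?_
  refine (Runs.loop_count (T := 9) hpw (fun i s' => s'.nv 30 = i ∧ ∀ x, x < i → s'.na 20 (n + x) = x)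
    n ?_ ?_ (by simp)).mono (by exact le_of_eq rfl) ?_
  · intro i s' hi hf ⟨h1, h2⟩
    have hn' : s'.nv 0 = n := by rw [hf.nv 0 (by simp [Cmd.writes])]; simpa using hn
    refine ⟨by simp [h1, hn', hi], Runs.mono (Runs.of_wp ?_) (Nat.le_of_ble_eq_true rfl)
      fun _ h => h⟩
    simp [wp, h1, hn']
    refine ⟨by omega, by omega, fun x hx => ?_⟩
    split_ifs with h
    · exact h.symm
    · exact h2 x (by omega)
  · intro s' hf ⟨h1, h2⟩
    have hn' : s'.nv 0 = n := by rw [hf.nv 0 (by simp [Cmd.writes])]; simpa using hn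
    simp [h1, hn']
  · rintro s₂ ⟨⟨hi, hl⟩, hf⟩
    have hn' : s₂.nv 0 = n := by rw [hf.nv 0 (by simp [Cmd.writes])]; simpa using hn
    have hra : s₂.ra e = s.ra e := by
      rw [hf.ra e (by simp [Cmd.writes]; omega)]; simp
    have H := Runs.loop_measure (pr := pr) (B := B) (b := .nle 2 (nvar 30))
      (c := .nset 30 (nvar 30 - 1) ;; sortCombine e) (s := s₂) (T := 44) hpw
      (fun s' => (1 ≤ s'.nv 30 ∧ s'.nv 30 ≤ n ∧
        (∀ j, s'.nv 30 ≤ j → j < n →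
          s'.na 20 j = better (s.ra e) n (s'.na 20 (2 * j)) (s'.na 20 (2 * j + 1))) ∧
        (∀ y, s'.nv 30 ≤ y → y < 2 * n → s'.na 20 y ≤ n) ∧
        (∀ x, x < n → s'.na 20 (n + x) = x)))
      (fun s' => s'.nv 30) ?_ ⟨by omega, by omega, by intros; omega, ?_, hl⟩
    · refine H.mono (by rw [hi]; exact le_of_eq rfl) ?_
      rintro s' ⟨⟨⟨h1, h2, h3, h4, h5⟩, h6⟩, h7⟩
      simp at h6
      exact ⟨fun j hj1 hj2 _ => h3 j (by omega) hj2, h5⟩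
    · rintro s' hf ⟨h1, h2, h3, h4, h5⟩ hb
      have hf : Frame [120, 132, 136, 82, 82] s₂ s' := hf
      simp only [BExp.eval_nle, NExp.eval_ofNat, NExp.eval_var'] at hb
      have hra : s'.ra e = s.ra e := by
        rw [← hra]; apply hf.ra; simp; omega
      have hn' : s'.nv 0 = n := by rw [hf.nv 0 (by decide), hn']
      refine Runs.seq (T := 4) (T' := 40) (Runs.mono (Runs.of_wp
        (Q := fun s₁ => s₁ = s'.setN 30 (s'.nv 30 - 1)) ?_) le_rfl ?_)
      · simp [wp]; omega
      · rintro _ rfl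
        set i := s'.nv 30 with hidef
        refine (sortCombine_runs (n := n) (i := i - 1) (by simpa using hn') (by simp) ?_ ?_).mono
          le_rfl ?_
        · simp only [State.na_setN]
          have := h4 (2 * (i - 1)) (by omega) (by omega)
          omega
        · simp only [State.na_setN]
          have := h4 (2 * (i - 1) + 1) (by omega) (by omega)
          omega
        · rintro s₃ ⟨hs, hi2⟩
          simp only [State.na_setN, State.ra_setN, hra] at hs
          refine ⟨⟨by omega, by omega, ?_, ?_, ?_⟩, by omega⟩
          · rw [hi2]
            intro j hj1 hj2
            rw [hs, hs, hs]
            by_cases hji : j = i - 1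
            · subst hji
              rw [if_pos rfl, if_neg (by omega), if_neg (by omega)]
            · rw [if_neg hji, if_neg (by omega), if_neg (by omega)]
              exact h3 j (by omega) hj2
          · rw [hi2]
            intro y hy1 hy2
            rw [hs]
            split_ifs
            · rcases better_eq_or (s.ra e) n (s'.na 20 (2 * (i - 1))) (s'.na 20 (2 * (i - 1) + 1))
                with h | h <;> rw [h] <;> exact h4 _ (by omega) (by omega)
            · exact h4 y (by omega) hy2
          · intro y hy
            rw [hs, if_neg (by omega), h5 y hy]
    · intro y hy1 hy2
      have := hl (y - n) (by omega)
      rw [show n + (y - n) = y by omega] at this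
      omega

/-- Extract all players in the order of their keys. The player of rank `j` goes to cell `e * n + j`
of array `0`, the rank of player `x` to cell `e * n + x` of array `1`. -/
def sortExtract (e : ℕ) : Cmd :=
  .nset 31 0 ;;
  .loop (.not (.nle (nvar 0) (nvar 31)))
    ((.nset 32 (.get 20 1) ;;
      .nput 0 (.lit e * nvar 0 + nvar 31) (nvar 32) ;;
      .nput 1 (.lit e * nvar 0 + nvar 32) (nvar 31) ;;
      .nset 30 (nvar 0 + nvar 32) ;;
      .nput 20 (nvar 30) (nvar 0)) ;;
    sortClimb e ;;
    .nset 31 (nvar 31 + 1))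

-- Pigeonhole: if all `n` players had been removed, their ranks would be `n` distinct numbers below
-- `j < n`.
omit hpw in
theorem exists_player {n j : ℕ} (hj : j < n) {w L R : ℕ → ℕ}
    (hl : ∀ x, x < n → w (n + x) = x ∨ w (n + x) = n)
    (h2 : ∀ x, x < n → w (n + x) = n → R x < j ∧ L (R x) = x) :
    ∃ x, x < n ∧ w (n + x) = x := by
  by_contra! h
  have hR : ∀ x, x < n → R x < j ∧ L (R x) = x := fun x hx =>
    h2 x hx ((hl x hx).resolve_left (h x hx))
  have := Finset.card_le_card_of_injOn (s := Finset.range n) (t := Finset.range j) R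
    (fun x hx => by simpa using (hR x (by simpa using hx)).1)
    (fun x hx y hy hxy => by
      rw [← (hR x (by simpa using hx)).2, ← (hR y (by simpa using hy)).2, hxy])
  simp at this
  omega

/-- `L` lists `0, …, n - 1` in the order of their keys, and `R` is its inverse. -/
structure IsSorting (key : ℕ → ℝ) (n : ℕ) (L R : ℕ → ℕ) : Prop where
  lt : ∀ j, j < n → L j < n
  rank_lt : ∀ x, x < n → R x < n
  rank_list : ∀ j, j < n → R (L j) = j
  list_rank : ∀ x, x < n → L (R x) = x
  mono : ∀ i j, i ≤ j → j < n → key (L i) ≤ key (L j)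

/-- Selection sort. The invariant says that the lists `0` and `1` are inverse to each other on the
extracted players, that the extracted keys are ascending, and that they are at most every remaining
key. Extracted leaves carry the dummy `n`. -/
theorem sortExtract_runs {B e n : ℕ} {s : State} (he : e < 2) (hB : 2 * n ≤ B) (hn : s.nv 0 = n)
    (hT : TreeOKBut (s.ra e) n (s.na 20) 0) (hl : ∀ x, x < n → s.na 20 (n + x) = x) :
    Runs pr B (sortExtract e) s (2 + (n * (Nat.log 2 (2 * n) * 48 + 46) + 5)) fun s' =>
      IsSorting (s.ra e) n (fun j => s'.na 0 (e * n + j)) (fun j => s'.na 1 (e * n + j)) ∧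
      ∀ y, y < e * n ∨ e * n + n ≤ y → s'.na 0 y = s.na 0 y ∧ s'.na 1 y = s.na 1 y := by
  refine Runs.seq' (T := 2) (Runs.straight (Q := fun s₁ => s₁ = s.setN 31 0) (by simp [wp])
    (Nat.le_of_ble_eq_true rfl)) ?_ le_rfl
  rintro s₁ rfl
  refine (Runs.loop_count (T := 37 + Nat.log 2 (2 * n) * 48 + 4) hpw (fun j s' =>
    s'.nv 31 = j ∧ TreeOKBut (s.ra e) n (s'.na 20) 0 ∧
    (∀ x, x < n → s'.na 20 (n + x) = x ∨ s'.na 20 (n + x) = n) ∧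
    (∀ i, i < j → s'.na 0 (e * n + i) < n ∧ s'.na 1 (e * n + s'.na 0 (e * n + i)) = i ∧
      s'.na 20 (n + s'.na 0 (e * n + i)) = n) ∧
    (∀ x, x < n → s'.na 20 (n + x) = n → s'.na 1 (e * n + x) < j ∧
      s'.na 0 (e * n + s'.na 1 (e * n + x)) = x) ∧
    (∀ i, i < j → ∀ x, x < n → s'.na 20 (n + x) = x →
      s.ra e (s'.na 0 (e * n + i)) ≤ s.ra e x) ∧
    (∀ i i', i ≤ i' → i' < j → s.ra e (s'.na 0 (e * n + i)) ≤ s.ra e (s'.na 0 (e * n + i'))) ∧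
    ∀ y, y < e * n ∨ e * n + n ≤ y → s'.na 0 y = s.na 0 y ∧ s'.na 1 y = s.na 1 y)
    n ?_ ?_ ?_).mono (by simp [BExp.size, NExp.size]; ring_nf; omega) ?_
  · rintro j s' hj hf ⟨h31, h1, h2, h3, h4, h5, h6, h7⟩
    have hf : Frame [128, 2, 6, 120, 82, 120, 132, 136, 82, 82, 124] (s.setN 31 0) s' := hf
    have hn' : s'.nv 0 = n := by rw [hf.nv 0 (by decide)]; simpa using hn
    have hra : s'.ra e = s.ra e := by rw [hf.ra e (by simp; omega)]; simp
    refine ⟨by simp [h31, hn', hj], ?_⟩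
    -- Some player is left, hence the root does not hold the dummy.
    obtain ⟨x₀, hx₀, hwx₀⟩ := exists_player (R := fun y => s'.na 1 (e * n + y))
      (L := fun y => s'.na 0 (e * n + y)) hj h2 h4
    have hroot := h1.root_le (n + x₀) (by omega) (by omega) (by omega)
    have hleaf := h1.leaf h2 (2 * n)
    set x := s'.na 20 1 with hx
    have hxx : s'.na 20 (n + x) = x := by
      rcases hleaf 1 le_rfl (by omega) (by omega) with h | h
      · omega
      · exact h.2
    have hmin : ∀ y, y < n → s'.na 20 (n + y) = y → s.ra e x ≤ s.ra e y := by
      intro y hy hwy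
      have := (h1.root_le (n + y) (by omega) (by omega) (by omega)).2
      rwa [hwy] at this
    refine Runs.seq' (T := 33) (T' := Nat.log 2 (2 * n) * 48 + 8) (Runs.straight (Q := fun s₁ =>
      s₁.nv 0 = n ∧ s₁.nv 31 = j ∧ s₁.nv 30 = n + x ∧ s₁.ra e = s.ra e ∧
      (∀ y, s₁.na 0 y = if y = e * n + j then x else s'.na 0 y) ∧
      (∀ y, s₁.na 1 y = if y = e * n + x then j else s'.na 1 y) ∧
      (∀ y, s₁.na 20 y = if y = n + x then n else s'.na 20 y)) ?_
        (Nat.le_of_ble_eq_true rfl)) ?_ (by omega)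
    · simp [wp, hn', h31, ← hx, hra]
      omega
    · rintro s₁ ⟨k1, k2, k3, k4, k5, k6, k7⟩
      refine Runs.seq' (T' := 4) (sortClimb_runs hpw he hB k1 (by omega) (by omega) ?_ ?_)
        ?_ (by omega)
      · intro i hi1 hi2 hi3
        rw [k7, k7, k7, k4, if_neg (by omega), if_neg (by omega), if_neg (by omega)]
        exact h1 i hi1 hi2 (by omega)
      · intro y hy1 hy2
        rw [k7]
        split_ifs
        · exact le_rfl
        · rcases hleaf y hy1 hy2 (by omega) with h | h <;> omega
      · rintro s₂ ⟨⟨l1, l2⟩, hf₂⟩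
        refine Runs.straight ?_ (Nat.le_of_ble_eq_true rfl)
        have hw : ∀ y, y < n → s₂.na 20 (n + y) = if y = x then n else s'.na 20 (n + y) := by
          intro y hy
          rw [l2 _ (by omega), k7]
          simp
        rw [k4] at l1
        simp only [wp, NExp.eval_add', NExp.eval_var', NExp.eval_ofNat, State.nv_setN,
          State.na_setN, hf₂.nv 31 (by decide), k2, hf₂.na 0 (by decide), hf₂.na 1 (by decide), k5,
          k6, if_true]
        refine ⟨by omega, trivial, l1, ?_, ?_, ?_, ?_, ?_, ?_⟩
        · intro y hy
          rw [hw y hy]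
          split_ifs
          · exact .inr rfl
          · exact h2 y hy
        · intro i hi
          by_cases hij : i = j
          · subst hij
            simp only [if_true, true_and]
            exact ⟨hroot.1, by rw [hw _ hroot.1, if_pos rfl]⟩
          · obtain ⟨m1, m2, m3⟩ := h3 i (by omega)
            have hne : s'.na 0 (e * n + i) ≠ x := by
              intro h; rw [h, hxx] at m3; omega
            rw [if_neg (by omega), if_neg (by omega), hw _ m1, if_neg hne]
            exact ⟨m1, m2, m3⟩
        · intro y hy hwy
          rw [hw y hy] at hwy
          by_cases hyx : y = x
          · subst hyx
            simp
          · rw [if_neg hyx] at hwy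
            obtain ⟨m1, m2⟩ := h4 y hy hwy
            rw [if_neg (by omega), if_neg (by omega)]
            exact ⟨by omega, m2⟩
        · intro i hi y hy hwy
          rw [hw y hy] at hwy
          have hyx : y ≠ x := by rintro rfl; simp at hwy; omega
          rw [if_neg hyx] at hwy
          by_cases hij : i = j
          · rw [if_pos (by omega)]
            exact hmin y hy hwy
          · rw [if_neg (by omega)]
            exact h5 i (by omega) y hy hwy
        · intro i i' hii hi'
          by_cases hij' : i' = j
          · subst hij'
            rw [if_pos rfl]
            by_cases hij : i = i'
            · rw [if_pos (by omega)]
            · rw [if_neg (by omega)]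
              exact h5 i (by omega) x hroot.1 hxx
          · rw [if_neg (by omega), if_neg (by omega)]
            exact h6 i i' hii (by omega)
        · intro y hy
          rw [if_neg (by omega), if_neg (by omega)]
          exact h7 y hy
  · rintro s' hf ⟨h31, -⟩
    have hf : Frame [128, 2, 6, 120, 82, 120, 132, 136, 82, 82, 124] (s.setN 31 0) s' := hf
    have hn' : s'.nv 0 = n := by rw [hf.nv 0 (by decide)]; simpa using hn
    simp [hn', h31]
  · refine ⟨by simp, by simpa using hT, fun x hx => .inl (by simpa using hl x hx), by simp, ?_,
      by simp, by simp, by simp⟩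
    intro x hx h
    simp only [State.na_setN, hl x hx] at h
    omega
  · rintro s' ⟨⟨h31, h1, h2, h3, h4, h5, h6, h7⟩, hf⟩
    refine ⟨?_, h7⟩
    -- The `n` extracted players are distinct and below `n`, so they are all of them.
    have hsurj : ∀ x, x < n → ∃ i, i < n ∧ s'.na 0 (e * n + i) = x := by
      intro x hx
      have := Finset.surj_on_of_inj_on_of_card_le (s := Finset.range n) (t := Finset.range n)
        (fun i _ => s'.na 0 (e * n + i)) (fun i hi => by simpa using (h3 i (by simpa using hi)).1)
        (fun i i' hi hi' h => by
          rw [← (h3 i (by simpa using hi)).2.1, h, (h3 i' (by simpa using hi')).2.1]) le_rfl x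
        (by simpa using hx)
      obtain ⟨i, hi, h⟩ := this
      exact ⟨i, by simpa using hi, h.symm⟩
    have hrem : ∀ x, x < n → s'.na 20 (n + x) = n := by
      intro x hx
      obtain ⟨i, hi, rfl⟩ := hsurj x hx
      exact (h3 i hi).2.2
    exact ⟨fun j hj => (h3 j hj).1, fun x hx => (h4 x hx (hrem x hx)).1,
      fun j hj => (h3 j hj).2.1, fun x hx => (h4 x hx (hrem x hx)).2, h6⟩

/-- Sort the points by the keys in real array `e`. -/
def sortPoints (e : ℕ) : Cmd := sortBuild e ;; sortExtract e

omit hpw in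
theorem sortPoints_writes (pw : ℕ → List ℕ) (e : ℕ) : (sortPoints e).writes pw =
    [120, 82, 120, 120, 132, 136, 82, 82, 124, 128, 2, 6, 120, 82, 120, 132, 136, 82, 82, 124] :=
  rfl

theorem sortPoints_runs {B e n : ℕ} {s : State} (he : e < 2) (hB : 2 * n ≤ B) (hn : s.nv 0 = n)
    (hn1 : 1 ≤ n) :
    Runs pr B (sortPoints e) s (n * (Nat.log 2 (2 * n) * 48 + 110) + 18) fun s' =>
      IsSorting (s.ra e) n (fun j => s'.na 0 (e * n + j)) (fun j => s'.na 1 (e * n + j)) ∧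
      ∀ y, y < e * n ∨ e * n + n ≤ y → s'.na 0 y = s.na 0 y ∧ s'.na 1 y = s.na 1 y := by
  refine Runs.seq' ((sortBuild_runs hpw he hB hn hn1).frame hpw) ?_
    (T' := 2 + (n * (Nat.log 2 (2 * n) * 48 + 46) + 5)) (by ring_nf; omega)
  rintro s₁ ⟨⟨h1, h2⟩, hf⟩
  have hf : Frame [120, 82, 120, 120, 132, 136, 82, 82] s s₁ := hf
  have hra : s₁.ra e = s.ra e := by apply hf.ra; simp; omega
  rw [← hra] at h1 ⊢
  refine (sortExtract_runs hpw he hB (by rw [hf.nv 0 (by decide), hn]) h1 h2).mono le_rfl ?_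
  rintro s₂ ⟨h3, h4⟩
  refine ⟨h3, fun y hy => ?_⟩
  rw [← hf.na 0 (by decide), ← hf.na 1 (by decide)]
  exact h4 y hy

end


/-! ### Counted loops -/

/-- Run `c` for `x = 0, …, e - 1`. -/
def forTo (x : ℕ) (e : NExp) (c : Cmd) : Cmd :=
  .nset x 0 ;; .loop (.not (.nle e (nvar x))) (c ;; .nset x (nvar x + 1))

/-- The bound `e` is evaluated anew in every test, so `he` asks for its value in all memories that
the loop can produce. The invariant is required after the counter has been advanced, which `hx`
makes harmless for the body. -/
theorem forTo_runs {pr : List Cmd} {pw : ℕ → List ℕ} (hpw : WritesOK pr pw) {B x N T T₀ : ℕ} {e : NExp}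
    {c : Cmd} {s : State} (I : ℕ → State → Prop) (hx : 4 * x ∉ c.writes pw) (hB : N ≤ B)
    (he : ∀ s', Frame ((forTo x e c).writes pw) s s' → e.eval s' = N)
    (h0 : I 0 (s.setN x 0))
    (hstep : ∀ i s', i < N → Frame ((forTo x e c).writes pw) s s' → s'.nv x = i → I i s' →
      Runs pr B c s' T fun s'' => I (i + 1) (s''.setN x (i + 1)))
    (hT : N * (T + e.size + 8) + (e.size + 6) ≤ T₀) :
    Runs pr B (forTo x e c) s T₀
      fun s' => I N s' ∧ s'.nv x = N ∧ Frame ((forTo x e c).writes pw) s s' := by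
  have hW : (forTo x e c).writes pw = [4 * x] ++ (c.writes pw ++ [4 * x]) := rfl
  have hf0 : Frame ((forTo x e c).writes pw) s (s.setN x 0) := by
    refine ⟨fun y hy => ?_, fun _ _ => rfl, fun _ _ => rfl, fun _ _ => rfl⟩
    have : y ≠ x := by rintro rfl; simp [hW] at hy
    simp [this]
  have hsub : (c ;; .nset x (nvar x + 1)).writes pw ⊆ (forTo x e c).writes pw := by
    rw [hW]; exact List.subset_append_right _ _
  refine Runs.seq' (T := 2) (Runs.straight (Q := fun s₁ => s₁ = s.setN x 0) (by simp [wp]) le_rfl)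
    (T' := N * (T + e.size + 8) + (e.size + 4)) ?_ (le_trans (by omega) hT)
  rintro _ rfl
  refine (Runs.loop_count (T := T + 4) hpw (fun i s' => s'.nv x = i ∧ I i s') N ?_ ?_
    ⟨by simp, h0⟩).mono ?_ ?_
  · rintro i s' hi hf ⟨h1, h2⟩
    have hf' := hf0.trans (hf.mono hsub)
    refine ⟨by simp [he s' hf', h1, hi], ?_⟩
    refine Runs.seq' ((hstep i s' hi hf' h1 h2).frame hpw) (T' := 4) ?_ le_rfl
    rintro s₁ ⟨h3, hf₁⟩
    refine Runs.straight ?_ le_rfl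
    have : s₁.nv x = i := by rw [hf₁.nv x hx, h1]
    simp only [wp, NExp.eval_add', NExp.eval_var', this, NExp.eval_ofNat]
    exact ⟨by omega, by simp, h3⟩
  · rintro s' hf ⟨h1, -⟩
    simp [he s' (hf0.trans (hf.mono hsub)), h1]
  · change N * (T + 4 + (e.size + 1 + 1 + 1) + 1) + (e.size + 1 + 1 + 1 + 1) ≤ _
    apply le_of_eq; ring
  · rintro s' ⟨⟨h1, h2⟩, hf⟩
    exact ⟨h2, h1, hf0.trans (hf.mono hsub)⟩

end RealRAM

/-! ### Intervals with many live points -/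

section Count

variable {A A' V V' : ℕ → Prop} [DecidablePred A] [DecidablePred A'] [DecidablePred V]
  [DecidablePred V']

theorem Nat.exists_count_eq {i m : ℕ} (h : i < Nat.count A m) :
    ∃ r, r < m ∧ A r ∧ Nat.count A r = i := by
  induction m with
  | zero => simp at h
  | succ m ih =>
    rw [Nat.count_succ] at h
    by_cases h' : i < Nat.count A m
    · obtain ⟨r, hr, h⟩ := ih h'
      exact ⟨r, by omega, h⟩
    · split_ifs at h with hA
      · exact ⟨m, by omega, hA, by omega⟩
      · omega

/-- Equal counts mean that no point of `A` lies between `x` and `y`, hence none of the smaller set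
`A'`. Thus numbers of surviving or deleted active points depend only on the position relative to the
active points. -/
theorem Nat.count_eq_of_count_eq (hA : ∀ r, A' r → A r) {x y : ℕ}
    (h : Nat.count A x = Nat.count A y) : Nat.count A' x = Nat.count A' y := by
  wlog hxy : x ≤ y generalizing x y
  · exact (this h.symm (by omega)).symm
  obtain ⟨d, rfl⟩ := Nat.exists_eq_add_of_le hxy
  clear hxy
  induction d with
  | zero => rfl
  | succ d ih =>
    have h1 : Nat.count A x ≤ Nat.count A (x + d) := Nat.count_monotone A (by omega)
    rw [← Nat.add_assoc] at h ⊢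
    rw [Nat.count_succ] at h ⊢
    split_ifs at h with h2
    · omega
    · rw [if_neg fun h3 => h2 (hA _ h3), ih h, Nat.add_zero]

theorem Nat.count_lt_count {r x : ℕ} (hr : A r) (h : r < x) : Nat.count A r < Nat.count A x :=
  Nat.count_strict_mono hr h

/-- The position of point `p` relative to the active points: `2 i` in the gap before the `i`-th
active point, `2 i + 1` at the `i`-th active point. -/
def activePos (A : ℕ → Prop) [DecidablePred A] (p : ℕ) : ℕ :=
  2 * Nat.count A p + if A p then 1 else 0

theorem activePos_div (p : ℕ) : activePos A p / 2 = Nat.count A p := by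
  unfold activePos
  split_ifs <;> omega

theorem activePos_mono {p p' : ℕ} (h : p ≤ p') : activePos A p ≤ activePos A p' := by
  rcases h.eq_or_lt with rfl | h
  · exact le_rfl
  · have h1 : Nat.count A p ≤ Nat.count A p' := Nat.count_monotone A h.le
    unfold activePos
    by_cases hp : A p
    · have := Nat.count_lt_count hp h
      rw [if_pos hp]; omega
    · rw [if_neg hp]; omega

theorem activePos_le {p m : ℕ} (h : p < m) : activePos A p ≤ 2 * Nat.count A m := by
  have h1 : Nat.count A p ≤ Nat.count A m := Nat.count_monotone A h.le
  unfold activePos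
  by_cases hp : A p
  · have := Nat.count_lt_count hp h
    rw [if_pos hp]; omega
  · rw [if_neg hp]; omega

/-- `xl, xr` are the ends of an interval from a live point at position `P - 1` to a live point at
position `u - (P - 1)` that contains `k + T` live points. -/
def IsLiveInterval (m k : ℕ) (V A : ℕ → Prop) [DecidablePred V] [DecidablePred A] (X : ℕ → ℝ)
    (T u P : ℕ) (xl xr : ℝ) : Prop :=
  ∃ p q, p ≤ q ∧ q < m ∧ V p ∧ V q ∧ Nat.count V (q + 1) = Nat.count V p + k + T ∧
    P = activePos A p + 1 ∧ activePos A p + activePos A q = u ∧ xl = X p ∧ xr = X q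

variable {m k : ℕ} {X : ℕ → ℝ}

/-- Among intervals with equally many live points, one that starts later also ends later. Positions
are monotone, so both positions weakly increase, and an equal sum forces both to be equal. This
keeps the table two-dimensional although an interval has a surplus and two positions. -/
theorem IsLiveInterval.pos_eq {T u P P' : ℕ} {xl xr xl' xr' : ℝ}
    (h : IsLiveInterval m k V A X T u P xl xr) (h' : IsLiveInterval m k V A X T u P' xl' xr') :
    P = P' := by
  obtain ⟨p, q, -, -, hVp, hVq, hc, rfl, hu, -, -⟩ := h
  obtain ⟨p', q', -, -, hVp', hVq', hc', rfl, hu', -, -⟩ := h'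
  have key : ∀ {p q p' q' : ℕ}, V q → V q' → Nat.count V (q + 1) = Nat.count V p + k + T →
      Nat.count V (q' + 1) = Nat.count V p' + k + T → p ≤ p' →
      activePos A p + activePos A q = activePos A p' + activePos A q' →
      activePos A p = activePos A p' := by
    intro p q p' q' hq hq' h h' hp hs
    have h1 : Nat.count V p ≤ Nat.count V p' := Nat.count_monotone V hp
    have h2 : q ≤ q' := by
      by_contra! h3
      have h4 : Nat.count V (q' + 1) ≤ Nat.count V q := Nat.count_monotone V h3
      have h5 := Nat.count_lt_count hq (Nat.lt_succ_self q)
      simp only [Nat.succ_eq_add_one] at h5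
      omega
    have h3 := activePos_mono (A := A) hp
    have h4 := activePos_mono (A := A) h2
    omega
  rcases le_total p p' with h | h
  · rw [key hVq hVq' hc hc' h (by omega)]
  · rw [key hVq' hVq hc' hc h (by omega)]

theorem IsLiveInterval.bounds {T u P : ℕ} {xl xr : ℝ}
    (h : IsLiveInterval m k V A X T u P xl xr) :
    1 ≤ P ∧ P ≤ u + 1 ∧ u ≤ 4 * Nat.count A m ∧ P ≤ 2 * Nat.count A m + 1 ∧
      u + 1 - P ≤ 2 * Nat.count A m := by
  obtain ⟨p, q, hpq, hq, -, -, -, rfl, rfl, -, -⟩ := h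
  have := activePos_le (A := A) hq
  have := activePos_le (A := A) (hpq.trans_lt hq)
  omega

/-- `G, tp, tl, tr` is a table of the shortest live intervals. -/
structure IsTable (m k : ℕ) (V A : ℕ → Prop) [DecidablePred V] [DecidablePred A] (X : ℕ → ℝ)
    (tp : ℕ → ℕ → ℕ) (tl tr : ℕ → ℕ → ℝ) : Prop where
  sound : ∀ T u, T ≤ Nat.count A m → u ≤ 4 * Nat.count A m → tp T u ≠ 0 →
    IsLiveInterval m k V A X T u (tp T u) (tl T u) (tr T u)
  complete : ∀ T u P xl xr, T ≤ Nat.count A m → IsLiveInterval m k V A X T u P xl xr →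
    tp T u ≠ 0 ∧ tr T u - tl T u ≤ xr - xl

/-- The relation between a node of the recursion and its child: some of the active points are
deleted, and others become permanent. -/
structure Refines (V A V' A' : ℕ → Prop) : Prop where
  live : ∀ r, V' r → V r
  act : ∀ r, A' r → A r
  act_live : ∀ r, A' r → V' r
  deleted : ∀ r, V r → ¬ V' r → A r
  act_live_old : ∀ r, A r → V r

/-- The tables of a refinement step: `nw` gives the new position plus one of a point in terms of its
old position, or `0` for deleted points, `dl` counts deleted points. -/
structure RefineTables (m : ℕ) (V A V' A' : ℕ → Prop) [DecidablePred V] [DecidablePred A]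
    [DecidablePred V'] [DecidablePred A'] (nw dl : ℕ → ℕ) : Prop where
  new : ∀ r, r < m → V' r → nw (activePos A r) = activePos A' r + 1
  del : ∀ r, r < m → V r → ¬ V' r → nw (activePos A r) = 0
  count : ∀ r, r < m → dl (Nat.count A r) = Nat.count (fun r => A r ∧ ¬ V' r) r

omit [DecidablePred A'] in
theorem Refines.count_eq (h : Refines V A V' A') (x : ℕ) :
    Nat.count V x = Nat.count V' x + Nat.count (fun r => A r ∧ ¬ V' r) x := by
  induction x with
  | zero => simp
  | succ x ih =>
    rw [Nat.count_succ, Nat.count_succ, Nat.count_succ, ih]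
    have h1 := h.live x
    have h2 := h.deleted x
    have h3 := h.act_live_old x
    by_cases hV : V x <;> by_cases hV' : V' x <;> by_cases hA : A x <;> simp_all <;> omega

-- The points that stay active and the deleted ones are disjoint sets of formerly active points.
-- This bound keeps the surplus of a parent interval within the parent's table.
omit [DecidablePred V] in
theorem Refines.count_add_le (h : Refines V A V' A') (x : ℕ) :
    Nat.count A' x + Nat.count (fun r => A r ∧ ¬ V' r) x ≤ Nat.count A x := by
  induction x with
  | zero => simp
  | succ x ih =>
    rw [Nat.count_succ, Nat.count_succ, Nat.count_succ]
    have h1 := h.act x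
    have h2 := h.act_live x
    by_cases hV' : V' x <;> by_cases hA : A x <;> by_cases hA' : A' x <;> simp_all <;> omega

variable {nw dl : ℕ → ℕ}

/-- An interval whose two ends survive loses exactly the deleted points inside it, so its surplus
`T` drops by their number, the difference of two entries of `dl`. The right position is recovered
from the cell as `u + 1 - P`, since `P` is stored with an offset of one. -/
theorem RefineTables.forward (hR : Refines V A V' A') (hN : RefineTables m V A V' A' nw dl)
    {T u P : ℕ} {xl xr : ℝ} (h : IsLiveInterval m k V A X T u P xl xr)
    (h1 : 1 ≤ nw (P - 1)) (h2 : 1 ≤ nw (u + 1 - P))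
    (h3 : dl ((u + 1 - P) / 2) - dl ((P - 1) / 2) ≤ T) :
    IsLiveInterval m k V' A' X (T - (dl ((u + 1 - P) / 2) - dl ((P - 1) / 2)))
      (nw (P - 1) + nw (u + 1 - P) - 2) (nw (P - 1)) xl xr := by
  obtain ⟨p, q, hpq, hq, hVp, hVq, hc, rfl, rfl, rfl, rfl⟩ := h
  have e1 : activePos A p + activePos A q + 1 - (activePos A p + 1) = activePos A q := by omega
  rw [Nat.add_sub_cancel] at h1 h3 ⊢
  rw [e1] at h2 h3 ⊢
  have hp := hpq.trans_lt hq
  have hVp' : V' p := by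
    by_contra h; rw [hN.del p hp hVp h] at h1; omega
  have hVq' : V' q := by
    by_contra h; rw [hN.del q hq hVq h] at h2; omega
  rw [activePos_div, activePos_div, hN.count p hp, hN.count q hq] at h3 ⊢
  rw [hN.new p hp hVp', hN.new q hq hVq']
  refine ⟨p, q, hpq, hq, hVp', hVq', ?_, rfl, by omega, rfl, rfl⟩
  rw [hR.count_eq (q + 1), hR.count_eq p] at hc
  -- The right end survives, so counting deleted points before `q` already counts those up to `q`.
  have h4 : Nat.count (fun r => A r ∧ ¬ V' r) (q + 1) = Nat.count (fun r => A r ∧ ¬ V' r) q := by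
    rw [Nat.count_succ]; simp [hVq']
  have h5 : Nat.count (fun r => A r ∧ ¬ V' r) p ≤ Nat.count (fun r => A r ∧ ¬ V' r) q :=
    Nat.count_monotone _ hpq
  omega

/-- Putting the deleted points back turns a live interval of the child into one of the parent with
the same ends. Its surplus is `T'` plus the number of deleted points inside, still within the
parent's range by `Refines.count_add_le`. -/
theorem RefineTables.backward (hR : Refines V A V' A') (hN : RefineTables m V A V' A' nw dl)
    {T' u' P' : ℕ} {xl xr : ℝ} (hT' : T' ≤ Nat.count A' m)
    (h : IsLiveInterval m k V' A' X T' u' P' xl xr) :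
    ∃ T u P, T ≤ Nat.count A m ∧ IsLiveInterval m k V A X T u P xl xr ∧ 1 ≤ nw (P - 1) ∧
      1 ≤ nw (u + 1 - P) ∧ T = T' + (dl ((u + 1 - P) / 2) - dl ((P - 1) / 2)) ∧
      u' = nw (P - 1) + nw (u + 1 - P) - 2 := by
  obtain ⟨p, q, hpq, hq, hVp, hVq, hc, rfl, rfl, rfl, rfl⟩ := h
  have hp := hpq.trans_lt hq
  have e1 : activePos A p + activePos A q + 1 - (activePos A p + 1) = activePos A q := by omega
  have h5 : Nat.count (fun r => A r ∧ ¬ V' r) p ≤ Nat.count (fun r => A r ∧ ¬ V' r) q :=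
    Nat.count_monotone _ hpq
  have h6 : Nat.count (fun r => A r ∧ ¬ V' r) q ≤ Nat.count (fun r => A r ∧ ¬ V' r) m :=
    Nat.count_monotone _ hq.le
  have h7 := hR.count_add_le m
  refine ⟨T' + (Nat.count (fun r => A r ∧ ¬ V' r) q - Nat.count (fun r => A r ∧ ¬ V' r) p),
    activePos A p + activePos A q, activePos A p + 1, by omega,
    ⟨p, q, hpq, hq, hR.live p hVp, hR.live q hVq, ?_, rfl, rfl, rfl, rfl⟩, ?_⟩
  · rw [hR.count_eq (q + 1), hR.count_eq p]
    have h4 : Nat.count (fun r => A r ∧ ¬ V' r) (q + 1) = Nat.count (fun r => A r ∧ ¬ V' r) q := by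
      rw [Nat.count_succ]; simp [hVq]
    omega
  · rw [e1, Nat.add_sub_cancel, activePos_div, activePos_div, hN.count p hp, hN.count q hq,
      hN.new p hp hVp, hN.new q hq hVq]
    refine ⟨by omega, by omega, rfl, by omega⟩

/-- Every cell of the old table is accounted for in the new one. -/
theorem IsTable.refine (hR : Refines V A V' A') (hN : RefineTables m V A V' A' nw dl)
    {tp tp' : ℕ → ℕ → ℕ} {tl tr tl' tr' : ℕ → ℕ → ℝ} (hT : IsTable m k V A X tp tl tr)
    (hs : ∀ T u, T ≤ Nat.count A' m → u ≤ 4 * Nat.count A' m → tp' T u ≠ 0 →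
      IsLiveInterval m k V' A' X T u (tp' T u) (tl' T u) (tr' T u))
    (hc : ∀ T u, T ≤ Nat.count A m → u ≤ 4 * Nat.count A m → tp T u ≠ 0 →
      1 ≤ nw (tp T u - 1) → 1 ≤ nw (u + 1 - tp T u) →
      ∀ T' u', T' ≤ Nat.count A' m →
        T = T' + (dl ((u + 1 - tp T u) / 2) - dl ((tp T u - 1) / 2)) →
        u' = nw (tp T u - 1) + nw (u + 1 - tp T u) - 2 →
        tp' T' u' ≠ 0 ∧ tr' T' u' - tl' T' u' ≤ tr T u - tl T u) :
    IsTable m k V' A' X tp' tl' tr' where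
  sound := hs
  complete := by
    intro T' u' P' xl xr hT' h
    obtain ⟨T, u, P, hTG, hI, h1, h2, h3, h4⟩ := hN.backward hR hT' h
    obtain ⟨h5, h6⟩ := hT.complete T u P xl xr hTG hI
    have hu := hI.bounds.2.2.1
    -- The stored interval may differ from the given one, but it has the same two positions. It
    -- therefore survives as well, loses equally many points and moves to the same cell of the
    -- child.
    have hP : tp T u = P := (hT.sound T u hTG hu h5).pos_eq hI
    have := hc T u hTG hu h5 (by rwa [hP]) (by rwa [hP]) T' u' hT' (by rwa [hP]) (by rwa [hP])
    exact ⟨this.1, this.2.trans h6⟩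

end Count

namespace RealRAM

/-! ### One step of the slab recursion

Variables: `3` number of points, `12` row length `K` of the tables, `13` distance `S = K * K` of
consecutive recursion levels, `14` base address of the current level, `15`–`17` block length and
block positions of the child, `18` number of active points, `19`–`28` temporaries. Arrays: `10`
block length, `11`, `12` block positions, `13` number of active points, `14` ranks of the active
points, `15` table of positions, real arrays `2`, `3` tables of interval ends, `16` new positions,
`17` numbers of deleted points. -/

/-- Clear the table of the child. -/
def clearTable : Cmd :=
  forTo 22 (nvar 20 + 1) (forTo 23 (4 * nvar 20 + 1)
    (.nput 15 (nvar 14 + nvar 13 + nvar 22 * nvar 12 + nvar 23) 0))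

/-- Transfer table cell `(nvar 22, nvar 23)` to the child. -/
def moveCell : Cmd :=
  .nset 27 (nvar 14 + nvar 22 * nvar 12 + nvar 23) ;;
  .nset 24 (.get 15 (nvar 27)) ;;
  .cond (.nle 1 (nvar 24))
    (.nset 25 (nvar 23 + 1 - nvar 24) ;;
    .nset 26 (.get 17 (nvar 25 / 2) - .get 17 ((nvar 24 - 1) / 2)) ;;
    .nset 28 (nvar 14 + nvar 13 + (nvar 22 - nvar 26) * nvar 12 +
      (.get 16 (nvar 24 - 1) + .get 16 (nvar 25) - 2)) ;;
    .cond (.and (.and (.nle 1 (.get 16 (nvar 24 - 1)))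
        (.and (.nle 1 (.get 16 (nvar 25))) (.and (.nle (nvar 26) (nvar 22))
          (.nle (nvar 22 - nvar 26) (nvar 20)))))
        (.or (.not (.nle 1 (.get 15 (nvar 28)))) (.not (.rle
          (.get 3 (nvar 28) - .get 2 (nvar 28)) (.get 3 (nvar 27) - .get 2 (nvar 27))))))
      (.nput 15 (nvar 28) (.get 16 (nvar 24 - 1)) ;;
        .rput 2 (nvar 28) (.get 2 (nvar 27)) ;;
        .rput 3 (nvar 28) (.get 3 (nvar 27)))
      .skip)
    .skip

/-- Transfer the table to the child. -/
def moveTable : Cmd :=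
  forTo 22 (nvar 18 + 1) (forTo 23 (4 * nvar 18 + 1) moveCell)

/-- Either the entry is written, and then the target was empty or not shorter, or nothing changes,
and then an entry that qualifies finds a target at least as short. The word bounds in `hB3` are
needed only for a nonempty cell, because the target address is not computed otherwise. -/
theorem moveCell_runs {pr : List Cmd} {B o K S G' T u P Q D tg : ℕ} {s : State} (h14 : s.nv 14 = o)
    (h12 : s.nv 12 = K) (h13 : s.nv 13 = S) (h20 : s.nv 20 = G') (h22 : s.nv 22 = T)
    (h23 : s.nv 23 = u) (hP : s.na 15 (o + T * K + u) = P) (hQ : u + 1 - P = Q)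
    (hD : s.na 17 (Q / 2) - s.na 17 ((P - 1) / 2) = D)
    (htg : o + S + (T - D) * K + (s.na 16 (P - 1) + s.na 16 Q - 2) = tg)
    (hB1 : o + T * K + u ≤ B) (hB2 : P ≤ B)
    (hB3 : 1 ≤ P → Q ≤ B ∧ D ≤ B ∧ tg ≤ B ∧ s.na 16 (P - 1) ≤ B) :
    Runs pr B moveCell s 200 fun s' =>
      (((1 ≤ P ∧ 1 ≤ s.na 16 (P - 1) ∧ 1 ≤ s.na 16 Q ∧ D ≤ T ∧ T - D ≤ G') ∧
        (∀ j, s'.na 15 j = if j = tg then s.na 16 (P - 1) else s.na 15 j) ∧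
        (∀ j, s'.ra 2 j = if j = tg then s.ra 2 (o + T * K + u) else s.ra 2 j) ∧
        (∀ j, s'.ra 3 j = if j = tg then s.ra 3 (o + T * K + u) else s.ra 3 j) ∧
        (s.na 15 tg = 0 ∨ s.ra 3 (o + T * K + u) - s.ra 2 (o + T * K + u) ≤
          s.ra 3 tg - s.ra 2 tg)) ∨
      (s'.na 15 = s.na 15 ∧ s'.ra 2 = s.ra 2 ∧ s'.ra 3 = s.ra 3 ∧
        (1 ≤ P → 1 ≤ s.na 16 (P - 1) → 1 ≤ s.na 16 Q → D ≤ T → T - D ≤ G' →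
          s.na 15 tg ≠ 0 ∧ s.ra 3 tg - s.ra 2 tg ≤
            s.ra 3 (o + T * K + u) - s.ra 2 (o + T * K + u)))) := by
  refine Runs.seq' (T := 9) (T' := 191) (Runs.straight (Q := fun s₁ => s₁ = s.setN 27 (o + T * K + u))
    (by simp [wp, h14, h22, h12, h23, hB1]) (Nat.le_of_ble_eq_true rfl)) ?_ le_rfl
  rintro _ rfl
  refine Runs.seq' (T := 9) (T' := 182) (Runs.straight (Q := fun s₁ => s₁ =
    (s.setN 27 (o + T * K + u)).setN 24 P)
    (by simp [wp, hP, hB2]) (Nat.le_of_ble_eq_true rfl)) ?_ le_rfl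
  rintro _ rfl
  by_cases hP1 : 1 ≤ P
  swap
  · refine (Runs.cond (T := 178) (fun h => ?_) fun _ => ?_).mono le_rfl fun _ h => h
    · simp at h; omega
    · exact Runs.straight (by simp [wp, hP1]) (Nat.le_of_ble_eq_true rfl)
  obtain ⟨hB3, hB4, hB5, hB6⟩ := hB3 hP1
  refine (Runs.cond (T := 178) (fun _ => ?_) fun h => absurd hP1 (by simpa using h)).mono
    le_rfl fun _ h => h
  refine Runs.seq' (T := 9) (T' := 169) (Runs.straight (Q := fun s₁ => s₁ =
    ((s.setN 27 (o + T * K + u)).setN 24 P).setN 25 Q)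
    (by simp [wp, h23, hQ, hB3]) (Nat.le_of_ble_eq_true rfl)) ?_ le_rfl
  rintro _ rfl
  refine Runs.seq' (T := 12) (T' := 157) (Runs.straight (Q := fun s₁ => s₁ =
    (((s.setN 27 (o + T * K + u)).setN 24 P).setN 25 Q).setN 26 D)
    (by simp [wp, hD]; omega) (Nat.le_of_ble_eq_true rfl)) ?_ le_rfl
  rintro _ rfl
  refine Runs.seq' (T := 20) (T' := 137) (Runs.straight (Q := fun s₁ => s₁ =
    ((((s.setN 27 (o + T * K + u)).setN 24 P).setN 25 Q).setN 26 D).setN 28 tg)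
    (by simp [wp, h14, h13, h12, h22, htg, hB5]) (Nat.le_of_ble_eq_true rfl)) ?_ le_rfl
  rintro _ rfl
  set s₁ := ((((s.setN 27 (o + T * K + u)).setN 24 P).setN 25 Q).setN 26 D).setN 28 tg with hs₁
  have e1 : s₁.nv 28 = tg := by simp [hs₁]
  have e2 : s₁.nv 27 = o + T * K + u := by simp [hs₁]
  have e3 : s₁.nv 24 = P := by simp [hs₁]
  have e4 : s₁.nv 25 = Q := by simp [hs₁]
  have e5 : s₁.nv 26 = D := by simp [hs₁]
  have e6 : s₁.nv 22 = T := by simp [hs₁, h22]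
  have e7 : s₁.nv 20 = G' := by simp [hs₁, h20]
  have e8 : s₁.na = s.na := by simp [hs₁]
  have e9 : s₁.ra = s.ra := by simp [hs₁]
  refine Runs.straight ?_ (Nat.le_of_ble_eq_true rfl)
  simp only [wp, BExp.eval_and, BExp.eval_or, BExp.eval_not, BExp.eval_nle, BExp.eval_rle,
    NExp.eval_var', NExp.eval_get', NExp.eval_sub', NExp.eval_ofNat, RExp.eval_sub',
    RExp.eval_get', State.nv_putN, State.nv_putR, State.ra_putN, e1, e2, e3, e4, e5, e6, e7, e8, e9]
  constructor
  · rintro ⟨h1, h2⟩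
    refine ⟨hB6, .inl ⟨⟨hP1, h1⟩, ?_, ?_, ?_, ?_⟩⟩
    · simp [e8]
    · intro j; simp [e9]
    · intro j; simp [e9]
    · rcases h2 with h2 | h2
      · exact .inl (by omega)
      · exact .inr (not_le.1 h2).le
  · intro h
    refine .inr ⟨trivial, trivial, trivial, fun h1 h2 h3 h4 h5 => ?_⟩
    push Not at h
    obtain ⟨h6, h7⟩ := h ⟨h2, h3, h4, h5⟩
    exact ⟨by omega, h7⟩

theorem index_inj {K T u T' u' : ℕ} (hu : u < K) (hu' : u' < K) :
    T * K + u = T' * K + u' ↔ T = T' ∧ u = u' := by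
  constructor
  · intro h
    have h1 := congrArg (· / K) h
    have hK : 0 < K := by omega
    simp only [Nat.mul_comm _ K, Nat.mul_add_div hK, Nat.div_eq_of_lt hu, Nat.div_eq_of_lt hu'] at h1
    have : T = T' := by omega
    subst this
    exact ⟨rfl, by omega⟩
  · rintro ⟨rfl, rfl⟩; rfl

theorem index_lt {K T u : ℕ} (hT : T < K) (hu : u < K) : T * K + u < K * K := by
  nlinarith

section

variable {pr : List Cmd} {pw : ℕ → List ℕ} (hpw : WritesOK pr pw)
include hpw

theorem clearTable_runs {B o K G' : ℕ} {s : State} (h14 : s.nv 14 = o)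
    (h12 : s.nv 12 = K) (h13 : s.nv 13 = K * K) (h20 : s.nv 20 = G') (hG : 4 * G' < K)
    (hB : o + 2 * (K * K) ≤ B) :
    Runs pr B clearTable s ((G' + 1) * ((4 * G' + 1) * 24 + 22) + 9) fun s' =>
      (∀ T u, T ≤ G' → u ≤ 4 * G' → s'.na 15 (o + K * K + T * K + u) = 0) ∧
      ∀ x, x < o + K * K → s'.na 15 x = s.na 15 x := by
  have hKB : K ≤ K * K := Nat.le_mul_self K
  refine (forTo_runs hpw (N := G' + 1) (T := (4 * G' + 1) * 24 + 11) (fun T s' =>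
    (∀ T' u, T' < T → u ≤ 4 * G' → s'.na 15 (o + K * K + T' * K + u) = 0) ∧
      ∀ x, x < o + K * K → s'.na 15 x = s.na 15 x) (by simp [Cmd.writes, forTo]) (by omega)
    ?_ ?_ ?_ (by simp)).mono le_rfl ?_
  · intro s' hf
    simp [hf.nv 20 (by simp [Cmd.writes, forTo]), h20]
  · simp
  · rintro T s' hT hf hT' ⟨h1, h2⟩
    have hf : Frame [88, 92, 62, 92, 88] s s' := hf
    refine (forTo_runs hpw (N := 4 * G' + 1) (T := 11) (fun i s' =>
      (∀ T' u, (T' < T ∧ u ≤ 4 * G') ∨ (T' = T ∧ u < i) →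
        s'.na 15 (o + K * K + T' * K + u) = 0) ∧
      ∀ x, x < o + K * K → s'.na 15 x = s.na 15 x) (by simp [Cmd.writes]) (by omega)
      ?_ ?_ ?_ (by simp)).mono le_rfl ?_
    · intro s₁ hf₁
      have hf₁ : Frame [92, 62, 92] s' s₁ := hf₁
      simp [hf₁.nv 20 (by decide), hf.nv 20 (by decide), h20]
    · exact ⟨fun T' u h => by simpa using h1 T' u (by omega) (by omega), by simpa using h2⟩
    · rintro i s₁ hi hf₁ hi' ⟨h3, h4⟩
      have hf₁ : Frame [92, 62, 92] s' s₁ := hf₁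
      refine Runs.straight ?_ (Nat.le_of_ble_eq_true rfl)
      have e : s₁.nv 14 = o ∧ s₁.nv 13 = K * K ∧ s₁.nv 12 = K ∧ s₁.nv 22 = T := by
        rw [hf₁.nv 14 (by decide), hf₁.nv 13 (by decide), hf₁.nv 12 (by decide),
          hf₁.nv 22 (by decide), hf.nv 14 (by decide), hf.nv 13 (by decide), hf.nv 12 (by decide)]
        exact ⟨h14, h13, h12, hT'⟩
      simp only [wp, NExp.eval_ofNat, NExp.eval_add', NExp.eval_mul', NExp.eval_var', e, hi',
        State.na_setN, State.na_putN]
      refine ⟨by omega, fun T' u h => ?_, fun x hx => ?_⟩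
      · simp only [true_and]
        split_ifs with h5
        · rfl
        · apply h3
          rcases h with h | h
          · exact .inl h
          · refine .inr ⟨h.1, ?_⟩
            by_contra h6
            exact h5 (by rw [h.1, show u = i by omega])
      · rw [if_neg (by omega)]
        exact h4 x hx
    · rintro s₁ ⟨⟨h3, h4⟩, -, -⟩
      exact ⟨fun T' u hT' hu => by
        simpa using h3 T' u (by omega), by simpa using h4⟩
  · rintro s' ⟨⟨h1, h2⟩, -, -⟩
    exact ⟨fun T u hT hu => h1 T u (by omega) hu, h2⟩

-- Several parent cells may compete for one cell of the child, which keeps the shortest interval.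
-- The relation `R` stands for the meaning of an entry: its truth for the transferred entries is all
-- that soundness needs, so nothing about live points enters here.
set_option maxHeartbeats 1000000 in
theorem moveTable_runs {B o K G G' : ℕ} {s : State} (h14 : s.nv 14 = o)
    (h12 : s.nv 12 = K) (h13 : s.nv 13 = K * K) (h18 : s.nv 18 = G) (h20 : s.nv 20 = G')
    (hG : 4 * G < K) (hG' : 4 * G' < K) (hB : o + 2 * (K * K) ≤ B)
    {nw dl : ℕ → ℕ} (hnw : s.na 16 = nw) (hdl : s.na 17 = dl)
    (hnw' : ∀ j, j ≤ 2 * G → nw j ≤ 2 * G' + 1) (hdl' : ∀ j, j ≤ G → dl j ≤ G)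
    {tp : ℕ → ℕ → ℕ} {tl tr : ℕ → ℕ → ℝ} (htp : ∀ T u, s.na 15 (o + T * K + u) = tp T u)
    (htl : ∀ T u, s.ra 2 (o + T * K + u) = tl T u) (htr : ∀ T u, s.ra 3 (o + T * K + u) = tr T u)
    (hb : ∀ T u, T ≤ G → u ≤ 4 * G → tp T u ≠ 0 → tp T u ≤ 2 * G + 1 ∧ u + 1 - tp T u ≤ 2 * G)
    {R : ℕ → ℕ → ℕ → ℝ → ℝ → Prop}
    (hR : ∀ T u, T ≤ G → u ≤ 4 * G → tp T u ≠ 0 → 1 ≤ nw (tp T u - 1) →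
      1 ≤ nw (u + 1 - tp T u) → dl ((u + 1 - tp T u) / 2) - dl ((tp T u - 1) / 2) ≤ T →
      R (T - (dl ((u + 1 - tp T u) / 2) - dl ((tp T u - 1) / 2)))
        (nw (tp T u - 1) + nw (u + 1 - tp T u) - 2) (nw (tp T u - 1)) (tl T u) (tr T u))
    (h0 : ∀ T u, T ≤ G' → u ≤ 4 * G' → s.na 15 (o + K * K + T * K + u) = 0) :
    Runs pr B moveTable s ((G + 1) * ((4 * G + 1) * 213 + 22) + 9) fun s' =>
      (∀ T u, T ≤ G' → u ≤ 4 * G' → s'.na 15 (o + K * K + T * K + u) ≠ 0 →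
        R T u (s'.na 15 (o + K * K + T * K + u)) (s'.ra 2 (o + K * K + T * K + u))
          (s'.ra 3 (o + K * K + T * K + u))) ∧
      (∀ T u, T ≤ G → u ≤ 4 * G → tp T u ≠ 0 → 1 ≤ nw (tp T u - 1) →
        1 ≤ nw (u + 1 - tp T u) → ∀ T' u', T' ≤ G' →
        T = T' + (dl ((u + 1 - tp T u) / 2) - dl ((tp T u - 1) / 2)) →
        u' = nw (tp T u - 1) + nw (u + 1 - tp T u) - 2 →
        s'.na 15 (o + K * K + T' * K + u') ≠ 0 ∧
          s'.ra 3 (o + K * K + T' * K + u') - s'.ra 2 (o + K * K + T' * K + u') ≤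
            tr T u - tl T u) ∧
      ∀ x, x < o + K * K → s'.na 15 x = s.na 15 x ∧ s'.ra 2 x = s.ra 2 x ∧ s'.ra 3 x = s.ra 3 x := by
  have hKB : K ≤ K * K := Nat.le_mul_self K
  -- The argument `D` of the invariant is the set of parent cells already transferred.
  let I : (ℕ → ℕ → Prop) → State → Prop := fun D s' =>
      (∀ T u, T ≤ G' → u ≤ 4 * G' → s'.na 15 (o + K * K + T * K + u) ≠ 0 →
        R T u (s'.na 15 (o + K * K + T * K + u)) (s'.ra 2 (o + K * K + T * K + u))
          (s'.ra 3 (o + K * K + T * K + u))) ∧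
      (∀ T u, D T u → T ≤ G → u ≤ 4 * G → tp T u ≠ 0 → 1 ≤ nw (tp T u - 1) →
        1 ≤ nw (u + 1 - tp T u) → ∀ T' u', T' ≤ G' →
        T = T' + (dl ((u + 1 - tp T u) / 2) - dl ((tp T u - 1) / 2)) →
        u' = nw (tp T u - 1) + nw (u + 1 - tp T u) - 2 →
        s'.na 15 (o + K * K + T' * K + u') ≠ 0 ∧
          s'.ra 3 (o + K * K + T' * K + u') - s'.ra 2 (o + K * K + T' * K + u') ≤
            tr T u - tl T u) ∧
      ∀ x, x < o + K * K → s'.na 15 x = s.na 15 x ∧ s'.ra 2 x = s.ra 2 x ∧ s'.ra 3 x = s.ra 3 x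
  have hW : moveTable.writes pw = [88, 92, 108, 96, 100, 104, 112, 62, 11, 15, 92, 88] := rfl
  refine (forTo_runs hpw (N := G + 1) (T := (4 * G + 1) * 213 + 11) (fun T s' =>
    I (fun T' _ => T' < T) s') (by simp [Cmd.writes, forTo, moveCell]) (by omega)
    ?_ ?_ ?_ (by simp)).mono le_rfl ?_
  · intro s' hf
    have hf : Frame [88, 92, 108, 96, 100, 104, 112, 62, 11, 15, 92, 88] s s' := hf
    simp [hf.nv 18 (by decide), h18]
  · refine ⟨fun T u hT hu h => ?_, fun T u h => absurd h (by omega), by simp⟩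
    simp only [State.na_setN] at h
    exact absurd (h0 T u hT hu) h
  · rintro T s' hT hf hT' hI
    have hf : Frame [88, 92, 108, 96, 100, 104, 112, 62, 11, 15, 92, 88] s s' := hf
    refine (forTo_runs hpw (N := 4 * G + 1) (T := 200) (fun i s' =>
      I (fun T' u => T' < T ∨ (T' = T ∧ u < i)) s') (by simp [Cmd.writes, moveCell]) (by omega)
      ?_ ?_ ?_ (by simp)).mono le_rfl ?_
    · intro s₁ hf₁
      have hf₁ : Frame [92, 108, 96, 100, 104, 112, 62, 11, 15, 92] s' s₁ := hf₁
      simp [hf₁.nv 18 (by decide), hf.nv 18 (by decide), h18]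
    · exact ⟨hI.1, fun T' u h => hI.2.1 T' u (by omega), hI.2.2⟩
    · rintro i s₁ hi hf₁ hi' ⟨h1, h2, h3⟩
      have hf₁ : Frame [92, 108, 96, 100, 104, 112, 62, 11, 15, 92] s' s₁ := hf₁
      have hi4 : i ≤ 4 * G := by omega
      have hTG : T ≤ G := by omega
      have hidx : T * K + i < K * K := index_lt (by omega) (by omega)
      have e15 : s₁.na 15 (o + T * K + i) = tp T i := by
        rw [(h3 _ (by omega)).1, htp]
      have e2 : s₁.ra 2 (o + T * K + i) = tl T i := by
        rw [(h3 _ (by omega)).2.1, htl]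
      have e3 : s₁.ra 3 (o + T * K + i) = tr T i := by
        rw [(h3 _ (by omega)).2.2, htr]
      have e16 : s₁.na 16 = nw := by rw [hf₁.na 16 (by decide), hf.na 16 (by decide), hnw]
      have e17 : s₁.na 17 = dl := by rw [hf₁.na 17 (by decide), hf.na 17 (by decide), hdl]
      have hbT := hb T i hTG hi4
      have hRT := hR T i hTG hi4
      set P := tp T i with hPdef
      set Q := i + 1 - P with hQdef
      set D := dl (Q / 2) - dl ((P - 1) / 2) with hDdef
      set u' := nw (P - 1) + nw Q - 2 with hu'def
      have hu' : P ≠ 0 → u' ≤ 4 * G' := by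
        intro h
        have := hnw' (P - 1) (by have := hbT h; omega)
        have := hnw' Q (by have := hbT h; omega)
        omega
      have hidx' : P ≠ 0 → (T - D) * K + u' < K * K := fun h =>
        index_lt (by omega) (by have := hu' h; omega)
      refine (moveCell_runs (o := o) (K := K) (S := K * K) (G' := G') (T := T) (u := i) (P := P)
        (Q := Q) (D := D) (tg := o + K * K + (T - D) * K + u')
        (by rw [hf₁.nv 14 (by decide), hf.nv 14 (by decide), h14])
        (by rw [hf₁.nv 12 (by decide), hf.nv 12 (by decide), h12])
        (by rw [hf₁.nv 13 (by decide), hf.nv 13 (by decide), h13])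
        (by rw [hf₁.nv 20 (by decide), hf.nv 20 (by decide), h20])
        (by rw [hf₁.nv 22 (by decide), hT']) hi' e15 hQdef.symm (by rw [e17])
        (by rw [e16]) (by omega) ?_ ?_).mono le_rfl ?_
      · rcases Nat.eq_zero_or_pos P with h | h
        · omega
        · have := hbT h.ne'
          omega
      · intro hP1
        have hP0 : P ≠ 0 := by omega
        have h5 := hbT hP0
        have h6 := hidx' hP0
        have h7 := hdl' (Q / 2) (by omega)
        have h8 := hnw' (P - 1) (by omega)
        rw [e16]
        refine ⟨by omega, by omega, by omega, by omega⟩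
      · rintro s₂ h
        rw [e16, e2, e3] at h
        rcases h with ⟨⟨c1, c2, c3, c4, c5⟩, d1, d2, d3, d4⟩ | ⟨d1, d2, d3, d4⟩
        · have hP0 : P ≠ 0 := by omega
          have h6 := hidx' hP0
          have hu'' := hu' hP0
          have hinj : ∀ T₁ u₁, u₁ ≤ 4 * G' → (o + K * K + T₁ * K + u₁ =
              o + K * K + (T - D) * K + u' ↔ T₁ = T - D ∧ u₁ = u') := by
            intro T₁ u₁ hu₁
            rw [← index_inj (K := K) (by omega) (by omega)]
            omega
          refine ⟨?_, ?_, ?_⟩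
          · intro T₁ u₁ hT₁ hu₁ h
            simp only [State.na_setN, State.ra_setN, d1, d2, d3, hinj T₁ u₁ hu₁] at h ⊢
            split_ifs at h ⊢ with h7
            · obtain ⟨rfl, rfl⟩ := h7
              exact hRT hP0 c2 c3 c4
            · exact h1 T₁ u₁ hT₁ hu₁ h
          · intro T₁ u₁ hD hT₁ hu₁ h7 h8 h9 T₂ u₂ hT₂ e₁ e₂
            have hu₂ : u₂ ≤ 4 * G' := by
              have := hnw' (tp T₁ u₁ - 1) (by have := hb T₁ u₁ hT₁ hu₁ h7; omega)
              have := hnw' (u₁ + 1 - tp T₁ u₁) (by have := hb T₁ u₁ hT₁ hu₁ h7; omega)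
              omega
            simp only [State.na_setN, State.ra_setN, d1, d2, d3, hinj T₂ u₂ hu₂]
            by_cases hnew : T₁ = T ∧ u₁ = i
            · obtain ⟨r1, r2⟩ := hnew
              rw [r1, r2] at e₁ e₂ ⊢
              have e₁ : T = T₂ + D := e₁
              have e₂ : u₂ = u' := e₂
              have e₃ : T₂ = T - D := by omega
              rw [if_pos ⟨e₃, e₂⟩, if_pos ⟨e₃, e₂⟩, if_pos ⟨e₃, e₂⟩]
              exact ⟨by omega, le_rfl⟩
            · obtain ⟨k1, k2⟩ := h2 T₁ u₁ (by omega) hT₁ hu₁ h7 h8 h9 T₂ u₂ hT₂ e₁ e₂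
              split_ifs with h10
              · obtain ⟨rfl, rfl⟩ := h10
                refine ⟨by omega, ?_⟩
                -- A cell transferred earlier has the same target. That target was nonempty, so it
                -- has been overwritten only by an interval that is no longer.
                rcases d4 with d4 | d4
                · exact absurd d4 k1
                · exact d4.trans k2
              · exact ⟨k1, k2⟩
          · intro x hx
            simp only [State.na_setN, State.ra_setN, d1, d2, d3]
            rw [if_neg (by omega), if_neg (by omega), if_neg (by omega)]
            exact h3 x hx
        · refine ⟨?_, ?_, ?_⟩
          · simpa only [State.na_setN, State.ra_setN, d1, d2, d3] using h1
          · intro T₁ u₁ hD hT₁ hu₁ h7 h8 h9 T₂ u₂ hT₂ e₁ e₂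
            simp only [State.na_setN, State.ra_setN, d1, d2, d3]
            by_cases hnew : T₁ = T ∧ u₁ = i
            · obtain ⟨r1, r2⟩ := hnew
              rw [r1, r2] at e₁ e₂ h7 h8 h9 ⊢
              have e₁ : T = T₂ + D := e₁
              have e₂ : u₂ = u' := e₂
              have e₃ : T - D = T₂ := by omega
              have := d4 (Nat.one_le_iff_ne_zero.2 h7) h8 h9 (by omega) (by omega)
              rw [e₃, ← e₂] at this
              exact this
            · exact h2 T₁ u₁ (by omega) hT₁ hu₁ h7 h8 h9 T₂ u₂ hT₂ e₁ e₂
          · simpa only [State.na_setN, State.ra_setN, d1, d2, d3] using h3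
    · rintro s₁ ⟨⟨h1, h2, h3⟩, -, -⟩
      exact ⟨h1, fun T' u h h' h'' => h2 T' u (by omega) h' h'', h3⟩
  · rintro s' ⟨⟨h1, h2, h3⟩, -, -⟩
    exact ⟨h1, fun T u hT => h2 T u (by omega) hT, h3⟩

end


/-- Decide the fate of the `nvar 19`-th active point. -/
def markPoint : Cmd :=
  .nset 28 (.get 14 (nvar 14 + nvar 19)) ;;
  .nput 16 (2 * nvar 19) (2 * nvar 20 + 1) ;;
  .nput 17 (nvar 19) (nvar 21) ;;
  .cond (.or (.not (.nle (nvar 16) (nvar 28))) (.nle (nvar 17 + nvar 15) (nvar 28)))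
    (.nput 16 (2 * nvar 19 + 1) 0 ;; .nset 21 (nvar 21 + 1))
    (.cond (.or (.not (.nle (nvar 16 + nvar 15) (nvar 28))) (.nle (nvar 17) (nvar 28)))
      (.nput 16 (2 * nvar 19 + 1) (2 * nvar 20 + 2) ;;
        .nput 14 (nvar 14 + nvar 13 + nvar 20) (nvar 28) ;; .nset 20 (nvar 20 + 1))
      (.nput 16 (2 * nvar 19 + 1) (2 * nvar 20 + 1)))

/-- Decide the fate of all active points. -/
def markPoints : Cmd :=
  .nset 20 0 ;; .nset 21 0 ;; forTo 19 (nvar 18) markPoint ;;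
  (.nput 16 (2 * nvar 18) (2 * nvar 20 + 1) ;; .nput 17 (nvar 18) (nvar 21) ;;
    .nput 13 (nvar 14 + nvar 13) (nvar 20))

theorem markPoint_runs {pr : List Cmd} {B o S i kc dc nb nt h v : ℕ} {s : State}
    (h14 : s.nv 14 = o) (h13 : s.nv 13 = S) (h19 : s.nv 19 = i) (h20 : s.nv 20 = kc)
    (h21 : s.nv 21 = dc) (h16 : s.nv 16 = nb) (h17 : s.nv 17 = nt) (h15 : s.nv 15 = h)
    (hv : s.na 14 (o + i) = v) (hB : 2 * kc + 2 ≤ B) (hB' : dc + 1 ≤ B) (hvB : v ≤ B)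
    {lv ac : Prop} [Decidable lv] [Decidable ac] (hlv : lv ↔ nb ≤ v ∧ v < nt + h) (hac : ac ↔ lv ∧ (v < nb + h ∨ nt ≤ v)) :
    Runs pr B markPoint s 100 fun s' =>
      (∀ j, s'.na 16 j = if j = 2 * i + 1 then
          (if lv then 2 * kc + (if ac then 1 else 0) + 1 else 0)
        else if j = 2 * i then 2 * kc + 1 else s.na 16 j) ∧
      (∀ j, s'.na 17 j = if j = i then dc else s.na 17 j) ∧
      (∀ j, s'.na 14 j = if ac ∧ j = o + S + kc then v else s.na 14 j) ∧
      s'.nv 20 = kc + (if ac then 1 else 0) ∧ s'.nv 21 = dc + (if lv then 0 else 1) := by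
  refine Runs.straight ?_ (Nat.le_of_ble_eq_true rfl)
  simp [wp, markPoint, h14, h13, h19, h20, h21, h16, h17, h15, hv]
  refine ⟨hvB, by omega, by omega, fun h1 => ⟨by omega, ?_⟩, fun h1 h2 => ⟨?_, ?_⟩⟩
  · have h2 : ¬ lv := by rw [hlv]; omega
    have h3 : ¬ ac := fun h => h2 (hac.1 h).1
    simp [h2, h3]
  · have h3 : lv := hlv.2 ⟨h1, h2⟩
    intro h4
    have h5 : ac := hac.2 ⟨h3, by omega⟩
    simp [h3, h5]
    omega
  · have h3 : lv := hlv.2 ⟨h1, h2⟩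
    intro h4 h4'
    have h5 : ¬ ac := fun h => by have := (hac.1 h).2; omega
    simp [h3, h5]
    omega

section

variable {pr : List Cmd} {pw : ℕ → List ℕ} (hpw : WritesOK pr pw)
include hpw

-- One sweep over the active points in `x`-order, with counters for the active points kept so far
-- and for the deleted ones. The invariant speaks of points `x` rather than of table indices. All
-- points in the same gap have the same counters by `Nat.count_eq_of_count_eq`, so one entry per gap
-- serves them all.
set_option maxHeartbeats 1000000 in
theorem markPoints_runs {B o S G m nb nt h : ℕ} {σ : ℕ → ℕ} {s : State}
    (h14 : s.nv 14 = o) (h13 : s.nv 13 = S) (h18 : s.nv 18 = G)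
    (h16 : s.nv 16 = nb) (h17 : s.nv 17 = nt) (h15 : s.nv 15 = h)
    {V A V' A' : ℕ → Prop} [DecidablePred V] [DecidablePred A] [DecidablePred V'] [DecidablePred A']
    (hR : Refines V A V' A') (hG : Nat.count A m = G) (hB : 2 * m + 2 ≤ B)
    (hsg : ∀ r, r < m → A r → s.na 14 (o + Nat.count A r) = σ r)
    (hσ : ∀ r, r < m → σ r ≤ B) (hGS : G ≤ S)
    (hV' : ∀ r, r < m → A r → (V' r ↔ nb ≤ σ r ∧ σ r < nt + h))
    (hA' : ∀ r, r < m → A r → (A' r ↔ V' r ∧ (σ r < nb + h ∨ nt ≤ σ r))) :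
    Runs pr B markPoints s (G * 109 + 40) fun s' =>
      RefineTables m V A V' A' (s'.na 16) (s'.na 17) ∧
      (∀ j, j ≤ 2 * G → s'.na 16 j ≤ 2 * Nat.count A' m + 1) ∧ (∀ j, j ≤ G → s'.na 17 j ≤ G) ∧
      s'.nv 20 = Nat.count A' m ∧ (∀ x, s'.na 13 x = if x = o + S then Nat.count A' m else s.na 13 x) ∧
      (∀ r, r < m → A' r → s'.na 14 (o + S + Nat.count A' r) = σ r) ∧
      ∀ x, x < o + S → s'.na 14 x = s.na 14 x := by
  have hGm : G ≤ m := hG ▸ Nat.count_le A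
  have hDA : ∀ r, (A r ∧ ¬ V' r) → A r := fun r h => h.1
  have hcA' : ∀ x, Nat.count A' x ≤ x := fun x => Nat.count_le _
  have hcD : ∀ x, Nat.count (fun r => A r ∧ ¬ V' r) x ≤ x := fun x => Nat.count_le _
  refine Runs.seq' (T := 2) (T' := G * 109 + 38) (Runs.straight (Q := fun s₁ => s₁ = s.setN 20 0)
    (by simp [wp]) (Nat.le_of_ble_eq_true rfl)) ?_ (by omega)
  rintro _ rfl
  refine Runs.seq' (T := 2) (T' := G * 109 + 36) (Runs.straight
    (Q := fun s₁ => s₁ = (s.setN 20 0).setN 21 0)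
    (by simp [wp]) (Nat.le_of_ble_eq_true rfl)) ?_ (by omega)
  rintro _ rfl
  set s₀ := (s.setN 20 0).setN 21 0 with hs₀
  refine Runs.seq' (T := G * 109 + 7) (T' := 29) (forTo_runs hpw (N := G) (T := 100) (fun i s' =>
    (∀ x, x ≤ m → Nat.count A x = i →
      s'.nv 20 = Nat.count A' x ∧ s'.nv 21 = Nat.count (fun r => A r ∧ ¬ V' r) x) ∧
    (∀ x, x ≤ m → Nat.count A x < i → s'.na 16 (2 * Nat.count A x) = 2 * Nat.count A' x + 1 ∧
      s'.na 17 (Nat.count A x) = Nat.count (fun r => A r ∧ ¬ V' r) x) ∧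
    (∀ r, r < m → A r → Nat.count A r < i →
      s'.na 16 (2 * Nat.count A r + 1) = if V' r then activePos A' r + 1 else 0) ∧
    (∀ r, r < m → A' r → Nat.count A r < i → s'.na 14 (o + S + Nat.count A' r) = σ r) ∧
    ∀ x, x < o + S → s'.na 14 x = s.na 14 x) (by simp [Cmd.writes, markPoint]) (by omega) ?_ ?_ ?_
    (by simp)) ?_ (by omega)
  · intro s' hf
    have hf : Frame [76, 112, 66, 70, 66, 84, 66, 58, 80, 66, 76] s₀ s' := hf
    simp [hf.nv 18 (by decide), hs₀, h18]
  · refine ⟨fun x hx h => ?_, by simp, by simp, by simp, by simp [hs₀]⟩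
    have h0 : Nat.count A x = Nat.count A 0 := by simpa using h
    rw [Nat.count_eq_of_count_eq hR.act h0, Nat.count_eq_of_count_eq hDA h0]
    simp [hs₀]
  · rintro i s₁ hi hf hi' ⟨i1, i2, i3, i4, i5⟩
    have hf : Frame [76, 112, 66, 70, 66, 84, 66, 58, 80, 66, 76] s₀ s₁ := hf
    obtain ⟨r, hr, hAr, hri⟩ := Nat.exists_count_eq (hG.symm ▸ hi)
    obtain ⟨j1, j2⟩ := i1 r hr.le hri
    have := hcA' r
    have := hcD r
    refine (markPoint_runs (o := o) (S := S) (i := i) (nb := nb) (nt := nt) (h := h) (v := σ r)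
      (by rw [hf.nv 14 (by decide)]; simpa [hs₀] using h14)
      (by rw [hf.nv 13 (by decide)]; simpa [hs₀] using h13) hi' j1 j2
      (by rw [hf.nv 16 (by decide)]; simpa [hs₀] using h16)
      (by rw [hf.nv 17 (by decide)]; simpa [hs₀] using h17)
      (by rw [hf.nv 15 (by decide)]; simpa [hs₀] using h15)
      (by rw [i5 _ (by omega), ← hri, hsg r hr hAr]) (by omega) (by omega) (hσ r hr)
      (hV' r hr hAr) (hA' r hr hAr)).mono le_rfl ?_
    rintro s₂ ⟨k1, k2, k3, k4, k5⟩
    have hsucc : Nat.count A (r + 1) = i + 1 := by rw [Nat.count_succ, if_pos hAr, hri]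
    have huniq : ∀ r', A r' → Nat.count A r' = i → r' = r := fun r' h1 h2 =>
      Nat.count_injective h1 hAr (h2.trans hri.symm)
    refine ⟨?_, ?_, ?_, ?_, ?_⟩
    · intro x hx hxi
      have e := hxi.trans hsucc.symm
      rw [Nat.count_eq_of_count_eq hR.act e, Nat.count_eq_of_count_eq hDA e]
      simp only [State.nv_setN, k4, k5]
      simp only [Nat.count_succ]
      refine ⟨?_, ?_⟩
      · simp
      · by_cases h : V' r <;> simp [h, hAr]
    · intro x hx hxi
      simp only [State.na_setN, k1, k2]
      rw [if_neg (by omega)]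
      by_cases h : Nat.count A x = i
      · have e := h.trans hri.symm
        rw [if_pos (by omega), if_pos h, Nat.count_eq_of_count_eq hR.act e,
          Nat.count_eq_of_count_eq hDA e]
        exact ⟨rfl, rfl⟩
      · rw [if_neg (by omega), if_neg h]
        exact i2 x hx (by omega)
    · intro r' hr' hA hri'
      simp only [State.na_setN, k1]
      by_cases h : Nat.count A r' = i
      · obtain rfl := huniq r' hA h
        rw [if_pos (by omega)]
        rfl
      · rw [if_neg (by omega), if_neg (by omega)]
        exact i3 r' hr' hA (by omega)
    · intro r' hr' hA hri'
      simp only [State.na_setN, k3]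
      by_cases h : Nat.count A r' = i
      · obtain rfl := huniq r' (hR.act _ hA) h
        rw [if_pos ⟨hA, rfl⟩]
      · rw [if_neg]
        · exact i4 r' hr' hA (by omega)
        · rintro ⟨h1, h2⟩
          have : r' = r := Nat.count_injective hA h1 (by omega)
          rw [this] at h
          exact h hri
    · intro x hx
      simp only [State.na_setN, k3]
      rw [if_neg (by omega), i5 x hx]
  · rintro s₁ ⟨⟨i1, i2, i3, i4, i5⟩, -, hf⟩
    have hf : Frame [76, 112, 66, 70, 66, 84, 66, 58, 80, 66, 76] s₀ s₁ := hf
    obtain ⟨j1, j2⟩ := i1 m le_rfl hG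
    have e1 : s₁.nv 18 = G := by rw [hf.nv 18 (by decide)]; simpa [hs₀] using h18
    have e2 : s₁.nv 14 = o := by rw [hf.nv 14 (by decide)]; simpa [hs₀] using h14
    have e3 : s₁.nv 13 = S := by rw [hf.nv 13 (by decide)]; simpa [hs₀] using h13
    have e4 : s₁.na 13 = s.na 13 := by rw [hf.na 13 (by decide)]; simp [hs₀]
    have := hcA' m
    have := hcD m
    refine (Runs.straight (T := 29) (Q := fun s' =>
      (∀ j, s'.na 16 j = if j = 2 * G then 2 * Nat.count A' m + 1 else s₁.na 16 j) ∧
      (∀ j, s'.na 17 j = if j = G then Nat.count (fun r => A r ∧ ¬ V' r) m else s₁.na 17 j) ∧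
      (∀ x, s'.na 13 x = if x = o + S then Nat.count A' m else s.na 13 x) ∧
      (∀ x, s'.na 14 x = s₁.na 14 x) ∧ s'.nv 20 = Nat.count A' m)
      (by simp [wp, e1, e2, e3, e4, j1, j2]; omega) (Nat.le_of_ble_eq_true rfl)).mono le_rfl ?_
    rintro s₂ ⟨q16, q17, q13, q14, q20⟩
    refine ⟨⟨?_, ?_, ?_⟩, ?_, ?_, q20, q13, ?_, ?_⟩
    · intro r hr hV
      by_cases hAr : A r
      · have hlt : Nat.count A r < G := hG ▸ Nat.count_lt_count hAr hr
        have : activePos A r = 2 * Nat.count A r + 1 := by simp [activePos, hAr]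
        rw [this, q16, if_neg (by omega), i3 r hr hAr hlt, if_pos hV]
      · have hA'r : ¬ A' r := fun h => hAr (hR.act r h)
        have h1 : activePos A r = 2 * Nat.count A r := by simp [activePos, hAr]
        have h2 : activePos A' r = 2 * Nat.count A' r := by simp [activePos, hA'r]
        rw [h1, h2, q16]
        split_ifs with h3
        · rw [Nat.count_eq_of_count_eq (x := r) (y := m) hR.act (by omega)]
        · have : Nat.count A r ≤ Nat.count A m := Nat.count_monotone A hr.le
          exact (i2 r hr.le (by omega)).1
    · intro r hr hV hnV
      have hAr := hR.deleted r hV hnV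
      have hlt : Nat.count A r < G := hG ▸ Nat.count_lt_count hAr hr
      have : activePos A r = 2 * Nat.count A r + 1 := by simp [activePos, hAr]
      rw [this, q16, if_neg (by omega), i3 r hr hAr hlt, if_neg hnV]
    · intro r hr
      rw [q17]
      split_ifs with h3
      · rw [Nat.count_eq_of_count_eq (x := r) (y := m) hDA (by omega)]
      · have : Nat.count A r ≤ Nat.count A m := Nat.count_monotone A hr.le
        exact (i2 r hr.le (by omega)).2
    · intro j hj
      rw [q16]
      split_ifs with h3
      · exact le_rfl
      · obtain ⟨r, hr, hAr, hrj⟩ := Nat.exists_count_eq (A := A) (m := m) (i := j / 2) (by omega)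
        have hm : Nat.count A' r ≤ Nat.count A' m := Nat.count_monotone A' hr.le
        rcases Nat.mod_two_eq_zero_or_one j with h | h
        · rw [show j = 2 * Nat.count A r by omega, (i2 r hr.le (by omega)).1]
          omega
        · rw [show j = 2 * Nat.count A r + 1 by omega, i3 r hr hAr (by omega)]
          have := activePos_le (A := A') hr
          split_ifs <;> omega
    · intro j hj
      have hle : ∀ x, x ≤ m → Nat.count (fun r => A r ∧ ¬ V' r) x ≤ G := fun x hx => by
        have h1 : Nat.count (fun r => A r ∧ ¬ V' r) x ≤ Nat.count (fun r => A r ∧ ¬ V' r) m :=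
          Nat.count_monotone _ hx
        have h2 := hR.count_add_le m
        omega
      rw [q17]
      split_ifs with h3
      · exact hle m le_rfl
      · obtain ⟨r, hr, hAr, hrj⟩ := Nat.exists_count_eq (A := A) (m := m) (i := j) (by omega)
        rw [show j = Nat.count A r by omega, (i2 r hr.le (by omega)).2]
        exact hle r hr.le
    · intro r hr hA'r
      have hlt : Nat.count A r < G := hG ▸ Nat.count_lt_count (hR.act r hA'r) hr
      rw [q14]
      exact i4 r hr hA'r hlt
    · intro x hx
      rw [q14]
      exact i5 x hx

end

end RealRAM

/-! ### Stability of tables and tight intervals. -/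

section Count

variable {A V : ℕ → Prop} [DecidablePred A] [DecidablePred V] {m k : ℕ} {X : ℕ → ℝ}

theorem IsTable.congr {tp tp' : ℕ → ℕ → ℕ} {tl tr tl' tr' : ℕ → ℕ → ℝ}
    (hT : IsTable m k V A X tp tl tr)
    (h : ∀ T u, T ≤ Nat.count A m → u ≤ 4 * Nat.count A m →
      tp' T u = tp T u ∧ tl' T u = tl T u ∧ tr' T u = tr T u) : IsTable m k V A X tp' tl' tr' where
  sound T u hT' hu h0 := by
    obtain ⟨h1, h2, h3⟩ := h T u hT' hu
    rw [h1] at h0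
    rw [h1, h2, h3]
    exact hT.sound T u hT' hu h0
  complete T u P xl xr hT' hI := by
    obtain ⟨h1, h2, h3⟩ := h T u hT' hI.bounds.2.2.1
    rw [h1, h2, h3]
    exact hT.complete T u P xl xr hT' hI

/-- Take the first live point from `p` on and the `k`-th one from there. That `k ≥ 1` makes the
second not precede the first. -/
theorem Nat.exists_tight_interval {p q : ℕ} (hk : 1 ≤ k)
    (h : Nat.count V p + k ≤ Nat.count V (q + 1)) :
    ∃ p' q', p ≤ p' ∧ p' ≤ q' ∧ q' ≤ q ∧ V p' ∧ V q' ∧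
      Nat.count V (q' + 1) = Nat.count V p' + k := by
  obtain ⟨p', hp', hVp', hcp'⟩ := Nat.exists_count_eq (A := V) (m := q + 1) (i := Nat.count V p)
    (by omega)
  obtain ⟨q', hq', hVq', hcq'⟩ := Nat.exists_count_eq (A := V) (m := q + 1)
    (i := Nat.count V p + k - 1) (by omega)
  refine ⟨p', q', ?_, ?_, by omega, hVp', hVq', ?_⟩
  · by_contra! hlt
    have := Nat.count_lt_count hVp' hlt
    omega
  · by_contra! hlt
    have := Nat.count_lt_count hVq' hlt
    omega
  · rw [Nat.count_succ, if_pos hVq']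
    omega

end Count

/-! ### Nodes of the slab recursion and the step to a child. -/

namespace RealRAM

/-- The points of a slab that starts in the block at `b` and ends in the block at `t`, `h` being the
length of the blocks. -/
abbrev IsLive (σ : ℕ → ℕ) (h b t r : ℕ) : Prop := b ≤ σ r ∧ σ r < t + h

/-- The points of the two blocks. -/
abbrev IsActive (σ : ℕ → ℕ) (h b t r : ℕ) : Prop := IsLive σ h b t r ∧ (σ r < b + h ∨ t ≤ σ r)

/-- The ranks are distinct and those of active points lie in two blocks of length `h`. All tables of
a node therefore have size polynomial in `h` instead of `m`. -/
theorem count_isActive_le {σ : ℕ → ℕ} {m : ℕ} (hσ : ∀ r r', r < m → r' < m → σ r = σ r' → r = r')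
    (h b t : ℕ) : Nat.count (IsActive σ h b t) m ≤ 2 * h := by
  rw [Nat.count_eq_card_filter_range]
  calc _ ≤ (Finset.Ico b (b + h) ∪ Finset.Ico t (t + h)).card := by
        refine Finset.card_le_card_of_injOn σ ?_ ?_
        · intro r hr
          simp at hr ⊢
          omega
        · intro r hr r' hr' h
          simp at hr hr'
          exact hσ r r' hr.1 hr'.1 h
    _ ≤ _ := (Finset.card_union_le _ _).trans (by simp; omega)

/-- The child's slab lies inside the parent's and still contains everything between the parent's
blocks, so a lost point must have been in one of those blocks. -/
theorem refines_child {σ : ℕ → ℕ} {h b t nb nt : ℕ} (hb : b ≤ nb) (hb' : nb ≤ b + h) (ht : t ≤ nt)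
    (ht' : nt ≤ t + h) :
    Refines (IsLive σ (2 * h) b t) (IsActive σ (2 * h) b t) (IsLive σ h nb nt)
      (IsActive σ h nb nt) := by
  constructor <;> intro r <;> simp only [IsActive, IsLive] <;> omega

/-- The recursion tables of level `o` describe a node of the slab recursion. -/
structure NodeOK (m k K : ℕ) (σ : ℕ → ℕ) (X : ℕ → ℝ) (s : State) (o h b t : ℕ) : Prop where
  len : s.na 10 o = h
  bot : s.na 11 o = b
  top : s.na 12 o = t
  num : s.na 13 o = Nat.count (IsActive σ h b t) m
  rank : ∀ r, r < m → IsActive σ h b t r → s.na 14 (o + Nat.count (IsActive σ h b t) r) = σ r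
  table : IsTable m k (IsLive σ h b t) (IsActive σ h b t) X (fun T u => s.na 15 (o + T * K + u))
    (fun T u => s.ra 2 (o + T * K + u)) (fun T u => s.ra 3 (o + T * K + u))

/-- The recursion tables agree below address `L`. -/
structure LowEq (L : ℕ) (s s' : State) : Prop where
  na : ∀ a, 10 ≤ a → a < 16 → ∀ x, x < L → s'.na a x = s.na a x
  ra : ∀ a, 2 ≤ a → a < 4 → ∀ x, x < L → s'.ra a x = s.ra a x

theorem LowEq.trans {L : ℕ} {s s' s'' : State} (h : LowEq L s s') (h' : LowEq L s' s'') :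
    LowEq L s s'' :=
  ⟨fun a h1 h2 x hx => (h'.na a h1 h2 x hx).trans (h.na a h1 h2 x hx),
    fun a h1 h2 x hx => (h'.ra a h1 h2 x hx).trans (h.ra a h1 h2 x hx)⟩

theorem LowEq.of_eq {L : ℕ} {s s' : State} (h : s'.na = s.na) (h' : s'.ra = s.ra) : LowEq L s s' :=
  ⟨fun a _ _ x _ => by rw [h], fun a _ _ x _ => by rw [h']⟩

/-- All data of a node lie in the window of `K * K` addresses from `o` on. A deeper level writes
only beyond it, and so the parent's tables survive the recursive calls. -/
theorem NodeOK.congr {m k K : ℕ} {σ : ℕ → ℕ} {X : ℕ → ℝ} {s s' : State} {o h b t : ℕ}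
    (hN : NodeOK m k K σ X s o h b t) (hK : 4 * m < K) (h' : LowEq (o + K * K) s s') :
    NodeOK m k K σ X s' o h b t := by
  have hKK : K ≤ K * K := Nat.le_mul_self K
  have hcm := Nat.count_le (IsActive σ h b t) (n := m)
  refine ⟨?_, ?_, ?_, ?_, ?_, hN.table.congr ?_⟩
  · rw [h'.na 10 (by decide) (by decide) o (by omega), hN.len]
  · rw [h'.na 11 (by decide) (by decide) o (by omega), hN.bot]
  · rw [h'.na 12 (by decide) (by decide) o (by omega), hN.top]
  · rw [h'.na 13 (by decide) (by decide) o (by omega), hN.num]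
  · intro r hr hA
    have := Nat.count_lt_count hA hr
    rw [h'.na 14 (by decide) (by decide) _ (by omega), hN.rank r hr hA]
  · intro T u hT hu
    have := index_lt (K := K) (T := T) (u := u) (by omega) (by omega)
    exact ⟨h'.na 15 (by decide) (by decide) _ (by omega),
      h'.ra 2 (by decide) (by decide) _ (by omega), h'.ra 3 (by decide) (by decide) _ (by omega)⟩

/-- Set up the tables of the child with blocks of length `nvar 15` at `nvar 16` and `nvar 17`. -/
def enterNode : Cmd :=
  (.nput 10 (nvar 14 + nvar 13) (nvar 15) ;; .nput 11 (nvar 14 + nvar 13) (nvar 16) ;;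
    .nput 12 (nvar 14 + nvar 13) (nvar 17) ;; .nset 18 (.get 13 (nvar 14))) ;;
  markPoints ;; clearTable ;; moveTable

section

variable {pr : List Cmd} {pw : ℕ → List ℕ} (hpw : WritesOK pr pw)
include hpw

-- The child's tables are written to the next level while the parent's stay in place for the other
-- children. The table content is the combination of `RefineTables.forward` (soundness of what is
-- moved) and `IsTable.refine` (nothing is missed).
set_option maxHeartbeats 1000000 in
theorem enterNode_runs {B m k K o h b t nb nt : ℕ} {σ : ℕ → ℕ} {X : ℕ → ℝ} {s : State}
    (hσ : ∀ r r', r < m → r' < m → σ r = σ r' → r = r') (hσB : ∀ r, r < m → σ r < m)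
    (hK : 4 * m < K) (hB : o + 2 * (K * K) ≤ B) (hhB : t + 2 * h ≤ B) (hh : 1 ≤ h)
    (h14 : s.nv 14 = o) (h12 : s.nv 12 = K) (h13 : s.nv 13 = K * K) (h15 : s.nv 15 = h)
    (h16 : s.nv 16 = nb) (h17 : s.nv 17 = nt)
    (hb : b ≤ nb) (hb' : nb ≤ b + h) (ht : t ≤ nt) (ht' : nt ≤ t + h) (hbt : nb ≤ nt)
    (hm : 1 ≤ m) (hN : NodeOK m k K σ X s o (2 * h) b t) :
    Runs pr B enterNode s (30000 * h ^ 2) fun s' =>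
      NodeOK m k K σ X s' (o + K * K) h nb nt ∧ LowEq (o + K * K) s s' := by
  have hKK : K ≤ K * K := Nat.le_mul_self K
  set A := IsActive σ (2 * h) b t with hA
  set V := IsLive σ (2 * h) b t with hV
  set A' := IsActive σ h nb nt with hA'
  set V' := IsLive σ h nb nt with hV'
  have hR : Refines V A V' A' := refines_child hb hb' ht ht'
  have hGm : Nat.count A m ≤ m := Nat.count_le A
  have hGm' : Nat.count A' m ≤ m := Nat.count_le A'
  have hG4 : Nat.count A m ≤ 2 * (2 * h) := count_isActive_le hσ _ _ _
  have hG4' : Nat.count A' m ≤ 2 * h := count_isActive_le hσ _ _ _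
  set G := Nat.count A m with hG
  set G' := Nat.count A' m with hG'
  -- With at most `4 h` active points in the parent and `2 h` in the child, clearing and moving the
  -- tables are quadratic in `h`, and marking is linear.
  have hcost : 20 + ((G * 109 + 40) + (((G' + 1) * ((4 * G' + 1) * 24 + 22) + 9) +
      ((G + 1) * ((4 * G + 1) * 213 + 22) + 9))) ≤ 30000 * h ^ 2 := by
    have e1 : (G' + 1) * ((4 * G' + 1) * 24 + 22) ≤ (3 * h) * ((9 * h) * 24 + 22 * h) :=
      Nat.mul_le_mul (by omega) (by omega)
    have e2 : (G + 1) * ((4 * G + 1) * 213 + 22) ≤ (5 * h) * ((17 * h) * 213 + 22 * h) :=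
      Nat.mul_le_mul (by omega) (by omega)
    have e3 : h ≤ h ^ 2 := by rw [pow_two]; exact Nat.le_mul_self h
    have e4 : (3 * h) * ((9 * h) * 24 + 22 * h) = 714 * h ^ 2 := by ring
    have e5 : (5 * h) * ((17 * h) * 213 + 22 * h) = 18215 * h ^ 2 := by ring
    omega
  refine Runs.mono (T := 20 + ((G * 109 + 40) + (((G' + 1) * ((4 * G' + 1) * 24 + 22) + 9) +
      ((G + 1) * ((4 * G + 1) * 213 + 22) + 9)))) ?_ hcost fun _ h => h
  refine Runs.seq' (T := 20) ((Runs.straight (Q := fun s₁ =>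
      (∀ x, s₁.na 10 x = if x = o + K * K then h else s.na 10 x) ∧
      (∀ x, s₁.na 11 x = if x = o + K * K then nb else s.na 11 x) ∧
      (∀ x, s₁.na 12 x = if x = o + K * K then nt else s.na 12 x) ∧ s₁.nv 18 = G)
    (by
      simp [wp, h14, h13, h15, h16, h17, hN.num, ← hA, ← hG]
      omega) (Nat.le_of_ble_eq_true rfl)).frame hpw) ?_ le_rfl
  rintro s₁ ⟨⟨a1, a2, a3, a4⟩, hf₁⟩
  have hf₁ : Frame [42, 46, 50, 72] s s₁ := hf₁
  refine Runs.seq' ((markPoints_runs hpw (o := o) (S := K * K) (G := G) (m := m) (nb := nb) (nt := nt)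
    (h := h) (σ := σ) (s := s₁)
    (by rw [hf₁.nv 14 (by decide), h14]) (by rw [hf₁.nv 13 (by decide), h13]) a4
    (by rw [hf₁.nv 16 (by decide), h16]) (by rw [hf₁.nv 17 (by decide), h17])
    (by rw [hf₁.nv 15 (by decide), h15]) hR rfl (by omega)
    (fun r hr hAr => by rw [hf₁.na 14 (by decide)]; exact hN.rank r hr hAr)
    (fun r hr => by have := hσB r hr; omega) (by omega)
    (fun r hr hAr => Iff.rfl) (fun r hr hAr => Iff.rfl)).frame hpw) ?_ le_rfl
  rintro s₂ ⟨⟨b1, b2, b3, b4, b5, b6, b7⟩, hf₂⟩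
  have hf₂ : Frame [80, 84, 76, 112, 66, 70, 66, 84, 66, 58, 80, 66, 76, 66, 70, 54] s₁ s₂ := hf₂
  refine Runs.seq' ((clearTable_runs hpw (o := o) (K := K) (G' := G') (s := s₂)
    (by rw [hf₂.nv 14 (by decide), hf₁.nv 14 (by decide), h14])
    (by rw [hf₂.nv 12 (by decide), hf₁.nv 12 (by decide), h12])
    (by rw [hf₂.nv 13 (by decide), hf₁.nv 13 (by decide), h13]) b4 (by omega) hB).frame hpw) ?_
    le_rfl
  rintro s₃ ⟨⟨c1, c2⟩, hf₃⟩
  have hf₃ : Frame [88, 92, 62, 92, 88] s₂ s₃ := hf₃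
  have e15 : ∀ T u, T ≤ G → u ≤ 4 * G → s₃.na 15 (o + T * K + u) = s.na 15 (o + T * K + u) := by
    intro T u hT hu
    have := index_lt (K := K) (T := T) (u := u) (by omega) (by omega)
    rw [c2 _ (by omega), hf₂.na 15 (by decide), hf₁.na 15 (by decide)]
  have e2 : s₃.ra = s.ra := by
    funext a
    rw [hf₃.ra a (by simp; omega), hf₂.ra a (by simp; omega), hf₁.ra a (by simp; omega)]
  have hT₃ : IsTable m k V A X (fun T u => s₃.na 15 (o + T * K + u))
      (fun T u => s₃.ra 2 (o + T * K + u)) (fun T u => s₃.ra 3 (o + T * K + u)) :=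
    hN.table.congr fun T u hT hu => ⟨e15 T u hT hu, by rw [e2], by rw [e2]⟩
  have e16 : s₃.na 16 = s₂.na 16 := hf₃.na 16 (by decide)
  have e17 : s₃.na 17 = s₂.na 17 := hf₃.na 17 (by decide)
  refine ((moveTable_runs hpw (o := o) (K := K) (G := G) (G' := G') (s := s₃)
    (by rw [hf₃.nv 14 (by decide), hf₂.nv 14 (by decide), hf₁.nv 14 (by decide), h14])
    (by rw [hf₃.nv 12 (by decide), hf₂.nv 12 (by decide), hf₁.nv 12 (by decide), h12])
    (by rw [hf₃.nv 13 (by decide), hf₂.nv 13 (by decide), hf₁.nv 13 (by decide), h13])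
    (by rw [hf₃.nv 18 (by decide), hf₂.nv 18 (by decide), a4])
    (by rw [hf₃.nv 20 (by decide), b4]) (by omega) (by omega) hB e16 e17 b2 b3
    (fun _ _ => rfl) (fun _ _ => rfl) (fun _ _ => rfl)
    (fun T u hT hu h0 => by
      have := (hT₃.sound T u hT hu h0).bounds
      exact ⟨this.2.2.2.1, this.2.2.2.2⟩)
    (R := fun T u P xl xr => IsLiveInterval m k V' A' X T u P xl xr)
    (fun T u hT hu h0 h1 h2 h3 => b1.forward hR (hT₃.sound T u hT hu h0) h1 h2 h3) c1).frame
      hpw).mono le_rfl ?_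
  rintro s₄ ⟨⟨d1, d2, d3⟩, hf₄⟩
  have hf₄ : Frame [88, 92, 108, 96, 100, 104, 112, 62, 11, 15, 92, 88] s₃ s₄ := hf₄
  refine ⟨⟨?_, ?_, ?_, ?_, ?_, ?_⟩, ?_, ?_⟩
  · rw [hf₄.na 10 (by decide), hf₃.na 10 (by decide), hf₂.na 10 (by decide), a1, if_pos rfl]
  · rw [hf₄.na 11 (by decide), hf₃.na 11 (by decide), hf₂.na 11 (by decide), a2, if_pos rfl]
  · rw [hf₄.na 12 (by decide), hf₃.na 12 (by decide), hf₂.na 12 (by decide), a3, if_pos rfl]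
  · rw [hf₄.na 13 (by decide), hf₃.na 13 (by decide), b5, if_pos rfl]
  · intro r hr hAr
    rw [hf₄.na 14 (by decide), hf₃.na 14 (by decide)]
    exact b6 r hr hAr
  · refine hT₃.refine hR b1 d1 ?_
    intro T u hT hu h0 h1 h2 T' u' hT' h3 h4
    exact d2 T u hT hu h0 h1 h2 T' u' hT' h3 h4
  · intro a ha1 ha2 x hx
    by_cases ha : a = 15
    · subst ha
      rw [(d3 x hx).1, c2 x hx, hf₂.na 15 (by decide), hf₁.na 15 (by decide)]
    · rw [hf₄.na a (by simp; omega), hf₃.na a (by simp; omega)]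
      by_cases h10 : a = 10
      · subst h10
        rw [hf₂.na 10 (by decide), a1, if_neg (by omega)]
      by_cases h11 : a = 11
      · subst h11
        rw [hf₂.na 11 (by decide), a2, if_neg (by omega)]
      by_cases h12 : a = 12
      · subst h12
        rw [hf₂.na 12 (by decide), a3, if_neg (by omega)]
      by_cases h13 : a = 13
      · subst h13
        rw [b5, if_neg (by omega), hf₁.na 13 (by decide)]
      obtain rfl : a = 14 := by omega
      rw [b7 x hx, hf₁.na 14 (by decide)]
  · intro a ha1 ha2 x hx
    rw [← e2]
    by_cases ha : a = 2
    · subst ha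
      exact (d3 x hx).2.1
    · obtain rfl : a = 3 := by omega
      exact (d3 x hx).2.2

end


/-! ### The slab recursion. -/

/-- Half of the perimeter of the rectangle in the real variables `0`–`3`. -/
def halfPerim (s : State) : ℝ := s.rv 1 - s.rv 0 + (s.rv 3 - s.rv 2)

/-- Compare the current best rectangle with the one described by table cell `nvar 23`. -/
def leafCell : Cmd :=
  .cond (.and (.nle 1 (.get 15 (nvar 14 + nvar 23)))
      (.not (.rle (rvar 1 - rvar 0 + (rvar 3 - rvar 2))
        (.get 3 (nvar 14 + nvar 23) - .get 2 (nvar 14 + nvar 23) +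
          (.get 4 (.get 12 (nvar 14)) - .get 4 (.get 11 (nvar 14)))))))
    (.rset 0 (.get 2 (nvar 14 + nvar 23)) ;; .rset 1 (.get 3 (nvar 14 + nvar 23)) ;;
      .rset 2 (.get 4 (.get 11 (nvar 14))) ;; .rset 3 (.get 4 (.get 12 (nvar 14))))
    .skip

/-- Compare the current best rectangle with all those of the current slab. -/
def leafNode : Cmd := forTo 23 (4 * .get 13 (nvar 14) + 1) leafCell

/-- Solve the child whose blocks are the halves `e` and `f` of the current blocks. -/
def childNode (e f : ℕ) : Cmd :=
  (.nset 15 (.get 10 (nvar 14) / 2) ;;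
    .nset 16 (.get 11 (nvar 14) + .lit e * nvar 15) ;;
    .nset 17 (.get 12 (nvar 14) + .lit f * nvar 15)) ;;
  .cond (.and (.nle (nvar 16) (nvar 17)) (.not (.nle (nvar 3) (nvar 17))))
    (enterNode ;; .nset 14 (nvar 14 + nvar 13) ;; .call 0 ;; .nset 14 (nvar 14 - nvar 13))
    .skip

/-- The slab recursion. -/
def solveNode : Cmd :=
  .cond (.nle (.get 10 (nvar 14)) 1) leafNode
    (childNode 0 0 ;; childNode 0 1 ;; childNode 1 0 ;; childNode 1 1)

/-- What `solveNode` modifies. -/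
def solveWrites : List ℕ :=
  [56, 60, 64, 68, 72, 76, 80, 84, 88, 92, 96, 100, 104, 108, 112, 1, 5, 9, 13, 42, 46, 50, 54, 58,
    62, 66, 70, 11, 15]

/-- The list assumed for the recursive call is the one to be proved, so this is the fixed-point
check that `WritesOK` requires. -/
theorem solveNode_writes {pw : ℕ → List ℕ} (h : pw 0 = solveWrites) :
    solveNode.writes pw ⊆ solveWrites := by
  have h1 : ∀ e f, (childNode e f).writes pw ⊆ solveWrites := by
    intro e f
    have he : enterNode.writes pw ⊆ solveWrites := by
      have h1 : markPoints.writes pw = [80, 84, 76, 112, 66, 70, 66, 84, 66, 58, 80, 66, 76, 66, 70,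
          54] := rfl
      have h2 : clearTable.writes pw = [88, 92, 62, 92, 88] := rfl
      have h3 : moveTable.writes pw = [88, 92, 108, 96, 100, 104, 112, 62, 11, 15, 92, 88] := rfl
      simp only [enterNode, Cmd.writes, h1, h2, h3, List.append_subset]
      decide
    simp only [childNode, Cmd.writes, List.append_subset, h, he]
    decide
  have h2 : solveNode.writes pw = [92, 1, 5, 9, 13, 92] ++ ((childNode 0 0).writes pw ++
    ((childNode 0 1).writes pw ++ ((childNode 1 0).writes pw ++ (childNode 1 1).writes pw))) := rfl
  rw [h2]
  simp only [List.append_subset]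
  exact ⟨by decide, h1 _ _, h1 _ _, h1 _ _, h1 _ _⟩

/-- The constant part of the memory during the slab recursion. -/
structure SolveStatic (m K : ℕ) (Y : ℕ → ℝ) (s : State) : Prop where
  num : s.nv 3 = m
  row : s.nv 12 = K
  lev : s.nv 13 = K * K
  y : ∀ j, j < m → s.ra 4 j = Y j

theorem SolveStatic.frame {m K : ℕ} {Y : ℕ → ℝ} {s s' : State} (h : SolveStatic m K Y s)
    {W : List ℕ} (hW : W ⊆ solveWrites) (hf : Frame W s s') : SolveStatic m K Y s' := by
  have hf := hf.mono hW
  exact ⟨by rw [hf.nv 3 (by decide), h.num], by rw [hf.nv 12 (by decide), h.row],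
    by rw [hf.nv 13 (by decide), h.lev], fun j hj => by rw [hf.ra 4 (by decide), h.y j hj]⟩

/-- A correct slab problem: `m` points with ranks `σ` in the second coordinate and sorted
coordinates `X` and `Y`; `Good` holds for all rectangles with at least `k` points. -/
structure SlabProblem (m k : ℕ) (σ : ℕ → ℕ) (X Y : ℕ → ℝ) (Good : ℝ → ℝ → ℝ → ℝ → Prop) : Prop where
  pos : 1 ≤ k
  inj : ∀ r r', r < m → r' < m → σ r = σ r' → r = r'
  lt : ∀ r, r < m → σ r < m
  mono : ∀ r r', r ≤ r' → r' < m → X r ≤ X r'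
  good : ∀ i j p q, i ≤ j → j < m → p ≤ q → q < m →
    Nat.count (IsLive σ 1 i j) p + k ≤ Nat.count (IsLive σ 1 i j) (q + 1) → Good (X p) (X q) (Y i) (Y j)

/-- All rectangles with at least `k` points between block `b` and block `t` have half-perimeter at
least `v`. -/
def Covers (m k : ℕ) (σ : ℕ → ℕ) (X Y : ℕ → ℝ) (h b t : ℕ) (v : ℝ) : Prop :=
  ∀ i j p q, b ≤ i → i < b + h → t ≤ j → j < t + h → i ≤ j → j < m → p ≤ q → q < m →
    Nat.count (IsLive σ 1 i j) p + k ≤ Nat.count (IsLive σ 1 i j) (q + 1) → v ≤ X q - X p + (Y j - Y i)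

theorem Covers.mono {m k : ℕ} {σ : ℕ → ℕ} {X Y : ℕ → ℝ} {h b t : ℕ} {v v' : ℝ}
    (H : Covers m k σ X Y h b t v) (hv : v' ≤ v) : Covers m k σ X Y h b t v' :=
  fun i j p q h1 h2 h3 h4 h5 h6 h7 h8 h9 => hv.trans (H i j p q h1 h2 h3 h4 h5 h6 h7 h8 h9)

/-- The result of the search between block `b` and block `t`. -/
structure SolvePost (m k K : ℕ) (σ : ℕ → ℕ) (X Y : ℕ → ℝ) (Good : ℝ → ℝ → ℝ → ℝ → Prop)
    (s : State) (o h b t : ℕ) (s' : State) : Prop where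
  good : Good (s'.rv 0) (s'.rv 1) (s'.rv 2) (s'.rv 3)
  le : halfPerim s' ≤ halfPerim s
  low : LowEq (o + K * K) s s'
  base : s'.nv 14 = o
  static : SolveStatic m K Y s'
  covers : Covers m k σ X Y h b t (halfPerim s')

section

variable {pr : List Cmd} {pw : ℕ → List ℕ} (hpw : WritesOK pr pw)
  {B m k K : ℕ} {σ : ℕ → ℕ} {X Y : ℕ → ℝ} {Good : ℝ → ℝ → ℝ → ℝ → Prop}
  (hP : SlabProblem m k σ X Y Good)
include hpw hP

/-- For `h = 1` the bottom and top ranks are fixed and no point will be deleted any more, so only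
surplus `0` matters. There are at most two active points, hence at most nine cells, and the time is
constant. -/
theorem leafNode_runs {o b t : ℕ} {s : State} (hS : SolveStatic m K Y s)
    (h14 : s.nv 14 = o) (hN : NodeOK m k K σ X s o 1 b t) (hbt : b ≤ t) (htm : t < m)
    (hB : 4 * m + 1 ≤ B) (hg : Good (s.rv 0) (s.rv 1) (s.rv 2) (s.rv 3)) :
    Runs pr B leafNode s 1000 (SolvePost m k K σ X Y Good s o 1 b t) := by
  have hG : Nat.count (IsActive σ 1 b t) m ≤ 2 * 1 := count_isActive_le hP.inj 1 b t
  have hGm : Nat.count (IsActive σ 1 b t) m ≤ m := Nat.count_le _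
  have hW : leafNode.writes pw = [92, 1, 5, 9, 13, 92] := rfl
  refine (forTo_runs hpw (N := 4 * Nat.count (IsActive σ 1 b t) m + 1) (T := 80) (fun u s' =>
    Good (s'.rv 0) (s'.rv 1) (s'.rv 2) (s'.rv 3) ∧ halfPerim s' ≤ halfPerim s ∧
    ∀ u', u' < u → s.na 15 (o + u') ≠ 0 →
      halfPerim s' ≤ s.ra 3 (o + u') - s.ra 2 (o + u') + (Y t - Y b))
    (by simp [Cmd.writes, leafCell]) (by omega) ?_ ?_ ?_ (T₀ := 1000) (by simp; omega)).mono
      le_rfl ?_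
  · intro s' hf
    have hf : Frame [92, 1, 5, 9, 13, 92] s s' := hf
    simp [hf.nv 14 (by decide), hf.na 13 (by decide), h14, hN.num]
  · exact ⟨hg, le_rfl, by simp⟩
  · rintro u s' hu hf hu' ⟨h1, h2, h3⟩
    have hf : Frame [92, 1, 5, 9, 13, 92] s s' := hf
    have e4 : s'.ra 4 = s.ra 4 := hf.ra 4 (by decide)
    have e3 : s'.ra 3 = s.ra 3 := hf.ra 3 (by decide)
    have e2 : s'.ra 2 = s.ra 2 := hf.ra 2 (by decide)
    have e15 : s'.na 15 = s.na 15 := hf.na 15 (by decide)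
    have e12 : s'.na 12 o = t := by rw [hf.na 12 (by decide), hN.top]
    have e11 : s'.na 11 o = b := by rw [hf.na 11 (by decide), hN.bot]
    have e14 : s'.nv 14 = o := by rw [hf.nv 14 (by decide), h14]
    have et : s.ra 4 t = Y t := hS.y t htm
    have eb : s.ra 4 b = Y b := hS.y b (by omega)
    refine Runs.straight ?_ (Nat.le_of_ble_eq_true rfl)
    simp only [leafCell, wp, BExp.eval_and, BExp.eval_nle, BExp.eval_not, BExp.eval_rle,
      NExp.eval_ofNat, NExp.eval_get', NExp.eval_add', NExp.eval_var', RExp.eval_add',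
      RExp.eval_sub', RExp.eval_var', RExp.eval_get', State.nv_setR, State.na_setR, State.ra_setR,
      State.rv_setR, State.rv_setN, halfPerim, e15, e14, hu', e2, e3, e4, e12, e11, et, eb]
    constructor
    · rintro ⟨h4, h5⟩
      rw [not_le] at h5
      have hI := hN.table.sound 0 u (by omega) (by omega) (by simpa using (by omega : s.na 15 (o + u) ≠ 0))
      obtain ⟨p, q, hpq, hq, hVp, hVq, hc, -, -, hxl, hxr⟩ := hI
      simp only [Nat.zero_mul, Nat.add_zero] at hxl hxr hc
      refine ⟨?_, ?_, ?_⟩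
      · simp
        rw [hxl, hxr]
        exact hP.good b t p q hbt htm hpq hq (by omega)
      · simp
        unfold halfPerim at h2
        linarith
      · intro u' hu₁ h0
        simp
        by_cases huu : u' = u
        · rw [huu]
          linarith
        · have := h3 u' (by omega) h0
          unfold halfPerim at this
          linarith
    · intro h4
      refine ⟨h1, h2, fun u' hu₁ h0 => ?_⟩
      by_cases huu : u' = u
      · by_contra h5
        apply h4
        rw [← huu]
        refine ⟨by omega, fun h6 => h5 ?_⟩
        linarith
      · exact h3 u' (by omega) h0
  · rintro s' ⟨⟨h1, h2, h3⟩, -, hf⟩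
    have hf : Frame [92, 1, 5, 9, 13, 92] s s' := hf
    refine ⟨h1, h2, ⟨fun a _ _ x _ => by rw [hf.na a (by simp; omega)],
      fun a _ _ x _ => by rw [hf.ra a (by simp; omega)]⟩, by rw [hf.nv 14 (by decide), h14],
      hS.frame (by decide) hf, ?_⟩
    intro i j p q hi1 hi2 hj1 hj2 hij hjm hpq hqm hc
    obtain rfl : i = b := by omega
    obtain rfl : j = t := by omega
    -- Any interval with enough points shrinks to one with exactly `k` live points and live ends.
    -- The table knows one at least as short.
    obtain ⟨p', q', hpp', hpq', hqq', hVp', hVq', hc'⟩ := Nat.exists_tight_interval hP.pos hc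
    have hI : IsLiveInterval m k (IsLive σ 1 i j) (IsActive σ 1 i j) X 0
        (activePos (IsActive σ 1 i j) p' + activePos (IsActive σ 1 i j) q')
        (activePos (IsActive σ 1 i j) p' + 1)
        (X p') (X q') :=
      ⟨p', q', hpq', by omega, hVp', hVq', by omega, rfl, rfl, rfl, rfl⟩
    obtain ⟨h4, h5⟩ := hN.table.complete 0 _ _ _ _ (by omega) hI
    have h6 := hI.bounds.2.2.1
    simp only [Nat.zero_mul, Nat.add_zero] at h4 h5
    have h7 := h3 _ (by omega) h4
    have h8 := hP.mono p p' hpp' (by omega)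
    have h9 := hP.mono q' q hqq' hqm
    linarith

/-- The two blocks of a node coincide or are disjoint (`hal`), and this passes to every child that
is entered. A child is skipped if its top block starts beyond the last rank, or if its bottom block
comes after its top block. It then contains no pair of ranks `i ≤ j < m`. -/
theorem childNode_runs {o h b t e f T : ℕ} {s : State} (he : e < 2) (hf : f < 2)
    (hS : SolveStatic m K Y s) (hK : 4 * m < K) (h14 : s.nv 14 = o) (hh : 1 ≤ h)
    (hN : NodeOK m k K σ X s o (2 * h) b t) (hal : b = t ∨ b + 2 * h ≤ t) (htm : t < m)
    (hB : o + 2 * (K * K) ≤ B) (htB : t + 2 * h ≤ B)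
    (hg : Good (s.rv 0) (s.rv 1) (s.rv 2) (s.rv 3))
    (ih : ∀ nb nt s₁, SolveStatic m K Y s₁ → s₁.nv 14 = o + K * K →
      NodeOK m k K σ X s₁ (o + K * K) h nb nt → (nb = nt ∨ nb + h ≤ nt) → nt < m → nt ≤ t + h →
      Good (s₁.rv 0) (s₁.rv 1) (s₁.rv 2) (s₁.rv 3) →
      Runs pr B (.call 0) s₁ T (SolvePost m k K σ X Y Good s₁ (o + K * K) h nb nt)) :
    Runs pr B (childNode e f) s (30000 * h ^ 2 + T + 100)
      (SolvePost m k K σ X Y Good s o h (b + e * h) (t + f * h)) := by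
  have hKK : K ≤ K * K := Nat.le_mul_self K
  have heh : e * h ≤ h := by nlinarith
  have hfh : f * h ≤ h := by nlinarith
  have halc : b + e * h ≤ t + f * h → (b + e * h = t + f * h ∨ b + e * h + h ≤ t + f * h) := by
    interval_cases e <;> interval_cases f <;> omega
  -- This happens only for coinciding blocks with the upper half as bottom and the lower half as
  -- top.
  have hskip : ¬ b + e * h ≤ t + f * h → t + f * h + h ≤ b + e * h := by
    interval_cases e <;> interval_cases f <;> omega
  refine Runs.mono (T := 30 + (20 + (30000 * h ^ 2 + (T + 40)))) ?_ (by omega) fun _ h => h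
  refine Runs.seq' ((Runs.straight (Q := fun s₁ => s₁.nv 15 = h ∧ s₁.nv 16 = b + e * h ∧
      s₁.nv 17 = t + f * h) (by
        simp [wp, h14, hN.len, hN.bot, hN.top]
        omega) (Nat.le_of_ble_eq_true rfl)).frame hpw) ?_ le_rfl
  rintro s₁ ⟨⟨a1, a2, a3⟩, hf₁⟩
  have hf₁ : Frame [60, 64, 68] s s₁ := hf₁
  have hS₁ := hS.frame (by decide) hf₁
  have hL₁ : LowEq (o + K * K) s s₁ := LowEq.of_eq
    (funext fun a => hf₁.na a (by simp; omega)) (funext fun a => hf₁.ra a (by simp; omega))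
  have e14 : s₁.nv 14 = o := by rw [hf₁.nv 14 (by decide), h14]
  have er : s₁.rv = s.rv := funext fun a => hf₁.rv a (by simp; omega)
  refine (Runs.cond (T := 30000 * h ^ 2 + (T + 40)) ?_ ?_).mono (by simp [BExp.size]) fun _ h => h
  · intro hb
    simp only [BExp.eval_and, BExp.eval_nle, BExp.eval_not, NExp.eval_var', a2, a3, hS₁.num] at hb
    refine Runs.seq' ((enterNode_runs hpw hP.inj hP.lt hK hB htB hh e14 hS₁.row hS₁.lev a1 a2 a3
      (by omega) (by omega) (by omega) (by omega) hb.1 (by omega)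
      (hN.congr hK hL₁)).frame hpw) ?_ le_rfl
    rintro s₂ ⟨⟨b1, b2⟩, hf₂⟩
    have hf₂ : Frame [42, 46, 50, 72, 80, 84, 76, 112, 66, 70, 66, 84, 66, 58, 80, 66, 76, 66, 70,
      54, 88, 92, 62, 92, 88, 88, 92, 108, 96, 100, 104, 112, 62, 11, 15, 92, 88] s₁ s₂ := hf₂
    have hS₂ := hS₁.frame (by decide) hf₂
    have er₂ : ∀ a, a < 4 → s₂.rv a = s.rv a := fun a ha => by
      rw [hf₂.rv a (by simp; omega), er]
    refine Runs.seq' (T := 5) (T' := T + 35) ((Runs.straight (Q := fun s₃ => s₃ =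
      s₂.setN 14 (o + K * K)) (by
        simp [wp, hf₂.nv 14 (by decide), e14, hS₂.lev]
        omega) (Nat.le_of_ble_eq_true rfl)).frame hpw) ?_ (by omega)
    rintro s₃ ⟨rfl, hf₃⟩
    have hf₃ : Frame [56] s₂ (s₂.setN 14 (o + K * K)) := hf₃
    have hS₃ := hS₂.frame (by decide) hf₃
    refine Runs.seq' (T' := 10) (ih (b + e * h) (t + f * h) (s₂.setN 14 (o + K * K)) hS₃ (by simp)
      ⟨b1.len, b1.bot, b1.top, b1.num, b1.rank, b1.table⟩ (halc hb.1) (by omega) (by omega) (by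
        simpa [er₂] using hg)) ?_ (by omega)
    intro s₄ h4
    refine ((Runs.straight (Q := fun s₅ => s₅ = s₄.setN 14 o) (by
        simp [wp, h4.base, h4.static.lev]
        omega) (Nat.le_of_ble_eq_true rfl)).frame hpw).mono le_rfl ?_
    rintro s₅ ⟨rfl, hf₅⟩
    have hf₅ : Frame [56] s₄ (s₄.setN 14 o) := hf₅
    have hle : halfPerim (s₄.setN 14 o) ≤ halfPerim s := by
      have := h4.le
      simpa [halfPerim, er₂] using this
    refine ⟨h4.good, hle, ?_, by simp, h4.static.frame (by decide) hf₅, h4.covers⟩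
    exact hL₁.trans (b2.trans ⟨fun a h1 h2 x hx => h4.low.na a h1 h2 x (by omega),
      fun a h1 h2 x hx => h4.low.ra a h1 h2 x (by omega)⟩)
  · intro hb
    simp only [BExp.eval_and, BExp.eval_nle, BExp.eval_not, NExp.eval_var', a2, a3, hS₁.num] at hb
    refine (Runs.straight (Q := fun s₅ => s₅ = s₁) (by simp [wp])
      (Nat.le_of_ble_eq_true rfl)).mono (T := 1) (by omega) ?_
    rintro s₅ rfl
    refine ⟨by rw [er]; exact hg, by simp [halfPerim, er], hL₁, e14, hS₁, ?_⟩
    intro i j p q h1 h2 h3 h4 h5 h6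
    by_cases hbt : b + e * h ≤ t + f * h
    · omega
    · have := hskip hbt
      omega

/-- The four children partition the pairs of ranks. Each of the levels needs one window of `K * K`
addresses, whence the word bound with `L + 2` windows. -/
theorem solveNode_runs (hpr : pr[0]? = some solveNode)
    (hK : 4 * m < K) (hmB : 4 * m + 1 ≤ B) (L : ℕ) :
    ∀ {o b t : ℕ} {s : State}, SolveStatic m K Y s → s.nv 14 = o →
      NodeOK m k K σ X s o (2 ^ L) b t → (b = t ∨ b + 2 ^ L ≤ t) → t < m →
      o + (L + 2) * (K * K) ≤ B → t + 2 ^ L ≤ B →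
      Good (s.rv 0) (s.rv 1) (s.rv 2) (s.rv 3) →
      Runs pr B (.call 0) s (140000 * ((L + 1) * 4 ^ L))
        (SolvePost m k K σ X Y Good s o (2 ^ L) b t) := by
  induction L with
  | zero =>
    intro o b t s hS h14 hN hal htm hB htB hg
    refine (Runs.call (T := 1010) hpr ?_).mono (by simp) fun _ h => h
    refine (Runs.cond (T := 1000) ?_ ?_).mono (by simp [BExp.size]) fun _ h => h
    · intro _
      exact leafNode_runs hpw hP hS h14 hN (by simp at hal; omega) htm hmB hg
    · intro hb
      simp [h14, hN.len] at hb
  | succ L ih =>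
    intro o b t s hS h14 hN hal htm hB htB hg
    have hp : 2 ^ (L + 1) = 2 * 2 ^ L := by rw [pow_succ]; ring
    have hp1 : 1 ≤ 2 ^ L := Nat.one_le_two_pow
    have hp4 : (2 ^ L) ^ 2 = 4 ^ L := by rw [← pow_mul, mul_comm, pow_mul]; rfl
    have h41 : 1 ≤ 4 ^ L := Nat.one_le_pow _ _ (by decide)
    rw [hp] at hN hal htB
    set h := 2 ^ L with hh
    have hB2 : (L + 1 + 2) * (K * K) = (L + 2) * (K * K) + K * K := by ring
    have hB3 : (L + 2) * (K * K) = L * (K * K) + 2 * (K * K) := by ring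
    set T := 140000 * ((L + 1) * 4 ^ L) with hT
    set T₁ := 30000 * h ^ 2 + T + 100 with hT₁
    have hchild : ∀ e f s, e < 2 → f < 2 → SolveStatic m K Y s → s.nv 14 = o →
        NodeOK m k K σ X s o (2 * h) b t → Good (s.rv 0) (s.rv 1) (s.rv 2) (s.rv 3) →
        Runs pr B (childNode e f) s T₁
          (SolvePost m k K σ X Y Good s o h (b + e * h) (t + f * h)) := by
      intro e f s he hf hS h14 hN hg
      refine childNode_runs hpw hP he hf hS hK h14 hp1 hN hal htm (by omega) htB hg ?_
      intro nb nt s₁ hS₁ h14₁ hN₁ hal₁ htm₁ hnt hg₁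
      exact ih hS₁ h14₁ hN₁ hal₁ htm₁ (by omega) (by omega) hg₁
    refine (Runs.call (T := 10 + (T₁ + (T₁ + (T₁ + T₁)))) hpr ?_).mono ?_ fun _ h => h
    · refine (Runs.cond (T := (T₁ + (T₁ + (T₁ + T₁)))) ?_ ?_).mono (by simp [BExp.size]) fun _ h => h
      · intro hb
        simp [h14, hN.len] at hb
        omega
      · intro _
        refine Runs.seq' (hchild 0 0 s (by decide) (by decide) hS h14 hN hg) ?_ le_rfl
        intro s₁ h1
        have hN₁ := hN.congr hK h1.low
        refine Runs.seq' (hchild 0 1 s₁ (by decide) (by decide) h1.static h1.base hN₁ h1.good) ?_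
          le_rfl
        intro s₂ h2
        have hN₂ := hN₁.congr hK h2.low
        refine Runs.seq' (hchild 1 0 s₂ (by decide) (by decide) h2.static h2.base hN₂ h2.good) ?_
          le_rfl
        intro s₃ h3
        have hN₃ := hN₂.congr hK h3.low
        refine (hchild 1 1 s₃ (by decide) (by decide) h3.static h3.base hN₃ h3.good).mono
          le_rfl ?_
        intro s₄ h4
        refine ⟨h4.good, h4.le.trans (h3.le.trans (h2.le.trans h1.le)),
          h1.low.trans (h2.low.trans (h3.low.trans h4.low)), h4.base, h4.static, ?_⟩
        -- The best half-perimeter never increases, so the bound obtained by each child holds for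
        -- the final value too.
        have c1 := h1.covers.mono (h4.le.trans (h3.le.trans h2.le))
        have c2 := h2.covers.mono (h4.le.trans h3.le)
        have c3 := h3.covers.mono h4.le
        have c4 := h4.covers
        rw [hp]
        intro i j p q hi hi' hj hj'
        by_cases hib : i < b + h
        · by_cases hjt : j < t + h
          · exact c1 i j p q (by omega) (by omega) (by omega) (by omega)
          · exact c2 i j p q (by omega) (by omega) (by omega) (by omega)
        · by_cases hjt : j < t + h
          · exact c3 i j p q (by omega) (by omega) (by omega) (by omega)
          · exact c4 i j p q (by omega) (by omega) (by omega) (by omega)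
    -- Four times the children's budget leaves `140000 * 4 * 4 ^ L` steps for entering the children.
    · have e1 : (L + 1 + 1) * 4 ^ (L + 1) = 4 * ((L + 1) * 4 ^ L) + 4 * 4 ^ L := by ring
      rw [e1]
      omega


end

end RealRAM

/-! ### Rectangles, ranks and the translation to slab problems. -/

/-- Point `i` of the point set with coordinate functions `c 0` and `c 1` lies in a rectangle. -/
def InRect (c : ℕ → ℕ → ℝ) (x₁ x₂ y₁ y₂ : ℝ) (i : ℕ) : Prop :=
  (x₁ ≤ c 0 i ∧ c 0 i ≤ x₂) ∧ y₁ ≤ c 1 i ∧ c 1 i ≤ y₂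

noncomputable instance (c : ℕ → ℕ → ℝ) (x₁ x₂ y₁ y₂ : ℝ) : DecidablePred (InRect c x₁ x₂ y₁ y₂) :=
  Classical.decPred _

/-- The number of points of `S` in a rectangle. -/
noncomputable def rectCount (c : ℕ → ℕ → ℝ) (S : Finset ℕ) (x₁ x₂ y₁ y₂ : ℝ) : ℕ :=
  (S.filter (InRect c x₁ x₂ y₁ y₂)).card

theorem rectCount_mono {c : ℕ → ℕ → ℝ} {S S' : Finset ℕ} (h : S ⊆ S') (x₁ x₂ y₁ y₂ : ℝ) :
    rectCount c S x₁ x₂ y₁ y₂ ≤ rectCount c S' x₁ x₂ y₁ y₂ :=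
  Finset.card_le_card (Finset.filter_subset_filter _ h)

/-- A rectangle that contains at least `k` of the first `n` points. -/
structure IsGood (c : ℕ → ℕ → ℝ) (n k : ℕ) (x₁ x₂ y₁ y₂ : ℝ) : Prop where
  hx : x₁ ≤ x₂
  hy : y₁ ≤ y₂
  card : k ≤ rectCount c (Finset.range n) x₁ x₂ y₁ y₂

/-- `v` is a lower bound for the half-perimeters of rectangles with at least `k` points of `S`. -/
def IsLowerBound (c : ℕ → ℕ → ℝ) (k : ℕ) (S : Finset ℕ) (v : ℝ) : Prop :=
  ∀ x₁ x₂ y₁ y₂, k ≤ rectCount c S x₁ x₂ y₁ y₂ → v ≤ x₂ - x₁ + (y₂ - y₁)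

/-- `L` enumerates `S` in the order of the ranks `r`. -/
structure IsEnum (L : ℕ → ℕ) (S : Finset ℕ) (r : ℕ → ℕ) : Prop where
  mem : ∀ i, i < S.card → L i ∈ S
  surj : ∀ x, x ∈ S → ∃ i, i < S.card ∧ L i = x
  lt : ∀ i j, i < j → j < S.card → r (L i) < r (L j)

theorem IsEnum.inj {L : ℕ → ℕ} {S : Finset ℕ} {r : ℕ → ℕ} (h : IsEnum L S r) {i j : ℕ}
    (hi : i < S.card) (hj : j < S.card) (hij : L i = L j) : i = j := by
  rcases lt_trichotomy i j with h1 | h1 | h1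
  · have := h.lt i j h1 hj
    rw [hij] at this
    omega
  · exact h1
  · have := h.lt j i h1 hi
    rw [hij] at this
    omega

/-- The ranks `r` are compatible with the coordinates `key`. -/
def IsRanking (key : ℕ → ℝ) (n : ℕ) (r : ℕ → ℕ) : Prop :=
  ∀ x y, x < n → y < n → r x ≤ r y → key x ≤ key y

theorem IsEnum.key_mono {L : ℕ → ℕ} {S : Finset ℕ} {r : ℕ → ℕ} (h : IsEnum L S r) {key : ℕ → ℝ}
    {n : ℕ} (hr : IsRanking key n r) (hS : S ⊆ Finset.range n) {i j : ℕ} (hij : i ≤ j)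
    (hj : j < S.card) : key (L i) ≤ key (L j) := by
  refine hr _ _ (by simpa using hS (h.mem i (by omega))) (by simpa using hS (h.mem j hj)) ?_
  rcases hij.eq_or_lt with rfl | h1
  · exact le_rfl
  · exact (h.lt i j h1 hj).le

theorem Nat.count_add_card_Ico (V : ℕ → Prop) [DecidablePred V] {p q : ℕ} (h : p ≤ q) :
    Nat.count V q = Nat.count V p + ((Finset.Ico p q).filter V).card := by
  rw [Nat.count_eq_card_filter_range, Nat.count_eq_card_filter_range,
    ← Finset.card_union_of_disjoint, ← Finset.filter_union]
  · congr 2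
    ext x
    simp
    omega
  · rw [Finset.disjoint_left]
    intro x hx hx'
    simp at hx hx'
    omega

section

open RealRAM

variable {c : ℕ → ℕ → ℝ} {n k : ℕ} {S : Finset ℕ} {xl yl σ r₀ r₁ : ℕ → ℕ} (h0 : IsEnum xl S r₀)
  (hk : 1 ≤ k) (hσ : ∀ i, i < S.card → σ i < S.card ∧ yl (σ i) = xl i)
include h0 hk hσ

/-- Shrink a rectangle to the bounding box of the points of `S` in it. The box is given by the
extreme positions `p, q` in the `x`-order and the extreme ranks `i, j` in the `y`-order, which is a
case of `Covers` because the root blocks contain all ranks. -/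
theorem isLowerBound_of_covers {h : ℕ} {v : ℝ} (hh : S.card ≤ h)
    (H : Covers S.card k σ (fun i => c 0 (xl i)) (fun j => c 1 (yl j)) h 0 0 v) :
    IsLowerBound c k S v := by
  intro x₁ x₂ y₁ y₂ hc
  set F := (Finset.range S.card).filter fun r => InRect c x₁ x₂ y₁ y₂ (xl r) with hF
  have hmem : ∀ r, r ∈ F ↔ r < S.card ∧ InRect c x₁ x₂ y₁ y₂ (xl r) := fun r => by simp [hF]
  have hFk : k ≤ F.card := by
    refine hc.trans ?_
    refine (Finset.card_le_card ?_).trans (Finset.card_image_le (s := F) (f := xl))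
    intro x hx
    simp only [Finset.mem_filter] at hx
    obtain ⟨i, hi, rfl⟩ := h0.surj x hx.1
    exact Finset.mem_image_of_mem _ ((hmem i).2 ⟨hi, hx.2⟩)
  have hne : F.Nonempty := Finset.card_pos.1 (by omega)
  have hne' : (F.image σ).Nonempty := hne.image _
  have hp := (hmem _).1 (F.min'_mem hne)
  have hq := (hmem _).1 (F.max'_mem hne)
  obtain ⟨a, ha, ha'⟩ := Finset.mem_image.1 ((F.image σ).min'_mem hne')
  obtain ⟨b, hb, hb'⟩ := Finset.mem_image.1 ((F.image σ).max'_mem hne')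
  have hpq : F.min' hne ≤ F.max' hne := Finset.min'_le _ _ (F.max'_mem hne)
  have hij : (F.image σ).min' hne' ≤ (F.image σ).max' hne' :=
    Finset.min'_le _ _ ((F.image σ).max'_mem hne')
  have hi : ∀ r, r ∈ F → (F.image σ).min' hne' ≤ σ r := fun r hr =>
    Finset.min'_le _ _ (Finset.mem_image_of_mem _ hr)
  have hj : ∀ r, r ∈ F → σ r ≤ (F.image σ).max' hne' := fun r hr =>
    Finset.le_max' _ _ (Finset.mem_image_of_mem _ hr)
  have hp' : ∀ r, r ∈ F → F.min' hne ≤ r := fun r hr => Finset.min'_le _ _ hr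
  have hq' : ∀ r, r ∈ F → r ≤ F.max' hne := fun r hr => Finset.le_max' _ _ hr
  generalize F.min' hne = p at *
  generalize F.max' hne = q at *
  generalize (F.image σ).min' hne' = i at *
  generalize (F.image σ).max' hne' = j at *
  rw [hmem] at ha hb
  have h2 := hσ a ha.1
  have h3 := hσ b hb.1
  have h4 := H i j p q (by omega) (by omega) (by omega) (by omega) hij (by omega) hpq hq.1 (by
    rw [Nat.count_add_card_Ico _ (show p ≤ q + 1 by omega)]
    have : F.card ≤ ((Finset.Ico p (q + 1)).filter (IsLive σ 1 i j)).card := by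
      refine Finset.card_le_card fun r hr => ?_
      have := hi r hr
      have := hj r hr
      have := hp' r hr
      have := hq' r hr
      simp [IsLive]
      omega
    omega)
  simp only at h4
  rw [← ha', ← hb', h2.2, h3.2] at h4
  have := hp.2.1.1
  have := hq.2.1.2
  have := ha.2.2.1
  have := hb.2.2.2
  linarith

variable (hS : S ⊆ Finset.range n) (h1 : IsEnum yl S r₁) (hr0 : IsRanking (c 0) n r₀)
  (hr1 : IsRanking (c 1) n r₁)
include hS h1 hr0 hr1

/-- Points between the extreme ranks lie between the extreme coordinates, since ranks respect
coordinates. Ties could only add points to the rectangle, and so could passing from `S` to all `n`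
points. -/
theorem slabProblem_of_isEnum :
    SlabProblem S.card k σ (fun i => c 0 (xl i)) (fun j => c 1 (yl j)) (IsGood c n k) where
  pos := hk
  inj r r' hr hr' h := h0.inj hr hr' (by rw [← (hσ r hr).2, ← (hσ r' hr').2, h])
  lt r hr := (hσ r hr).1
  mono r r' h h' := h0.key_mono hr0 hS h h'
  good i j p q hij hj hpq hq hc := by
    refine ⟨h0.key_mono hr0 hS hpq hq, h1.key_mono hr1 hS hij hj,
      le_trans ?_ (rectCount_mono hS _ _ _ _)⟩
    rw [Nat.count_add_card_Ico _ (show p ≤ q + 1 by omega)] at hc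
    refine (show k ≤ _ by omega : k ≤ _).trans
      (Finset.card_le_card_of_injOn xl (s := (Finset.Ico p (q + 1)).filter (IsLive σ 1 i j)) ?_ ?_)
    · intro r hr
      simp [IsLive] at hr
      have hr' := hσ r (by omega)
      simp only [Finset.coe_filter, Set.mem_ofPred_eq, InRect]
      refine ⟨h0.mem r (by omega), ⟨h0.key_mono hr0 hS (by omega) (by omega),
        h0.key_mono hr0 hS (by omega) (by omega)⟩, ?_⟩
      rw [← hr'.2]
      exact ⟨h1.key_mono hr1 hS (by omega) (by omega), h1.key_mono hr1 hS (by omega) (by omega)⟩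
    · intro r hr r' hr' h
      simp at hr hr'
      exact h0.inj (by omega) (by omega) h

end

/-! ### The root table and the search on a final set. -/

namespace RealRAM

/-- Enter the interval from the `nvar 21`-th to the `nvar 22`-th point into the root table. -/
def fillCell : Cmd :=
  .cond (.nle (nvar 21 + nvar 1) (nvar 22 + 1))
    (.nset 23 (nvar 14 + (nvar 22 + 1 - nvar 21 - nvar 1) * nvar 12 +
        (2 * nvar 21 + 2 * nvar 22 + 2)) ;;
      .nput 15 (nvar 23) (2 * nvar 21 + 2) ;;
      .rput 2 (nvar 23) (.get 0 (.get 0 (nvar 2 + nvar 21))) ;;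
      .rput 3 (nvar 23) (.get 0 (.get 0 (nvar 2 + nvar 22))))
    .skip

/-- Fill the root table of the slab recursion. -/
def fillTable : Cmd := forTo 21 (nvar 3) (forTo 22 (nvar 3) fillCell)

/-- The table at `o` contains the intervals `p, …, q` with `D p q`. -/
structure Filled (m k K : ℕ) (X : ℕ → ℝ) (D : ℕ → ℕ → Prop) (o : ℕ) (s : State) : Prop where
  sound : ∀ T u, T ≤ m → u ≤ 4 * m → s.na 15 (o + T * K + u) ≠ 0 →
    ∃ p q, D p q ∧ p + k ≤ q + 1 ∧ q < m ∧ T = q + 1 - p - k ∧ u = 2 * p + 2 * q + 2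
  complete : ∀ p q, D p q → p + k ≤ q + 1 → q < m →
    s.na 15 (o + (q + 1 - p - k) * K + (2 * p + 2 * q + 2)) = 2 * p + 2 ∧
    s.ra 2 (o + (q + 1 - p - k) * K + (2 * p + 2 * q + 2)) = X p ∧
    s.ra 3 (o + (q + 1 - p - k) * K + (2 * p + 2 * q + 2)) = X q

theorem Filled.congr {m k K o : ℕ} {X : ℕ → ℝ} {D D' : ℕ → ℕ → Prop} {s s' : State}
    (h : Filled m k K X D o s) (hD : ∀ p q, q < m → (D p q ↔ D' p q)) (hn : s'.na 15 = s.na 15)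
    (h2 : s'.ra 2 = s.ra 2) (h3 : s'.ra 3 = s.ra 3) : Filled m k K X D' o s' where
  sound T u hT hu h0 := by
    rw [hn] at h0
    obtain ⟨p, q, h1, h2, h3, h4⟩ := h.sound T u hT hu h0
    exact ⟨p, q, (hD p q h3).1 h1, h2, h3, h4⟩
  complete p q h1 h4 h5 := by
    rw [hn, h2, h3]
    exact h.complete p q ((hD p q h5).2 h1) h4 h5

section

variable {pr : List Cmd} {pw : ℕ → List ℕ} (hpw : WritesOK pr pw)

/-- The surplus fixes `q - p` and the position sum fixes `p + q`, so different pairs never share a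
cell and no comparison of lengths is needed. -/
theorem fillCell_runs {B m k K o p q : ℕ} {X : ℕ → ℝ} {D : ℕ → ℕ → Prop} {s : State} (hk : 1 ≤ k)
    (hK : 4 * m < K) (hB : o + K * K ≤ B) (h1 : s.nv 1 = k) (h14 : s.nv 14 = o) (h12 : s.nv 12 = K)
    (h21 : s.nv 21 = p) (h22 : s.nv 22 = q) (hp : p < m) (hq : q < m)
    (hXp : s.ra 0 (s.na 0 (s.nv 2 + p)) = X p) (hXq : s.ra 0 (s.na 0 (s.nv 2 + q)) = X q)
    (h : Filled m k K X D o s) :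
    Runs pr B fillCell s 60 (Filled m k K X (fun p' q' => D p' q' ∨ p' = p ∧ q' = q) o) := by
  have hcell : ∀ p' q', p' + k ≤ q' + 1 → q' < m →
      (q' + 1 - p' - k) * K + (2 * p' + 2 * q' + 2) < K * K := fun p' q' h1 h2 =>
    index_lt (by omega) (by omega)
  refine Runs.straight ?_ (Nat.le_of_ble_eq_true rfl)
  simp only [fillCell, wp, BExp.eval_nle, NExp.eval_add', NExp.eval_var', NExp.eval_ofNat, h21, h22,
    h1, NExp.eval_sub', NExp.eval_mul', h12, h14, State.nv_setN, State.na_setN, State.ra_setN,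
    State.nv_putN, State.ra_putN, RExp.eval_get', NExp.eval_get', State.nv_putR, State.na_putR,
    State.ra_putR, State.na_putN]
  constructor
  · intro hpq
    have := hcell p q hpq hq
    refine ⟨by omega, by simp; omega, ?_⟩
    simp
    constructor
    · intro T u hT hu h0
      by_cases hc : o + T * K + u = o + (q + 1 - p - k) * K + (2 * p + 2 * q + 2)
      · have := (index_inj (K := K) (T := T) (u := u) (T' := q + 1 - p - k)
          (u' := 2 * p + 2 * q + 2) (by omega) (by omega)).1 (by omega)
        exact ⟨p, q, Or.inr ⟨rfl, rfl⟩, hpq, hq, this⟩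
      · simp [hc] at h0
        obtain ⟨p', q', a1, a2⟩ := h.sound T u hT hu h0
        exact ⟨p', q', Or.inl a1, a2⟩
    · intro p' q' hD hpq' hq'
      by_cases hc : o + (q' + 1 - p' - k) * K + (2 * p' + 2 * q' + 2) =
          o + (q + 1 - p - k) * K + (2 * p + 2 * q + 2)
      · have := (index_inj (K := K) (T := q' + 1 - p' - k) (u := 2 * p' + 2 * q' + 2)
          (T' := q + 1 - p - k) (u' := 2 * p + 2 * q + 2) (by omega) (by omega)).1 (by omega)
        obtain rfl : p' = p := by omega
        obtain rfl : q' = q := by omega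
        simp [hXp, hXq]
      · simp [hc]
        refine h.complete p' q' (hD.resolve_right ?_) hpq' hq'
        rintro ⟨rfl, rfl⟩
        exact hc rfl
  · intro hpq
    constructor
    · intro T u hT hu h0
      obtain ⟨p', q', a1, a2⟩ := h.sound T u hT hu h0
      exact ⟨p', q', Or.inl a1, a2⟩
    · intro p' q' hD hpq' hq'
      refine h.complete p' q' (hD.resolve_right ?_) hpq' hq'
      rintro ⟨rfl, rfl⟩
      exact hpq hpq'

include hpw

theorem fillTable_runs {B m k K o : ℕ} {X : ℕ → ℝ} {s : State} (hk : 1 ≤ k)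
    (hK : 4 * m < K) (hB : o + K * K ≤ B) (h1 : s.nv 1 = k) (h14 : s.nv 14 = o) (h12 : s.nv 12 = K)
    (h3 : s.nv 3 = m) (hX : ∀ p, p < m → s.ra 0 (s.na 0 (s.nv 2 + p)) = X p)
    (h0 : ∀ T u, T ≤ m → u ≤ 4 * m → s.na 15 (o + T * K + u) = 0) :
    Runs pr B fillTable s (m * (m * 69 + 16) + 7) (Filled m k K X (fun p q => p < m ∧ q < m) o) := by
  have hKK : K ≤ K * K := Nat.le_mul_self K
  refine (forTo_runs hpw (N := m) (T := m * 69 + 7) (fun p => Filled m k K X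
    (fun p' q' => p' < p ∧ q' < m) o) (by simp [Cmd.writes, forTo, fillCell]) (by omega) ?_ ?_ ?_
    (by simp)).mono le_rfl fun s' h => h.1
  · intro s' hf
    have hf : Frame [84, 88, 92, 62, 11, 15, 88, 84] s s' := hf
    simp [hf.nv 3 (by decide), h3]
  · exact ⟨fun T u hT hu h => absurd (h0 T u hT hu) h, fun p q h => by omega⟩
  · intro p s' hp hf hp' hI
    have hf : Frame [84, 88, 92, 62, 11, 15, 88, 84] s s' := hf
    refine (forTo_runs hpw (N := m) (T := 60) (fun q => Filled m k K X
      (fun p' q' => (p' < p ∧ q' < m) ∨ p' = p ∧ q' < q) o) (by simp [Cmd.writes, fillCell])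
      (by omega) ?_ ?_ ?_ (T₀ := m * 69 + 7) (by simp)).mono le_rfl ?_
    · intro s'' hf'
      have hf' : Frame [88, 92, 62, 11, 15, 88] s' s'' := hf'
      simp [hf'.nv 3 (by decide), hf.nv 3 (by decide), h3]
    · exact hI.congr (fun p q hq => by omega) rfl rfl rfl
    · intro q s'' hq hf' hq' hI'
      have hf' : Frame [88, 92, 62, 11, 15, 88] s' s'' := hf'
      have e0 : s''.na 0 = s.na 0 := by rw [hf'.na 0 (by decide), hf.na 0 (by decide)]
      have f0 : s''.ra 0 = s.ra 0 := by rw [hf'.ra 0 (by decide), hf.ra 0 (by decide)]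
      have e2 : s''.nv 2 = s.nv 2 := by rw [hf'.nv 2 (by decide), hf.nv 2 (by decide)]
      refine (fillCell_runs hk hK hB (by rw [hf'.nv 1 (by decide), hf.nv 1 (by decide), h1])
        (by rw [hf'.nv 14 (by decide), hf.nv 14 (by decide), h14])
        (by rw [hf'.nv 12 (by decide), hf.nv 12 (by decide), h12])
        (by rw [hf'.nv 21 (by decide), hp']) hq' hp hq (by rw [e0, f0, e2, hX p hp])
        (by rw [e0, f0, e2, hX q hq]) hI').mono le_rfl ?_
      intro s₃ h₃
      exact h₃.congr (fun p q hq => by omega) rfl rfl rfl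
    · rintro s'' ⟨h₃, -, -⟩
      exact h₃.congr (fun p q hq => by omega) rfl rfl rfl

end


/-- At the root all points are active, so the `p`-th one has position `2 p + 1`. Stored with offset
one this is `2 p + 2`, and the position sum is `2 p + 2 q + 2`. -/
theorem isTable_of_filled {m k K o : ℕ} {X : ℕ → ℝ} {V A : ℕ → Prop} [DecidablePred V]
    [DecidablePred A] {s : State} (hk : 1 ≤ k) (hV : ∀ r, r < m → V r) (hA : ∀ r, r < m → A r)
    (h : Filled m k K X (fun p q => p < m ∧ q < m) o s) :
    IsTable m k V A X (fun T u => s.na 15 (o + T * K + u)) (fun T u => s.ra 2 (o + T * K + u))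
      (fun T u => s.ra 3 (o + T * K + u)) := by
  have hcV : ∀ p, p ≤ m → Nat.count V p = p := fun p hp =>
    Nat.count_iff_forall.2 fun r hr => hV r (by omega)
  have hcA : ∀ p, p ≤ m → Nat.count A p = p := fun p hp =>
    Nat.count_iff_forall.2 fun r hr => hA r (by omega)
  have hpos : ∀ p, p < m → activePos A p = 2 * p + 1 := fun p hp => by
    rw [activePos, hcA p hp.le, if_pos (hA p hp)]
  have hm := hcA m le_rfl
  constructor
  · intro T u hT hu h0
    rw [hm] at hT hu
    obtain ⟨p, q, hD, hpq, hq, rfl, rfl⟩ := h.sound T u hT hu h0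
    obtain ⟨h1, h2, h3⟩ := h.complete p q hD hpq hq
    simp only [h1, h2, h3]
    refine ⟨p, q, by omega, hq, hV p hD.1, hV q hq, ?_, ?_, ?_, rfl, rfl⟩
    · rw [hcV _ (by omega), hcV _ (by omega)]
      omega
    · rw [hpos p hD.1]
    · rw [hpos p hD.1, hpos q hq]
      omega
  · rintro T u P xl xr hT ⟨p, q, hpq, hq, -, -, hc, -, rfl, rfl, rfl⟩
    rw [hcV _ (by omega), hcV _ (by omega)] at hc
    obtain ⟨h1, h2, h3⟩ := h.complete p q ⟨by omega, hq⟩ (by omega) hq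
    rw [hpos p (by omega), hpos q hq]
    rw [show q + 1 - p - k = T by omega,
      show 2 * p + 2 * q + 2 = 2 * p + 1 + (2 * q + 1) by ring] at h1 h2 h3
    simp only [h1, h2, h3]
    exact ⟨by omega, le_rfl⟩

/-- Sizes of the slab recursion. -/
def leafSizes : Cmd :=
  (.nset 3 (.get 2 (nvar 2)) ;; .nset 12 (4 * nvar 3 + 1) ;; .nset 13 (nvar 12 * nvar 12) ;;
    .nset 14 0 ;; .nset 20 (nvar 3) ;; .nset 15 1) ;;
  .loop (.not (.nle (nvar 3) (nvar 15))) (.nset 15 (2 * nvar 15))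

/-- Ranks of the points of the current node in the second coordinate. -/
def leafRanks : Cmd :=
  forTo 21 (nvar 3) (.nput 18 (.get 0 (nvar 2 + nvar 0 + nvar 21)) (nvar 21) ;;
    .rput 4 (nvar 21) (.get 1 (.get 0 (nvar 2 + nvar 0 + nvar 21))))

/-- The root of the slab recursion. -/
def leafRoot : Cmd :=
  .nset 14 (nvar 13) ;;
  forTo 21 (nvar 3) (.nput 14 (nvar 14 + nvar 21) (.get 18 (.get 0 (nvar 2 + nvar 21)))) ;;
  .nput 10 (nvar 14) (nvar 15) ;; .nput 11 (nvar 14) 0 ;; .nput 12 (nvar 14) 0 ;;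
  .nput 13 (nvar 14) (nvar 3)

/-- Treat all points of the current node by the slab recursion. -/
def solveLeaf : Cmd := leafSizes ;; leafRanks ;; clearTable ;; leafRoot ;; fillTable ;; .call 0

/-- The result of a search for the best rectangle with `k` points of `S`. -/
structure BestPost (c : ℕ → ℕ → ℝ) (n k : ℕ) (S : Finset ℕ) (s s' : State) : Prop where
  good : IsGood c n k (s'.rv 0) (s'.rv 1) (s'.rv 2) (s'.rv 3)
  le : halfPerim s' ≤ halfPerim s
  bound : IsLowerBound c k S (halfPerim s')

section

variable {pr : List Cmd} {pw : ℕ → List ℕ} (hpw : WritesOK pr pw)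
include hpw

theorem leafSizes_runs {B m : ℕ} {s : State} (hm : s.na 2 (s.nv 2) = m) (hm1 : 1 ≤ m)
    (hB : (4 * m + 1) * (4 * m + 1) ≤ B) :
    Runs pr B leafSizes s (9 * m + 40) fun s' => s'.nv 3 = m ∧ s'.nv 12 = 4 * m + 1 ∧
      s'.nv 13 = (4 * m + 1) * (4 * m + 1) ∧ s'.nv 14 = 0 ∧ s'.nv 20 = m ∧
      ∃ L, s'.nv 15 = 2 ^ L ∧ m ≤ 2 ^ L ∧ 2 ^ L ≤ 2 * m := by
  have hKK : 4 * m + 1 ≤ (4 * m + 1) * (4 * m + 1) := Nat.le_mul_self _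
  refine Runs.seq' (T := 30) (Runs.straight (Q := fun s' => s'.nv 3 = m ∧ s'.nv 12 = 4 * m + 1 ∧
      s'.nv 13 = (4 * m + 1) * (4 * m + 1) ∧ s'.nv 14 = 0 ∧ s'.nv 20 = m ∧ s'.nv 15 = 1) (by
    simp [wp, hm]
    omega) (Nat.le_of_ble_eq_true rfl)) ?_ (T' := m * 9 + 10) (by omega)
  rintro s₁ ⟨h1, h2, h3, h4, h5, h6⟩
  -- The block length is doubled from `1` until it reaches `m`, and so overshoots by less than a
  -- factor of two.
  refine (Runs.loop_measure hpw (T := 4) (fun s' => s'.nv 15 ≤ 2 * m ∧ ∃ L, s'.nv 15 = 2 ^ L)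
    (fun s' => m - s'.nv 15) ?_ ⟨by omega, 0, by simp [h6]⟩).mono ?_ ?_
  · rintro s' hf ⟨h7, L, h8⟩ hb
    have hf : Frame [60] s₁ s' := hf
    simp [hf.nv 3 (by decide), h1] at hb
    refine Runs.straight ?_ (Nat.le_of_ble_eq_true rfl)
    have : 1 ≤ 2 ^ L := Nat.one_le_two_pow
    rw [h8] at hb
    simp only [wp, NExp.eval_mul', NExp.eval_ofNat, NExp.eval_var', h8, State.nv_setN, if_true]
    exact ⟨by omega, ⟨by omega, L + 1, by ring⟩, by omega⟩
  · have : (BExp.nle (nvar 3) (nvar 15)).not.size = 4 := rfl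
    rw [this, h6]
    have : (m - 1) * (4 + 4 + 1) ≤ m * 9 := Nat.mul_le_mul (by omega) le_rfl
    omega
  · rintro s' ⟨⟨⟨h7, L, h8⟩, hb⟩, hf⟩
    have hf : Frame [60] s₁ s' := hf
    simp [hf.nv 3 (by decide), h1] at hb
    exact ⟨by rw [hf.nv 3 (by decide), h1], by rw [hf.nv 12 (by decide), h2],
      by rw [hf.nv 13 (by decide), h3], by rw [hf.nv 14 (by decide), h4],
      by rw [hf.nv 20 (by decide), h5], L, h8, by omega, by omega⟩

theorem leafRanks_runs {B m : ℕ} {yl : ℕ → ℕ} {s : State} (h3 : s.nv 3 = m)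
    (hl : ∀ j, j < m → s.na 0 (s.nv 2 + s.nv 0 + j) = yl j)
    (hinj : ∀ i j, i < m → j < m → yl i = yl j → i = j) (hB : m ≤ B) :
    Runs pr B leafRanks s (m * 49 + 7) fun s' =>
      (∀ j, j < m → s'.na 18 (yl j) = j) ∧ ∀ j, j < m → s'.ra 4 j = s.ra 1 (yl j) := by
  refine (forTo_runs hpw (N := m) (T := 40) (fun j s' => (∀ i, i < j → s'.na 18 (yl i) = i) ∧
    ∀ i, i < j → s'.ra 4 i = s.ra 1 (yl i)) (by simp [Cmd.writes]) hB ?_ (by simp) ?_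
    (by simp)).mono le_rfl fun s' h => h.1
  · intro s' hf
    have hf : Frame [84, 74, 19, 84] s s' := hf
    simp [hf.nv 3 (by decide), h3]
  · rintro j s' hj hf hj' ⟨h1, h2⟩
    have hf : Frame [84, 74, 19, 84] s s' := hf
    refine Runs.straight ?_ (Nat.le_of_ble_eq_true rfl)
    simp [wp, hj', hf.na 0 (by decide), hf.nv 2 (by decide), hf.nv 0 (by decide), hl j hj,
      hf.ra 1 (by decide)]
    refine ⟨by omega, fun i hi => ?_, fun i hi => ?_⟩
    · rcases hi.lt_or_eq with h | rfl
      · rw [if_neg fun he => by have := hinj i j (by omega) hj he; omega, h1 i h]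
      · rw [if_pos rfl]
    · rcases hi.lt_or_eq with h | rfl
      · rw [if_neg (by omega), h2 i h]
      · rw [if_pos rfl]

theorem leafRoot_runs {B m S h : ℕ} {σ : ℕ → ℕ} {s : State} (h3 : s.nv 3 = m) (h13 : s.nv 13 = S)
    (h15 : s.nv 15 = h) (hl : ∀ j, j < m → s.na 18 (s.na 0 (s.nv 2 + j)) = σ j)
    (hσ : ∀ j, j < m → σ j < m) (hB : m ≤ B) (hB' : S ≤ B) (hB'' : h ≤ B) :
    Runs pr B leafRoot s (m * 39 + 40) fun s' =>
      s'.nv 14 = S ∧ (∀ j, j < m → s'.na 14 (S + j) = σ j) ∧ s'.na 10 S = h ∧ s'.na 11 S = 0 ∧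
        s'.na 12 S = 0 ∧ s'.na 13 S = m := by
  refine Runs.seq' (T := 2) (Runs.straight (Q := fun s' => s' = s.setN 14 S) (by
    simp [wp, h13]
    omega) (Nat.le_of_ble_eq_true rfl)) ?_ (T' := m * 39 + 38) (by omega)
  rintro s₁ rfl
  refine Runs.seq' (forTo_runs hpw (N := m) (T := 30) (fun j s' => ∀ i, i < j →
    s'.na 14 (S + i) = σ i) (by simp [Cmd.writes]) hB ?_ (by simp) ?_ (T₀ := m * 39 + 7) (by simp))
    ?_ (T' := 31) (by omega)
  · intro s' hf
    have hf : Frame [84, 58, 84] (s.setN 14 S) s' := hf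
    simp [hf.nv 3 (by decide), h3]
  · rintro j s' hj hf hj' h1
    have hf : Frame [84, 58, 84] (s.setN 14 S) s' := hf
    refine Runs.straight ?_ (Nat.le_of_ble_eq_true rfl)
    have := hσ j hj
    simp [wp, hj', hf.na 18 (by decide), hf.na 0 (by decide), hf.nv 2 (by decide),
      hf.nv 14 (by decide), hl j hj]
    refine ⟨by omega, fun i hi => ?_⟩
    rcases hi.lt_or_eq with h | rfl
    · rw [if_neg (by omega), h1 i h]
    · rw [if_pos rfl]
  · rintro s' ⟨h1, -, hf⟩
    have hf : Frame [84, 58, 84] (s.setN 14 S) s' := hf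
    refine Runs.straight ?_ (Nat.le_of_ble_eq_true rfl)
    simp [wp, hf.nv 14 (by decide), hf.nv 15 (by decide), hf.nv 3 (by decide), h15, h3]
    exact ⟨hB'', hB, h1⟩

theorem solveLeaf_runs {B n k o : ℕ} {c : ℕ → ℕ → ℝ} {S : Finset ℕ} {r₀ r₁ : ℕ → ℕ} {s : State}
    (hpr : pr[0]? = some solveNode) (hk : 1 ≤ k) (hS1 : 1 ≤ S.card)
    (hS : S ⊆ Finset.range n) (h0 : s.nv 0 = n) (h1 : s.nv 1 = k) (h2 : s.nv 2 = o)
    (hc0 : s.ra 0 = c 0) (hc1 : s.ra 1 = c 1) (hr0 : IsRanking (c 0) n r₀)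
    (hr1 : IsRanking (c 1) n r₁) (hcard : s.na 2 o = S.card)
    (hx : IsEnum (fun i => s.na 0 (o + i)) S r₀) (hy : IsEnum (fun i => s.na 0 (o + n + i)) S r₁)
    (hB : (S.card + 4) * ((4 * S.card + 1) * (4 * S.card + 1)) ≤ B)
    (hg : IsGood c n k (s.rv 0) (s.rv 1) (s.rv 2) (s.rv 3)) :
    Runs pr B solveLeaf s (1000000 * (S.card ^ 2 * (Nat.log 2 (2 * S.card) + 1)))
      (BestPost c n k S s) := by
  -- `σ i` is the position in the `y`-order of the `i`-th point in the `x`-order.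
  choose! σ hσ using fun i (hi : i < S.card) => hy.surj _ (hx.mem i hi)
  set m := S.card with hm
  set K := 4 * m + 1 with hK
  have hKK : K ≤ K * K := Nat.le_mul_self K
  have hB4 : (m + 4) * (K * K) = m * (K * K) + 4 * (K * K) := by ring
  have hB5 : K * K ≤ m * (K * K) := Nat.le_mul_of_pos_left _ hS1
  have hP := slabProblem_of_isEnum hx hk hσ hS hy hr0 hr1
  rw [← hm] at hP
  refine Runs.mono (T := (9 * m + 40) + ((m * 49 + 7) + (((m + 1) * ((4 * m + 1) * 24 + 22) + 9) +
    ((m * 39 + 40) + ((m * (m * 69 + 16) + 7) +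
      140000 * ((Nat.log 2 (2 * m) + 1) * (4 * m ^ 2))))))) ?_ ?_ fun _ h => h
  swap
  · have e1 : m ≤ m ^ 2 := by rw [pow_two]; exact Nat.le_mul_self m
    have e2 : m ^ 2 ≤ m ^ 2 * (Nat.log 2 (2 * m) + 1) := Nat.le_mul_of_pos_right _ (by omega)
    have e3 : (m + 1) * ((4 * m + 1) * 24 + 22) = 96 * m ^ 2 + 142 * m + 46 := by ring
    have e4 : m * (m * 69 + 16) = 69 * m ^ 2 + 16 * m := by ring
    have e5 : (Nat.log 2 (2 * m) + 1) * (4 * m ^ 2) = 4 * (m ^ 2 * (Nat.log 2 (2 * m) + 1)) := by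
      ring
    omega
  refine Runs.seq' ((leafSizes_runs hpw (m := m) (by rw [h2, hcard]) hS1
    (show K * K ≤ B by omega)).frame hpw) ?_ le_rfl
  rintro s₁ ⟨⟨a3, a12, a13, a14, a20, L, a15, hL, hL'⟩, hf₁⟩
  have hf₁ : Frame [12, 48, 52, 56, 80, 60, 60] s s₁ := hf₁
  refine Runs.seq' ((leafRanks_runs hpw (m := m) (yl := fun i => s.na 0 (o + n + i)) a3
    (fun j hj => by
      rw [hf₁.na 0 (by decide), hf₁.nv 0 (by decide), hf₁.nv 2 (by decide), h0, h2])
    (fun i j hi hj h => hy.inj hi hj h) (by omega)).frame hpw) ?_ le_rfl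
  rintro s₂ ⟨⟨b18, b4⟩, hf₂⟩
  have hf₂ : Frame [84, 74, 19, 84] s₁ s₂ := hf₂
  -- Clearing the table of the "child" of the unused level `0` prepares the root, which sits at
  -- address `K * K`.
  refine Runs.seq' ((clearTable_runs hpw (o := 0) (K := K) (G' := m)
    (by rw [hf₂.nv 14 (by decide), a14]) (by rw [hf₂.nv 12 (by decide), a12])
    (by rw [hf₂.nv 13 (by decide), a13]) (by rw [hf₂.nv 20 (by decide), a20])
    (by omega) (by omega)).frame hpw) ?_ le_rfl
  rintro s₃ ⟨⟨c15, -⟩, hf₃⟩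
  have hf₃ : Frame [88, 92, 62, 92, 88] s₂ s₃ := hf₃
  have n3 : s₃.nv 3 = m := by rw [hf₃.nv 3 (by decide), hf₂.nv 3 (by decide), a3]
  have n2 : s₃.nv 2 = o := by
    rw [hf₃.nv 2 (by decide), hf₂.nv 2 (by decide), hf₁.nv 2 (by decide), h2]
  have n0 : s₃.na 0 = s.na 0 := by
    rw [hf₃.na 0 (by decide), hf₂.na 0 (by decide), hf₁.na 0 (by decide)]
  refine Runs.seq' ((leafRoot_runs hpw (m := m) (S := K * K) (h := 2 ^ L) (σ := σ) n3
    (by rw [hf₃.nv 13 (by decide), hf₂.nv 13 (by decide), a13])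
    (by rw [hf₃.nv 15 (by decide), hf₂.nv 15 (by decide), a15])
    (fun j hj => by
      have h5 := hσ j hj
      rw [n0, n2, hf₃.na 18 (by decide), ← h5.2]
      exact b18 _ h5.1)
    (fun j hj => (hσ j hj).1) (by omega) (by omega) (by omega)).frame hpw) ?_ le_rfl
  rintro s₄ ⟨⟨d14, dr, d10, d11, d12, d13⟩, hf₄⟩
  have hf₄ : Frame [56, 84, 58, 84, 42, 46, 50, 54] s₃ s₄ := hf₄
  refine Runs.seq' ((fillTable_runs hpw (m := m) (k := k) (K := K) (o := K * K)
    (X := fun i => c 0 (s.na 0 (o + i))) hk (by omega) (by omega)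
    (by rw [hf₄.nv 1 (by decide), hf₃.nv 1 (by decide), hf₂.nv 1 (by decide), hf₁.nv 1 (by decide),
      h1]) d14 (by rw [hf₄.nv 12 (by decide), hf₃.nv 12 (by decide), hf₂.nv 12 (by decide), a12])
    (by rw [hf₄.nv 3 (by decide), n3])
    (fun p hp => by rw [hf₄.nv 2 (by decide), n2, hf₄.na 0 (by decide), n0, hf₄.ra 0 (by decide),
      hf₃.ra 0 (by decide), hf₂.ra 0 (by decide), hf₁.ra 0 (by decide), hc0])
    (fun T u hT hu => by
      rw [hf₄.na 15 (by decide)]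
      simpa using c15 T u hT hu)).frame hpw) ?_ le_rfl
  rintro s₅ ⟨hF, hf₅⟩
  have hf₅ : Frame [84, 88, 92, 62, 11, 15, 88, 84] s₄ s₅ := hf₅
  have er : ∀ i, s₅.rv i = s.rv i := fun i => by
    rw [hf₅.rv i (by simp; omega), hf₄.rv i (by simp; omega), hf₃.rv i (by simp; omega),
      hf₂.rv i (by simp; omega), hf₁.rv i (by simp; omega)]
  have hact : ∀ r, r < m → IsActive σ (2 ^ L) 0 0 r := fun r hr => by
    have := (hσ r hr).1
    simp [IsActive, IsLive]
    omega
  -- Only the word bound needs this: the recursion addresses `L + 2` windows, and `B` has room for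
  -- `m + 4`.
  have hLm : L ≤ m := by
    by_contra! h
    have h6 : m + 1 ≤ 2 ^ m := Nat.lt_two_pow_self
    have h7 : 2 ^ (m + 1) ≤ 2 ^ L := Nat.pow_le_pow_right (by decide) h
    rw [pow_succ] at h7
    omega
  have hBL : K * K + (L + 2) * (K * K) ≤ B := by
    have : (L + 2) * (K * K) ≤ (m + 2) * (K * K) := Nat.mul_le_mul_right _ (by omega)
    have h8 : (m + 2) * (K * K) = m * (K * K) + 2 * (K * K) := by ring
    omega
  refine (solveNode_runs hpw hP hpr (K := K) (by omega) (by omega) L (o := K * K) (b := 0) (t := 0)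
    (s := s₅) ⟨by rw [hf₅.nv 3 (by decide), hf₄.nv 3 (by decide), n3],
      by rw [hf₅.nv 12 (by decide), hf₄.nv 12 (by decide), hf₃.nv 12 (by decide),
        hf₂.nv 12 (by decide), a12],
      by rw [hf₅.nv 13 (by decide), hf₄.nv 13 (by decide), hf₃.nv 13 (by decide),
        hf₂.nv 13 (by decide), a13],
      fun j hj => by rw [hf₅.ra 4 (by decide), hf₄.ra 4 (by decide), hf₃.ra 4 (by decide), b4 j hj,
        hf₁.ra 1 (by decide), hc1]⟩
    (by rw [hf₅.nv 14 (by decide), d14]) ⟨?_, ?_, ?_, ?_, ?_, ?_⟩ (Or.inl rfl) (by omega) hBL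
    (by omega) (by simpa only [er] using hg)).mono ?_ ?_
  · rw [hf₅.na 10 (by decide), d10]
  · rw [hf₅.na 11 (by decide), d11]
  · rw [hf₅.na 12 (by decide), d12]
  · rw [hf₅.na 13 (by decide), d13, eq_comm]
    exact Nat.count_iff_forall.2 fun r hr => hact r hr
  · intro r hr _
    rw [hf₅.na 14 (by decide), show Nat.count (IsActive σ (2 ^ L) 0 0) r = r from
      Nat.count_iff_forall.2 fun r' hr' => hact r' (by omega), dr r hr]
  · exact isTable_of_filled hk (fun r hr => (hact r hr).1) hact hF
  · refine Nat.mul_le_mul_left _ (Nat.mul_le_mul ?_ ?_)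
    · have := Nat.le_log_of_pow_le (b := 2) (by decide) hL'
      omega
    · calc 4 ^ L = (2 ^ L) ^ 2 := by rw [← pow_mul, mul_comm, pow_mul]; rfl
        _ ≤ (2 * m) ^ 2 := Nat.pow_le_pow_left hL' 2
        _ = _ := by ring
  · intro s₆ h
    refine ⟨h.good, ?_, isLowerBound_of_covers hx hk hσ hL h.covers⟩
    have := h.le
    simpa only [halfPerim, er] using this

end

end RealRAM

/-! ### Gaps, and why a large one splits the problem. -/

theorem inRect_iff {c : ℕ → ℕ → ℝ} {a b : ℕ → ℝ} {x : ℕ} :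
    InRect c (a 0) (b 0) (a 1) (b 1) x ↔ ∀ e, e < 2 → a e ≤ c e x ∧ c e x ≤ b e := by
  refine ⟨fun h e he => ?_, fun h => ⟨h 0 (by decide), h 1 (by decide)⟩⟩
  interval_cases e
  · exact h.1
  · exact h.2

/-- Copying the selected entries consecutively keeps their order. The `i`-th entry, if selected,
goes to the cell whose index is the number of selected ones before it. -/
theorem IsEnum.filter {L f : ℕ → ℕ} {S : Finset ℕ} {r : ℕ → ℕ} (h : IsEnum L S r) (p : ℕ → Prop)
    [DecidablePred p]
    (hf : ∀ i, i < S.card → p (L i) → f (Nat.count (fun i => p (L i)) i) = L i) :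
    (S.filter p).card = Nat.count (fun i => p (L i)) S.card ∧ IsEnum f (S.filter p) r := by
  have hc : (S.filter p).card = Nat.count (fun i => p (L i)) S.card := by
    rw [Nat.count_eq_card_filter_range]
    symm
    refine Finset.card_bij (fun i _ => L i) ?_ ?_ ?_
    · intro i hi
      simp at hi
      simp [h.mem i hi.1, hi.2]
    · intro i hi j hj hij
      simp at hi hj
      exact h.inj hi.1 hj.1 hij
    · intro x hx
      simp at hx
      obtain ⟨i, hi, rfl⟩ := h.surj x hx.1
      exact ⟨i, by simp [hi, hx.2], rfl⟩
  refine ⟨hc, ?_, ?_, ?_⟩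
  · intro j hj
    rw [hc] at hj
    obtain ⟨i, hi, hp, rfl⟩ := Nat.exists_count_eq hj
    rw [hf i hi hp]
    simp [h.mem i hi, hp]
  · intro x hx
    simp at hx
    obtain ⟨i, hi, rfl⟩ := h.surj x hx.1
    refine ⟨_, ?_, hf i hi hx.2⟩
    rw [hc]
    exact Nat.count_lt_count (A := fun i => p (L i)) hx.2 hi
  · intro j j' hjj hj'
    rw [hc] at hj'
    obtain ⟨i', hi', hp', rfl⟩ := Nat.exists_count_eq hj'
    obtain ⟨i, hi, hp, rfl⟩ := Nat.exists_count_eq (hjj.trans hj')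
    rw [hf i hi hp, hf i' hi' hp']
    refine h.lt i i' ?_ hi'
    by_contra! hle
    have := Nat.count_monotone (fun i => p (L i)) hle
    omega

/-- Ranks are strictly increasing along the enumeration, even where coordinates repeat. Selecting by
ranks thus gives subsets of exactly predictable size. -/
theorem IsEnum.card_filter_Icc {L : ℕ → ℕ} {S : Finset ℕ} {r : ℕ → ℕ} (h : IsEnum L S r)
    {a b : ℕ} (hab : a ≤ b) (hb : b < S.card) :
    (S.filter fun x => r (L a) ≤ r x ∧ r x ≤ r (L b)).card = b + 1 - a := by
  rw [← Nat.card_Ico]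
  symm
  have hmono : ∀ i j, i < S.card → j < S.card → (r (L i) ≤ r (L j) ↔ i ≤ j) := by
    intro i j hi hj
    constructor
    · intro h1
      by_contra! h2
      have := h.lt j i h2 hi
      omega
    · intro h1
      rcases h1.eq_or_lt with rfl | h1
      · exact le_rfl
      · exact (h.lt i j h1 hj).le
  refine Finset.card_bij (fun i _ => L i) ?_ ?_ ?_
  · intro i hi
    simp at hi
    simp [h.mem i (by omega), hmono a i (by omega) (by omega), hmono i b (by omega) hb]
    omega
  · intro i hi j hj hij
    simp at hi hj
    exact h.inj (by omega) (by omega) hij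
  · intro x hx
    simp at hx
    obtain ⟨i, hi, rfl⟩ := h.surj x hx.1
    rw [hmono a i (by omega) hi, hmono i b hi hb] at hx
    exact ⟨i, by simp; omega, rfl⟩

/-- If `s` consecutive steps of a monotone sequence never rise by more than `g`, then `J * s` steps
do not rise by more than `J * g`. -/
theorem rise_le {f : ℕ → ℝ} {lo hi s : ℕ} {g : ℝ} (hf : ∀ i j, i ≤ j → j ≤ hi → f i ≤ f j)
    (hs : lo + s ≤ hi) (hg : ∀ i, lo ≤ i → i + s ≤ hi → f (i + s) - f i ≤ g) (J : ℕ) :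
    ∀ x, lo ≤ x → x ≤ hi → x ≤ lo + J * s → f x - f lo ≤ J * g := by
  have hg0 : 0 ≤ g := by
    have h1 := hg lo le_rfl hs
    have h2 := hf lo (lo + s) (by omega) hs
    linarith
  induction J with
  | zero =>
    intro x h1 h2 h3
    obtain rfl : x = lo := by omega
    simp
  | succ J ih =>
    intro x h1 h2 h3
    push_cast
    by_cases hx : lo + s ≤ x
    · have h4 := ih (x - s) (by omega) (by omega) (by rw [Nat.add_mul] at h3; omega)
      have h5 := hg (x - s) (by omega) (by omega)
      rw [Nat.sub_add_cancel (by omega)] at h5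
      linarith
    · have h4 := hf x (lo + s) (by omega) hs
      have h5 := hg lo le_rfl hs
      have h6 : 0 ≤ (J : ℝ) * g := by positivity
      linarith

/-- The points of `S` whose coordinates are between the `q`-th from below and from above. -/
noncomputable def middle (c : ℕ → ℕ → ℝ) (S : Finset ℕ) (L : ℕ → ℕ → ℕ) (m q : ℕ) : Finset ℕ :=
  S.filter (InRect c (c 0 (L 0 q)) (c 0 (L 0 (m - 1 - q))) (c 1 (L 1 q)) (c 1 (L 1 (m - 1 - q))))

theorem mem_middle {c : ℕ → ℕ → ℝ} {S : Finset ℕ} {L : ℕ → ℕ → ℕ} {m q x : ℕ} :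
    x ∈ middle c S L m q ↔
      x ∈ S ∧ ∀ e, e < 2 → c e (L e q) ≤ c e x ∧ c e x ≤ c e (L e (m - 1 - q)) := by
  rw [middle, Finset.mem_filter]
  exact and_congr_right fun _ =>
    inRect_iff (a := fun e => c e (L e q)) (b := fun e => c e (L e (m - 1 - q)))

section

variable {c : ℕ → ℕ → ℝ} {k m q s : ℕ} {S : Finset ℕ} {L ρ : ℕ → ℕ → ℕ} {g : ℝ}
  (hm : S.card = m) (hq : q = m / 8) (hL : ∀ e, e < 2 → IsEnum (L e) S (ρ e))
  (hmono : ∀ e, e < 2 → ∀ i j, i ≤ j → j < m → c e (L e i) ≤ c e (L e j))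
include hm hq hL hmono

/-- A point outside the middle is among the first or the last `q` in one of the two directions. That
excludes at most `4 q ≤ m / 2` points. -/
theorem card_middle : m ≤ 2 * (middle c S L m q).card := by
  have h : ∀ e, ((Finset.range q ∪ Finset.Ico (m - q) m).image (L e)).card ≤ 2 * q := fun e =>
    Finset.card_image_le.trans ((Finset.card_union_le _ _).trans (by simp; omega))
  have h1 : S \ ((Finset.range q ∪ Finset.Ico (m - q) m).image (L 0) ∪
      (Finset.range q ∪ Finset.Ico (m - q) m).image (L 1)) ⊆
      middle c S L m q := by
    intro x hx
    simp only [Finset.mem_sdiff, Finset.mem_union, not_or] at hx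
    refine mem_middle.2 ⟨hx.1, ?_⟩
    have key : ∀ e, e < 2 → x ∉ (Finset.range q ∪ Finset.Ico (m - q) m).image (L e) →
        c e (L e q) ≤ c e x ∧ c e x ≤ c e (L e (m - 1 - q)) := by
      intro e he hx'
      obtain ⟨i, hi, rfl⟩ := (hL e he).surj x hx.1
      have h2 : i ∉ Finset.range q ∪ Finset.Ico (m - q) m := fun h =>
        hx' (Finset.mem_image_of_mem _ h)
      simp at h2
      exact ⟨hmono e he _ _ (by omega) (by omega), hmono e he _ _ (by omega) (by omega)⟩
    intro e he
    interval_cases e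
    · exact key 0 (by decide) hx.2.1
    · exact key 1 (by decide) hx.2.2
  have h2 := Finset.card_le_card h1
  have h3 := Finset.le_card_sdiff ((Finset.range q ∪ Finset.Ico (m - q) m).image (L 0) ∪
      (Finset.range q ∪ Finset.Ico (m - q) m).image (L 1)) S
  have h4 := Finset.card_union_le ((Finset.range q ∪ Finset.Ico (m - q) m).image (L 0))
      ((Finset.range q ∪ Finset.Ico (m - q) m).image (L 1))
  have h5 := h 0
  have h6 := h 1
  omega

variable (hk : 1 ≤ k) (hkm : 28800 * k ≤ m) (hs : 32 * m * k ≤ s * s) (hsm : 20 * s ≤ m)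
  (hg : ∀ e, e < 2 → ∀ i, q ≤ i → i + s + q < m → c e (L e (i + s)) - c e (L e i) ≤ g)
include hk hkm hs hsm hg

-- The central range is covered by `m / s + 1` strides of `s` steps, and each stride rises by at
-- most `g`.
omit hL in
theorem middle_width {e x : ℕ} (he : e < 2) (hx : c e x ≤ c e (L e (m - 1 - q))) :
    c e x - c e (L e q) ≤ (m / s + 1 : ℕ) * g := by
  have hs0 : 0 < s := by
    by_contra! h
    obtain rfl : s = 0 := by omega
    have : 0 < m * k := Nat.mul_pos (by omega) (by omega)
    rw [Nat.mul_assoc] at hs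
    omega
  have := rise_le (f := fun i => c e (L e i)) (lo := q) (hi := m - 1 - q) (s := s) (g := g)
    (fun i j hij hj => hmono e he i j hij (by omega)) (by omega)
    (fun i h1 h2 => hg e he i h1 (by omega)) (m / s + 1) (m - 1 - q) (by omega) le_rfl (by
      have := Nat.lt_div_mul_add (a := m) hs0
      rw [Nat.add_mul]
      omega)
  linarith

/-- With `g ≤ 0` the middle has width zero in both directions, so all its points coincide, and there
are at least `m / 2 ≥ k` of them. -/
theorem le_rectCount_of_gap_nonpos (hg0 : g ≤ 0) :
    k ≤ rectCount c S (c 0 (L 0 q)) (c 0 (L 0 q)) (c 1 (L 1 q)) (c 1 (L 1 q)) := by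
  have h1 := card_middle hm hq hL hmono
  refine (show k ≤ _ by omega : k ≤ _).trans (Finset.card_le_card
    (s := middle c S L m q) ?_)
  intro x hx
  rw [mem_middle] at hx
  rw [Finset.mem_filter]
  have key : ∀ e, e < 2 → c e (L e q) ≤ c e x ∧ c e x ≤ c e (L e q) := by
    intro e he
    have h2 := middle_width hm hq hmono hk hkm hs hsm hg he (hx.2 e he).2
    have h3 : ((m / s + 1 : ℕ) : ℝ) * g ≤ 0 := mul_nonpos_of_nonneg_of_nonpos (by positivity) hg0
    exact ⟨(hx.2 e he).1, by linarith⟩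
  exact ⟨hx.1, key 0 (by decide), key 1 (by decide)⟩

/-- Pigeonhole on a grid over the middle. Cells of side `2 g / 5` have half-perimeter `4 g / 5 < g`,
and a width of at most `J g` meets fewer than `3 J` of them per direction. -/
theorem exists_small_rect (hg0 : 0 < g) :
    ∃ x₁ x₂ y₁ y₂, k ≤ rectCount c S x₁ x₂ y₁ y₂ ∧ x₂ - x₁ + (y₂ - y₁) < g := by
  have h1 := card_middle hm hq hL hmono
  set M := middle c S L m q with hM
  set J := m / s + 1 with hJ
  have hJ1 : 1 ≤ J := Nat.le_add_left 1 _
  have hs0 : 0 < s := by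
    by_contra! h
    obtain rfl : s = 0 := by omega
    have : 0 < m * k := Nat.mul_pos (by omega) (by omega)
    rw [Nat.mul_assoc] at hs
    omega
  have hJs : J * s ≤ m + s := by
    have := Nat.div_mul_le_self m s
    rw [hJ, Nat.add_mul]
    omega
  -- From `3 J s ≤ 4 m` and `s² ≥ 32 m k`: `9 J² * 32 m k ≤ 16 m²`. The factor `32` in the choice of
  -- `s` is made for this.
  have hN : 2 * ((3 * J) * (3 * J) * k) ≤ m := by
    have e1 : 3 * (J * s) ≤ 4 * m := by omega
    have e2 : (3 * (J * s)) * (3 * (J * s)) ≤ (4 * m) * (4 * m) := Nat.mul_le_mul e1 e1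
    refine Nat.le_of_mul_le_mul_right ?_ (Nat.mul_pos hs0 hs0)
    nlinarith
  set cell : ℕ → ℕ → ℕ := fun e x => ⌊(c e x - c e (L e q)) / (2 * g / 5)⌋₊ with hcell
  have hδ : 0 < 2 * g / 5 := by positivity
  have hlt : ∀ e x, e < 2 → x ∈ M → cell e x < 3 * J := by
    intro e x he hx
    rw [hM, mem_middle] at hx
    have h2 := middle_width hm hq hmono hk hkm hs hsm hg he (hx.2 e he).2
    have h3 := (hx.2 e he).1
    rw [hcell]
    refine (Nat.floor_lt (div_nonneg (by linarith) hδ.le)).2 ?_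
    rw [div_lt_iff₀ hδ]
    have h4 : (1 : ℝ) ≤ J := by exact_mod_cast hJ1
    push_cast
    nlinarith
  obtain ⟨⟨a, b⟩, -, hab⟩ := Finset.exists_le_card_fiber_of_mul_le_card_of_maps_to (s := M)
    (t := Finset.range (3 * J) ×ˢ Finset.range (3 * J)) (f := fun x => (cell 0 x, cell 1 x)) (n := k)
    (fun x hx => by simp [hlt 0 x (by decide) hx, hlt 1 x (by decide) hx])
    (by simp) (by simp; omega)
  refine ⟨c 0 (L 0 q) + a * (2 * g / 5), c 0 (L 0 q) + (a + 1) * (2 * g / 5),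
    c 1 (L 1 q) + b * (2 * g / 5), c 1 (L 1 q) + (b + 1) * (2 * g / 5),
    hab.trans (Finset.card_le_card ?_), by linarith⟩
  intro x hx
  simp only [Finset.mem_filter, Prod.mk.injEq] at hx ⊢
  have key : ∀ e, e < 2 → c e (L e q) + cell e x * (2 * g / 5) ≤ c e x ∧
      c e x ≤ c e (L e q) + (cell e x + 1) * (2 * g / 5) := by
    intro e he
    have hx' := hx.1
    rw [hM, mem_middle] at hx'
    have h3 := (hx'.2 e he).1
    have h4 := Nat.floor_le (div_nonneg (sub_nonneg.2 h3) hδ.le)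
    have h5 := (Nat.lt_floor_add_one ((c e x - c e (L e q)) / (2 * g / 5))).le
    rw [le_div_iff₀ hδ] at h4
    rw [div_le_iff₀ hδ] at h5
    change (cell e x : ℝ) * (2 * g / 5) ≤ _ at h4
    change _ ≤ ((cell e x : ℝ) + 1) * (2 * g / 5) at h5
    exact ⟨by linarith, by linarith⟩
  have h0 := key 0 (by decide)
  have h1 := key 1 (by decide)
  rw [hx.2.1] at h0
  rw [hx.2.2] at h1
  have hxS : x ∈ S := (mem_middle.1 hx.1).1
  exact ⟨hxS, h0, h1⟩

end

/-- Rectangles of half-perimeter less than the gap `g` between positions `p` and `p + s` have all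
their points on one side. -/
theorem isLowerBound_of_split {c : ℕ → ℕ → ℝ} {k e p s : ℕ} {S S₁ S₂ : Finset ℕ} {L : ℕ → ℕ}
    {g v : ℝ} (he : e < 2) (hL : ∀ x, x ∈ S → ∃ i, i < S.card ∧ L i = x)
    (hmono : ∀ i j, i ≤ j → j < S.card → c e (L i) ≤ c e (L j))
    (hg : g ≤ c e (L (p + s)) - c e (L p)) (hS₁ : ∀ i, i < p + s → L i ∈ S₁)
    (hS₂ : ∀ i, p ≤ i → i < S.card → L i ∈ S₂)
    (hsmall : ∃ x₁ x₂ y₁ y₂, k ≤ rectCount c S x₁ x₂ y₁ y₂ ∧ x₂ - x₁ + (y₂ - y₁) < g)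
    (h₁ : IsLowerBound c k S₁ v) (h₂ : IsLowerBound c k S₂ v) : IsLowerBound c k S v := by
  have key : ∀ x₁ x₂ y₁ y₂, k ≤ rectCount c S x₁ x₂ y₁ y₂ → x₂ - x₁ + (y₂ - y₁) < g →
      v ≤ x₂ - x₁ + (y₂ - y₁) := by
    intro x₁ x₂ y₁ y₂ hc hlt
    have hd : ∀ x y, InRect c x₁ x₂ y₁ y₂ x → InRect c x₁ x₂ y₁ y₂ y →
        c e y - c e x ≤ x₂ - x₁ + (y₂ - y₁) := by
      rintro x y ⟨⟨a1, a2⟩, a3, a4⟩ ⟨⟨b1, b2⟩, b3, b4⟩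
      interval_cases e <;> linarith
    by_cases hall : ∀ x, x ∈ S → InRect c x₁ x₂ y₁ y₂ x → x ∈ S₁
    · refine h₁ _ _ _ _ (hc.trans (Finset.card_le_card fun x hx => ?_))
      simp only [Finset.mem_filter] at hx ⊢
      exact ⟨hall x hx.1 hx.2, hx.2⟩
    · push Not at hall
      obtain ⟨x, hxS, hx, hx₁⟩ := hall
      obtain ⟨i, hi, rfl⟩ := hL x hxS
      have hi' : p + s ≤ i := by
        by_contra! h
        exact hx₁ (hS₁ i h)
      -- The rectangle contains a point at position `p + s` or later. A second one before `p` would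
      -- make it at least `g` wide.
      refine h₂ _ _ _ _ (hc.trans (Finset.card_le_card fun y hy => ?_))
      simp only [Finset.mem_filter] at hy ⊢
      obtain ⟨j, hj, rfl⟩ := hL y hy.1
      refine ⟨hS₂ j ?_ hj, hy.2⟩
      by_contra! hjp
      have a1 := hd _ _ hy.2 hx
      have a2 := hmono j p hjp.le (by omega)
      have a3 := hmono (p + s) i hi' hi
      linarith
  intro x₁ x₂ y₁ y₂ hc
  by_cases hlt : x₂ - x₁ + (y₂ - y₁) < g
  · exact key _ _ _ _ hc hlt
  -- Rectangles of half-perimeter `g` or more are beaten by the small one, to which `key` applies.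
  · obtain ⟨a, b, a', b', h3, h4⟩ := hsmall
    have := key _ _ _ _ h3 h4
    linarith

/-! ### Finding the largest gap and extracting subsets. -/

namespace RealRAM

/-- The constant part of the memory during the recursion on point sets. -/
structure SetStatic (n k : ℕ) (c : ℕ → ℕ → ℝ) (ρ : ℕ → ℕ → ℕ) (s : State) : Prop where
  num : s.nv 0 = n
  goal : s.nv 1 = k
  coord : ∀ e, e < 2 → s.ra e = c e
  rank : ∀ e, e < 2 → ∀ x, x < n → s.na 1 (e * n + x) = ρ e x

/-- Level `o` of the memory describes the point set `S`. -/
structure SetNode (n : ℕ) (ρ : ℕ → ℕ → ℕ) (S : Finset ℕ) (o : ℕ) (s : State) : Prop where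
  card : s.na 2 o = S.card
  enum : ∀ e, e < 2 → IsEnum (fun i => s.na 0 (o + e * n + i)) S (ρ e)

theorem SetStatic.frame {n k : ℕ} {c : ℕ → ℕ → ℝ} {ρ : ℕ → ℕ → ℕ} {W : List ℕ} {s s' : State}
    (h : SetStatic n k c ρ s) (hf : Frame W s s')
    (hW : ∀ a, a ∈ W → a ≠ 0 ∧ a ≠ 4 ∧ a ≠ 3 ∧ a ≠ 7 ∧ a ≠ 6) :
    SetStatic n k c ρ s' where
  num := by rw [hf.nv 0 fun h => (hW _ h).1 rfl, h.num]
  goal := by rw [hf.nv 1 fun h => (hW _ h).2.1 rfl, h.goal]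
  coord e he := by
    rw [← h.coord e he]
    interval_cases e
    · exact hf.ra 0 fun h => (hW _ h).2.2.1 rfl
    · exact hf.ra 1 fun h => (hW _ h).2.2.2.1 rfl
  rank := by
    rw [hf.na 1 fun h => (hW _ h).2.2.2.2 rfl]
    exact h.rank

theorem SetNode.frame {n o : ℕ} {ρ : ℕ → ℕ → ℕ} {S : Finset ℕ} {W : List ℕ} {s s' : State}
    (h : SetNode n ρ S o s) (hf : Frame W s s') (h2 : 2 ∉ W) (h10 : 10 ∉ W) :
    SetNode n ρ S o s' where
  card := by rw [hf.na 2 h10, h.card]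
  enum := by
    rw [hf.na 0 h2]
    exact h.enum

/-- Compute the number of points, the size of the margins and the size of the gaps. -/
def splitSize : Cmd :=
  (.nset 3 (.get 2 (nvar 2)) ;; .nset 40 (nvar 3 / 8) ;; .nset 41 0) ;;
  .loop (.not (.nle (32 * nvar 3 * nvar 1) (nvar 41 * nvar 41))) (.nset 41 (nvar 41 + 1))

/-- Compare the largest gap so far with the next one in direction `e`. -/
def scanCell (e : ℕ) : Cmd :=
  .nset 50 (nvar 2 + .lit e * nvar 0 + (nvar 40 + nvar 45)) ;;
  .rset 5 (.get e (.get 0 (nvar 50 + nvar 41)) - .get e (.get 0 (nvar 50))) ;;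
  .cond (.not (.rle (rvar 5) (rvar 4)))
    (.rset 4 (rvar 5) ;; .nset 42 (.lit e) ;; .nset 43 (nvar 40 + nvar 45)) .skip

/-- Look for the largest gap in direction `e`. -/
def scanAxis (e : ℕ) : Cmd := forTo 45 (nvar 3 - 2 * nvar 40 - nvar 41) (scanCell e)

/-- Find the largest gap. -/
def splitNode : Cmd :=
  splitSize ;;
  (.nset 42 0 ;; .nset 43 (nvar 40) ;;
    .rset 4 (.get 0 (.get 0 (nvar 2 + nvar 40 + nvar 41)) - .get 0 (.get 0 (nvar 2 + nvar 40)))) ;;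
  scanAxis 0 ;; scanAxis 1 ;;
  .nput 3 (nvar 2) (nvar 42) ;; .nput 4 (nvar 2) (nvar 43) ;; .nput 5 (nvar 2) (nvar 41)

/-- Copy the points with rank between `nvar 46` and `nvar 47` to the next level. -/
def filterAxis (e : ℕ) : Cmd :=
  .nset 49 0 ;;
  forTo 45 (.get 2 (nvar 2))
    (.nset 50 (.get 0 (nvar 2 + .lit e * nvar 0 + nvar 45)) ;;
      .cond (.and (.nle (nvar 46) (.get 1 (nvar 48 + nvar 50)))
          (.nle (.get 1 (nvar 48 + nvar 50)) (nvar 47)))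
        (.nput 0 (nvar 2 + 2 * nvar 0 + .lit e * nvar 0 + nvar 49) (nvar 50) ;;
          .nset 49 (nvar 49 + 1))
        .skip)

/-- The gap at position `nvar 43` in direction `nvar 42` is the largest among those in `D`. -/
structure IsMaxGap (m q d : ℕ) (X : ℕ → ℕ → ℝ) (D : ℕ → ℕ → Prop) (s : State) : Prop where
  axis : s.nv 42 < 2
  low : q ≤ s.nv 43
  high : s.nv 43 + d + q < m
  val : s.rv 4 = X (s.nv 42) (s.nv 43 + d) - X (s.nv 42) (s.nv 43)
  max : ∀ e i, D e i → X e (i + d) - X e i ≤ s.rv 4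

section

variable {pr : List Cmd} {pw : ℕ → List ℕ}

theorem scanCell_runs {B n m q d e i o : ℕ} {X : ℕ → ℕ → ℝ} {D : ℕ → ℕ → Prop} {s : State}
    (he : e < 2) (h0 : s.nv 0 = n) (h2 : s.nv 2 = o) (h40 : s.nv 40 = q) (h41 : s.nv 41 = d)
    (h45 : s.nv 45 = i) (hi : i + 2 * q + d < m)
    (hX : ∀ i, i < m → s.ra e (s.na 0 (o + e * n + i)) = X e i) (hB : o + 2 * n + m ≤ B)
    (hB2 : 2 ≤ B) (h : IsMaxGap m q d X D s) :
    Runs pr B (scanCell e) s 60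
      (IsMaxGap m q d X fun e' i' => D e' i' ∨ e' = e ∧ i' = q + i) := by
  have hen : e * n ≤ 1 * n := Nat.mul_le_mul_right _ (by omega)
  have e1 := hX (q + i) (by omega)
  have e2 := hX (q + i + d) (by omega)
  rw [← Nat.add_assoc (o + e * n)] at e2
  refine Runs.straight ?_ (Nat.le_of_ble_eq_true rfl)
  simp only [scanCell, wp, NExp.eval_add', NExp.eval_mul', NExp.eval_lit', NExp.eval_var', h0, h2,
    h40, h41, h45, State.nv_setN, State.na_setN, State.ra_setN, RExp.eval_sub', RExp.eval_get',
    NExp.eval_get', BExp.eval_not, BExp.eval_rle, RExp.eval_var', State.rv_setR, State.rv_setN,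
    State.nv_setR, if_true, if_false, Nat.reduceEqDiff, e1, e2]
  refine ⟨by omega, fun hlt => ⟨by omega, by omega, ?_⟩, fun hle => ?_⟩
  · have hlt' := not_le.1 hlt
    refine ⟨by simpa using he, by simp, by simp; omega, by simp, ?_⟩
    rintro e' i' (hD | ⟨rfl, rfl⟩)
    · have := h.max e' i' hD
      simp
      linarith
    · simp
  · rw [not_not] at hle
    refine ⟨by simpa using h.axis, by simpa using h.low, by simpa using h.high,
      by simpa using h.val, ?_⟩
    rintro e' i' (hD | ⟨rfl, rfl⟩)
    · simpa using h.max e' i' hD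
    · simpa using hle

variable (hpw : WritesOK pr pw)
include hpw

theorem scanAxis_runs {B n m q d e o : ℕ} {X : ℕ → ℕ → ℝ} {D : ℕ → ℕ → Prop} {s : State}
    (he : e < 2) (h0 : s.nv 0 = n) (h2 : s.nv 2 = o) (h3 : s.nv 3 = m) (h40 : s.nv 40 = q)
    (h41 : s.nv 41 = d) (hX : ∀ i, i < m → s.ra e (s.na 0 (o + e * n + i)) = X e i)
    (hB : o + 2 * n + m ≤ B) (hB2 : 2 ≤ B) (h : IsMaxGap m q d X D s) :
    Runs pr B (scanAxis e) s (m * 75 + 13)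
      (IsMaxGap m q d X fun e' i => D e' i ∨ e' = e ∧ q ≤ i ∧ i + d + q < m) := by
  refine (forTo_runs hpw (N := m - 2 * q - d) (T := 60) (fun j => IsMaxGap m q d X
    fun e' i' => D e' i' ∨ e' = e ∧ q ≤ i' ∧ i' < q + j) (by simp [Cmd.writes, scanCell])
    (by omega) ?_ ?_ ?_ (T₀ := m * 75 + 13) ?_).mono le_rfl ?_
  · intro s' hf
    have hf : Frame [180, 200, 21, 17, 168, 172, 180] s s' := hf
    simp [hf.nv 3 (by decide), hf.nv 40 (by decide), hf.nv 41 (by decide), h3, h40, h41]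
  · refine ⟨by simpa using h.axis, by simpa using h.low, by simpa using h.high,
      by simpa using h.val, ?_⟩
    rintro e' i' (hD | ⟨-, h1, h2⟩)
    · simpa using h.max e' i' hD
    · omega
  · intro j s' hj hf hj' hI
    have hf : Frame [180, 200, 21, 17, 168, 172, 180] s s' := hf
    refine (scanCell_runs he (by rw [hf.nv 0 (by decide), h0]) (by rw [hf.nv 2 (by decide), h2])
      (by rw [hf.nv 40 (by decide), h40]) (by rw [hf.nv 41 (by decide), h41]) hj' (by omega)
      (fun i hi => by rw [hf.na 0 (by decide), hf.ra e (by simp; omega), hX i hi]) hB hB2 hI).mono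
      le_rfl ?_
    intro s'' h'
    refine ⟨by simpa using h'.axis, by simpa using h'.low, by simpa using h'.high,
      by simpa using h'.val, ?_⟩
    rintro e' i' hD
    refine h'.max e' i' ?_
    rcases hD with hD | ⟨h1, h2, h3⟩
    · exact Or.inl (Or.inl hD)
    · by_cases hi : i' = q + j
      · exact Or.inr ⟨h1, hi⟩
      · exact Or.inl (Or.inr ⟨h1, h2, by omega⟩)
  · have : (m - 2 * q - d) * (60 + 15) ≤ m * 75 := Nat.mul_le_mul (by omega) le_rfl
    exact (Nat.add_le_add_right this _).trans (by simp)
  · rintro s' ⟨h', -, -⟩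
    refine ⟨h'.axis, h'.low, h'.high, h'.val, fun e' i' hD => h'.max e' i' ?_⟩
    rcases hD with hD | ⟨h1, h2, h3⟩
    · exact Or.inl hD
    · exact Or.inr ⟨h1, h2, by omega⟩

/-- The loop finds the least `d` with `d² ≥ 32 m k`. The invariant about `d - 1` expresses
minimality, and truncated subtraction makes it true at the start. -/
theorem splitSize_runs {B m k : ℕ} {s : State} (h1 : s.nv 1 = k) (hm : s.na 2 (s.nv 2) = m)
    (hkm : 28800 * k ≤ m) (hk : 1 ≤ k) (hB : m ≤ B) :
    Runs pr B splitSize s (m * 20 + 40) fun s' => s'.nv 3 = m ∧ s'.nv 40 = m / 8 ∧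
      32 * m * k ≤ s'.nv 41 * s'.nv 41 ∧ 20 * s'.nv 41 ≤ m ∧
      (s'.nv 41 - 1) * (s'.nv 41 - 1) ≤ 32 * m * k := by
  refine Runs.seq' (T := 20) (Runs.straight (Q := fun s' => s'.nv 3 = m ∧ s'.nv 40 = m / 8 ∧
    s'.nv 41 = 0 ∧ s'.nv 1 = k) (by simp [wp, hm, h1]; omega) (Nat.le_of_ble_eq_true rfl)) ?_
    (T' := m * 20 + 20) (by omega)
  rintro s₁ ⟨a3, a40, a41, a1⟩
  -- Here `28800 = 900 * 32`, so `d - 1 ≤ m / 30`, and as `m` is large, `20 d ≤ m`.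
  have hbound : 30 * 30 * (32 * m * k) ≤ m * m := by nlinarith
  refine (Runs.loop_measure hpw (T := 4)
    (fun s' => (s'.nv 41 - 1) * (s'.nv 41 - 1) ≤ 32 * m * k) (fun s' => m - s'.nv 41) ?_
    (by simp [a41])).mono ?_ ?_
  · rintro s' hf h4 hb
    have hf : Frame [164] s₁ s' := hf
    simp [hf.nv 3 (by decide), hf.nv 1 (by decide), a3, a1] at hb
    have hlt : s'.nv 41 < m := by
      by_contra! h
      have := Nat.mul_le_mul h h
      omega
    refine Runs.straight ?_ (Nat.le_of_ble_eq_true rfl)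
    simp [wp]
    exact ⟨by omega, hb.le, by omega⟩
  · rw [a41]
    exact le_rfl.trans (by simp [BExp.size]; omega)
  · rintro s' ⟨⟨h4, hb⟩, hf⟩
    have hf : Frame [164] s₁ s' := hf
    simp [hf.nv 3 (by decide), hf.nv 1 (by decide), a3, a1] at hb
    refine ⟨by rw [hf.nv 3 (by decide), a3], by rw [hf.nv 40 (by decide), a40], hb, ?_, h4⟩
    have : 30 * (s'.nv 41 - 1) ≤ m := by
      by_contra! h
      have h5 := Nat.mul_lt_mul'' h h
      have h6 : 30 * (s'.nv 41 - 1) * (30 * (s'.nv 41 - 1)) =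
        30 * 30 * ((s'.nv 41 - 1) * (s'.nv 41 - 1)) := by ring
      omega
    omega

theorem splitNode_runs {B n m k o : ℕ} {c : ℕ → ℕ → ℝ} {ρ : ℕ → ℕ → ℕ} {S : Finset ℕ} {s : State}
    (hS : SetStatic n k c ρ s) (hN : SetNode n ρ S o s) (h2 : s.nv 2 = o) (hm : S.card = m)
    (hk : 1 ≤ k) (hkm : 28800 * k ≤ m) (hB : o + 2 * n + m ≤ B) :
    Runs pr B splitNode s (m * 200 + 200) fun s' => ∃ d D, d * 20 ≤ m ∧ 32 * m * k ≤ d * d ∧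
      (d - 1) * (d - 1) ≤ 32 * m * k ∧ s'.nv 3 = m ∧ s'.nv 40 = m / 8 ∧
      IsMaxGap m (m / 8) d (fun e i => c e (s.na 0 (o + e * n + i))) D s' ∧
      (∀ e i, e < 2 → m / 8 ≤ i → i + d + m / 8 < m → D e i) ∧
      s'.na 3 o = s'.nv 42 ∧ s'.na 4 o = s'.nv 43 ∧ s'.na 5 o = d ∧
      ∀ a, a < 6 → ∀ x, x < o → s'.na a x = s.na a x := by
  refine Runs.mono (T := (m * 20 + 40) + (40 + ((m * 75 + 13) + ((m * 75 + 13) + 30)))) ?_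
    (by omega) fun _ h => h
  refine Runs.seq' ((splitSize_runs hpw hS.goal (by rw [h2, hN.card, hm]) hkm hk (by omega)).frame
    hpw) ?_ le_rfl
  rintro s₁ ⟨⟨a3, a40, a1, a2, a4⟩, hf₁⟩
  have hf₁ : Frame [12, 160, 164, 164] s s₁ := hf₁
  generalize hd : s₁.nv 41 = d at *
  have b0 : s₁.nv 0 = n := by rw [hf₁.nv 0 (by decide), hS.num]
  have b2 : s₁.nv 2 = o := by rw [hf₁.nv 2 (by decide), h2]
  have bn : s₁.na = s.na := funext fun a => hf₁.na a (by simp; omega)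
  have br : ∀ e, e < 2 → s₁.ra e = c e := fun e he => by
    rw [hf₁.ra e (by simp; omega), hS.coord e he]
  refine Runs.seq' ((Runs.straight (Q := fun s₂ => IsMaxGap m (m / 8) d
      (fun e i => c e (s.na 0 (o + e * n + i))) (fun _ _ => False) s₂) (by
    simp [wp, a40, hd, b2, bn, br]
    exact ⟨by omega, ⟨by simp, by simp, by simp; omega, by simp [Nat.add_assoc], by simp⟩⟩)
    (Nat.le_of_ble_eq_true rfl)).frame hpw) ?_ le_rfl
  rintro s₂ ⟨hI₂, hf₂⟩
  have hf₂ : Frame [168, 172, 17] s₁ s₂ := hf₂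
  have c0 : s₂.nv 0 = n := by rw [hf₂.nv 0 (by decide), b0]
  have c2 : s₂.nv 2 = o := by rw [hf₂.nv 2 (by decide), b2]
  have c3 : s₂.nv 3 = m := by rw [hf₂.nv 3 (by decide), a3]
  have c40 : s₂.nv 40 = m / 8 := by rw [hf₂.nv 40 (by decide), a40]
  have c41 : s₂.nv 41 = d := by rw [hf₂.nv 41 (by decide), hd]
  have cn : s₂.na = s.na := (funext fun a => hf₂.na a (by simp; omega)).trans bn
  have cr : ∀ e, e < 2 → s₂.ra e = c e := fun e he => by
    rw [hf₂.ra e (by simp; omega), br e he]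
  refine Runs.seq' ((scanAxis_runs hpw (e := 0) (by decide) c0 c2 c3 c40 c41
    (fun i hi => by rw [cn, cr 0 (by decide)]) hB (by omega) hI₂).frame hpw) ?_ le_rfl
  rintro s₃ ⟨hI₃, hf₃⟩
  have hf₃ : Frame [180, 200, 21, 17, 168, 172, 180] s₂ s₃ := hf₃
  refine Runs.seq' ((scanAxis_runs hpw (e := 1) (by decide) (by rw [hf₃.nv 0 (by decide), c0])
    (by rw [hf₃.nv 2 (by decide), c2]) (by rw [hf₃.nv 3 (by decide), c3])
    (by rw [hf₃.nv 40 (by decide), c40]) (by rw [hf₃.nv 41 (by decide), c41])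
    (fun i hi => by rw [hf₃.na 0 (by decide), cn, hf₃.ra 1 (by decide), cr 1 (by decide)])
    hB (by omega) hI₃).frame hpw) ?_ le_rfl
  rintro s₄ ⟨hI₄, hf₄⟩
  have hf₄ : Frame [180, 200, 21, 17, 168, 172, 180] s₃ s₄ := hf₄
  have d2 : s₄.nv 2 = o := by rw [hf₄.nv 2 (by decide), hf₃.nv 2 (by decide), c2]
  have d3 : s₄.nv 3 = m := by rw [hf₄.nv 3 (by decide), hf₃.nv 3 (by decide), c3]
  have d40 : s₄.nv 40 = m / 8 := by rw [hf₄.nv 40 (by decide), hf₃.nv 40 (by decide), c40]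
  have d41 : s₄.nv 41 = d := by rw [hf₄.nv 41 (by decide), hf₃.nv 41 (by decide), c41]
  have dn : s₄.na = s.na := by
    rw [← cn]
    funext a
    rw [hf₄.na a (by simp; omega), hf₃.na a (by simp; omega)]
  have h42 := hI₄.axis
  have h43 := hI₄.high
  refine Runs.straight ?_ (Nat.le_of_ble_eq_true rfl)
  simp [wp, d2, d41]
  refine ⟨by omega, by omega, by omega, by omega, a1, a4, d3, d40, _,
    ⟨hI₄.axis, hI₄.low, hI₄.high, hI₄.val, hI₄.max⟩, ?_, ?_⟩
  · intro e i he h5 h6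
    interval_cases e
    · exact Or.inl (Or.inr ⟨rfl, h5, h6⟩)
    · exact Or.inr ⟨rfl, h5, h6⟩
  · intro a ha x hx
    rw [if_neg (by omega), if_neg (by omega), if_neg (by omega), dn]

theorem filterAxis_runs {B n k o e ax lo hi : ℕ} {c : ℕ → ℕ → ℝ} {ρ : ℕ → ℕ → ℕ} {S : Finset ℕ}
    {s : State} (he : e < 2) (hax : ax < 2) (hS : SetStatic n k c ρ s) (hN : SetNode n ρ S o s)
    (hSn : S ⊆ Finset.range n) (h2 : s.nv 2 = o) (h46 : s.nv 46 = lo) (h47 : s.nv 47 = hi)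
    (h48 : s.nv 48 = ax * n) (hB : n ≤ B) :
    Runs pr B (filterAxis e) s (S.card * 60 + 30) fun s' =>
      IsEnum (fun i => s'.na 0 (o + 2 * n + e * n + i)) (S.filter fun x => lo ≤ ρ ax x ∧ ρ ax x ≤ hi)
        (ρ e) ∧
      s'.nv 49 = (S.filter fun x => lo ≤ ρ ax x ∧ ρ ax x ≤ hi).card ∧
      ∀ y, y < o + 2 * n + e * n ∨ o + 2 * n + e * n + n ≤ y → s'.na 0 y = s.na 0 y := by
  have hSc : S.card ≤ n := by simpa using Finset.card_le_card hSn
  have hen : e * n ≤ 1 * n := Nat.mul_le_mul_right _ (by omega)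
  have hE := hN.enum e he
  set L : ℕ → ℕ := fun i => s.na 0 (o + e * n + i) with hL
  set p : ℕ → Prop := fun x => lo ≤ ρ ax x ∧ ρ ax x ≤ hi with hp
  have hcount : ∀ i, i ≤ S.card → Nat.count (fun i => p (L i)) i ≤ i := fun i _ => Nat.count_le _
  refine Runs.seq' (T := 2) (Runs.straight (Q := fun s₁ => s₁ = s.setN 49 0) (by simp [wp])
    (Nat.le_of_ble_eq_true rfl)) ?_ (T' := S.card * 60 + 28) (by omega)
  rintro s₁ rfl
  refine (forTo_runs hpw (N := S.card) (T := 50) (fun i s' =>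
    s'.nv 49 = Nat.count (fun i => p (L i)) i ∧
    (∀ i', i' < i → p (L i') →
      s'.na 0 (o + 2 * n + e * n + Nat.count (fun i => p (L i)) i') = L i') ∧
    ∀ y, y < o + 2 * n + e * n ∨ o + 2 * n + e * n + n ≤ y → s'.na 0 y = s.na 0 y)
    (by simp [Cmd.writes]) (by omega) ?_ ?_ ?_ (T₀ := S.card * 60 + 28) (by simp)).mono le_rfl ?_
  · intro s' hf
    have hf : Frame [180, 200, 2, 196, 180] (s.setN 49 0) s' := hf
    simp [hf.nv 2 (by decide), hf.na 2 (by decide), h2, hN.card]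
  · simp
  · rintro i s' hi' hf hi'' ⟨h49, h5, h6⟩
    have hf : Frame [180, 200, 2, 196, 180] (s.setN 49 0) s' := hf
    have hLn : L i < n := by simpa using hSn (hE.mem i hi')
    -- The copy goes to the next level, `2 n` addresses further, so the source is intact.
    have e0 : s'.na 0 (o + e * n + i) = L i := h6 _ (by omega)
    have e1 : s'.na 1 (ax * n + L i) = ρ ax (L i) := by
      rw [hf.na 1 (by decide)]
      exact hS.rank ax hax _ hLn
    have hci := hcount i (by omega)
    refine Runs.straight ?_ (Nat.le_of_ble_eq_true rfl)
    simp only [wp, NExp.eval_get', NExp.eval_add', NExp.eval_mul', NExp.eval_lit', NExp.eval_var',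
      NExp.eval_ofNat, BExp.eval_and, BExp.eval_nle, State.nv_setN, State.na_setN, State.nv_putN,
      hf.nv 2 (by decide), hf.nv 0 (by decide), hf.nv 46 (by decide), hf.nv 47 (by decide),
      hf.nv 48 (by decide), if_true, if_false, Nat.reduceEqDiff, h2, hS.num, h46, h47, h48, hi'', e0,
      e1, h49, State.na_putN, true_and]
    refine ⟨by omega, fun hpi => ⟨by omega, by omega, ?_, ?_, ?_⟩, fun hpi => ⟨?_, ?_, h6⟩⟩
    · rw [Nat.count_succ, if_pos (show p (L i) from hpi)]
    · intro i' h7 h8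
      by_cases hii : i' = i
      · rw [if_pos (by rw [hii]), hii]
      · have := Nat.count_lt_count (A := fun i => p (L i)) h8 (show i' < i by omega)
        rw [if_neg (by omega)]
        exact h5 i' (by omega) h8
    · intro y hy
      rw [if_neg (by omega)]
      exact h6 y hy
    · rw [Nat.count_succ, if_neg (show ¬ p (L i) from hpi)]
      rfl
    · intro i' h7 h8
      refine h5 i' ?_ h8
      by_contra! h9
      obtain rfl : i' = i := by omega
      exact hpi h8
  · rintro s' ⟨⟨h49, h5, h6⟩, -, -⟩
    have h7 := hE.filter p (f := fun i => s'.na 0 (o + 2 * n + e * n + i)) h5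
    exact ⟨h7.2, by rw [h49, h7.1], h6⟩

end

end RealRAM

theorem IsEnum.rank_mono {L : ℕ → ℕ} {S : Finset ℕ} {r : ℕ → ℕ} (h : IsEnum L S r) {i j : ℕ}
    (hij : i ≤ j) (hj : j < S.card) : r (L i) ≤ r (L j) := by
  rcases hij.eq_or_lt with rfl | h1
  · exact le_rfl
  · exact (h.lt i j h1 hj).le

theorem IsEnum.congr {L L' : ℕ → ℕ} {S : Finset ℕ} {r : ℕ → ℕ} (h : IsEnum L S r)
    (hL : ∀ i, i < S.card → L' i = L i) : IsEnum L' S r where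
  mem i hi := by
    rw [hL i hi]
    exact h.mem i hi
  surj x hx := by
    obtain ⟨i, hi, rfl⟩ := h.surj x hx
    exact ⟨i, hi, hL i hi⟩
  lt i j hij hj := by
    rw [hL i (by omega), hL j hj]
    exact h.lt i j hij hj

/-- As `k ≥ 1`, some point lies in the rectangle, which excludes reversed sides. -/
theorem isLowerBound_zero {c : ℕ → ℕ → ℝ} {k : ℕ} (hk : 1 ≤ k) (S : Finset ℕ) :
    IsLowerBound c k S 0 := by
  intro x₁ x₂ y₁ y₂ h
  obtain ⟨x, hx⟩ := Finset.card_pos.1 (show 0 < (S.filter (InRect c x₁ x₂ y₁ y₂)).card from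
    lt_of_lt_of_le hk h)
  obtain ⟨⟨h1, h2⟩, h3, h4⟩ := (Finset.mem_filter.1 hx).2
  linarith

theorem IsLowerBound.mono {c : ℕ → ℕ → ℝ} {k : ℕ} {S : Finset ℕ} {v v' : ℝ}
    (h : IsLowerBound c k S v) (hv : v' ≤ v) : IsLowerBound c k S v' :=
  fun x₁ x₂ y₁ y₂ hc => hv.trans (h x₁ x₂ y₁ y₂ hc)

/-! ### The recursion on point sets. -/

namespace RealRAM

/-- Treat the points at positions `lo, …, hi` in the direction of the gap. -/
def childSet (lo hi : NExp) : Cmd :=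
  (.nset 48 (.get 3 (nvar 2) * nvar 0) ;;
    .nset 46 (.get 1 (nvar 48 + .get 0 (nvar 2 + nvar 48 + lo))) ;;
    .nset 47 (.get 1 (nvar 48 + .get 0 (nvar 2 + nvar 48 + hi)))) ;;
  filterAxis 0 ;; filterAxis 1 ;;
  (.nput 2 (nvar 2 + 2 * nvar 0) (nvar 49) ;; .nset 2 (nvar 2 + 2 * nvar 0)) ;;
  .call 1 ;; .nset 2 (nvar 2 - 2 * nvar 0)

/-- Output a point where many points of the input coincide. -/
def setPoint : Cmd :=
  .rset 0 (.get 0 (.get 0 (nvar 2 + nvar 40))) ;; .rset 1 (rvar 0) ;;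
  .rset 2 (.get 1 (.get 0 (nvar 2 + nvar 0 + nvar 40))) ;; .rset 3 (rvar 2)

/-- The recursion on point sets. -/
def solveSet : Cmd :=
  .cond (.not (.nle (28800 * nvar 1) (.get 2 (nvar 2)))) solveLeaf
    (splitNode ;; .cond (.rle (rvar 4) 0) setPoint
      (childSet 0 (.get 4 (nvar 2) + .get 5 (nvar 2) - 1) ;;
        childSet (.get 4 (nvar 2)) (.get 2 (nvar 2) - 1)))

/-- What `solveSet` modifies. -/
def setWrites : List ℕ :=
  solveWrites ++ [12, 48, 52, 74, 19, 8, 160, 164, 168, 172, 180, 184, 188, 192, 196, 200, 17, 21, 2,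
    10, 14, 18, 22]

/-- The codes `0` and `4` belong to `n` and `k`, `3` and `7` to the coordinates, `6` to the ranks.
Hence `SetStatic` survives every call. -/
theorem setWrites_avoids : ∀ a, a ∈ setWrites → a ≠ 0 ∧ a ≠ 4 ∧ a ≠ 3 ∧ a ≠ 7 ∧ a ≠ 6 := by decide

theorem solveLeaf_writes {pw : ℕ → List ℕ} (h0 : pw 0 = solveWrites) :
    solveLeaf.writes pw ⊆ [12, 48, 52, 56, 80, 60, 60, 84, 74, 19, 84, 88, 92, 62, 92, 88, 56, 84,
      58, 84, 42, 46, 50, 54, 84, 88, 92, 62, 11, 15, 88, 84] ++ solveWrites := by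
  have h1 : leafSizes.writes pw = [12, 48, 52, 56, 80, 60, 60] := rfl
  have h2 : leafRanks.writes pw = [84, 74, 19, 84] := rfl
  have h3 : clearTable.writes pw = [88, 92, 62, 92, 88] := rfl
  have h4 : leafRoot.writes pw = [56, 84, 58, 84, 42, 46, 50, 54] := rfl
  have h5 : fillTable.writes pw = [84, 88, 92, 62, 11, 15, 88, 84] := rfl
  simp only [solveLeaf, Cmd.writes, h1, h2, h3, h4, h5, h0]
  decide

theorem solveSet_writes {pw : ℕ → List ℕ} (h0 : pw 0 = solveWrites) (h1 : pw 1 = setWrites) :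
    solveSet.writes pw ⊆ setWrites := by
  have hc : ∀ lo hi, (childSet lo hi).writes pw ⊆ setWrites := by
    intro lo hi
    simp only [childSet, Cmd.writes, filterAxis, forTo, h1]
    decide
  have h3 : splitNode.writes pw ⊆ setWrites := by
    simp only [splitNode, splitSize, scanAxis, scanCell, forTo, Cmd.writes]
    decide
  simp only [solveSet, setPoint, Cmd.writes, List.append_subset, hc, h3, and_true]
  exact ⟨List.Subset.trans (solveLeaf_writes h0) (by decide), by decide⟩

/-- The result of the search for the best rectangle with `k` points of `S`, which leaves addresses
below `l` alone. -/
structure SetPost (c : ℕ → ℕ → ℝ) (n k : ℕ) (S : Finset ℕ) (o l : ℕ) (s s' : State) : Prop where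
  best : BestPost c n k S s s'
  base : s'.nv 2 = o
  low : ∀ a, a < 6 → ∀ x, x < l → s'.na a x = s.na a x

theorem SetNode.congr {n o : ℕ} {ρ : ℕ → ℕ → ℕ} {S : Finset ℕ} {s s' : State}
    (h : SetNode n ρ S o s) (hS : S.card ≤ n) (hn : 1 ≤ n)
    (hl : ∀ a, a < 6 → ∀ x, x < o + 2 * n → s'.na a x = s.na a x) : SetNode n ρ S o s' where
  card := by rw [hl 2 (by decide) o (by omega), h.card]
  enum e he := (h.enum e he).congr fun i hi => by
    have : e * n ≤ 1 * n := Nat.mul_le_mul_right _ (by omega)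
    exact hl 0 (by decide) _ (by omega)

section

variable {pr : List Cmd} {pw : ℕ → List ℕ} (hpw : WritesOK pr pw) (hpw1 : pw 1 = setWrites)
  {B n k : ℕ} {c : ℕ → ℕ → ℝ} {ρ : ℕ → ℕ → ℕ}
include hpw hpw1

/-- Both sorted lists are filtered by rank, so no subset is ever sorted again. The bounds `lo` and
`hi` may depend only on the arrays and the level address: direction, position and length of the gap
are kept in arrays of the level, because the recursive call destroys the scalar variables. -/
theorem childSet_runs {o ax a b T : ℕ} {lo hi : NExp} {S : Finset ℕ} {s : State}
    (hS : SetStatic n k c ρ s) (hN : SetNode n ρ S o s) (hSn : S ⊆ Finset.range n)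
    (h2 : s.nv 2 = o) (hax : ax < 2) (h3 : s.na 3 o = ax)
    (hlo : ∀ s', s'.na = s.na → s'.nv 2 = s.nv 2 → lo.eval s' = a)
    (hhi : ∀ s', s'.na = s.na → s'.nv 2 = s.nv 2 → hi.eval s' = b)
    (hlos : lo.size ≤ 10) (hhis : hi.size ≤ 10) (ha : a < S.card) (hb : b < S.card)
    (hρ : ∀ x, x < n → ρ ax x < n) (hB : o + 3 * n ≤ B)
    (hg : IsGood c n k (s.rv 0) (s.rv 1) (s.rv 2) (s.rv 3))
    (ih : ∀ s₁, SetStatic n k c ρ s₁ → SetNode n ρ (S.filter fun x =>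
        ρ ax (s.na 0 (o + ax * n + a)) ≤ ρ ax x ∧ ρ ax x ≤ ρ ax (s.na 0 (o + ax * n + b)))
        (o + 2 * n) s₁ → s₁.nv 2 = o + 2 * n →
      IsGood c n k (s₁.rv 0) (s₁.rv 1) (s₁.rv 2) (s₁.rv 3) →
      Runs pr B (.call 1) s₁ T (SetPost c n k (S.filter fun x =>
        ρ ax (s.na 0 (o + ax * n + a)) ≤ ρ ax x ∧ ρ ax x ≤ ρ ax (s.na 0 (o + ax * n + b)))
        (o + 2 * n) (o + 2 * n) s₁)) :
    Runs pr B (childSet lo hi) s (S.card * 120 + T + 200) fun s' =>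
      SetPost c n k (S.filter fun x =>
        ρ ax (s.na 0 (o + ax * n + a)) ≤ ρ ax x ∧ ρ ax x ≤ ρ ax (s.na 0 (o + ax * n + b)))
        o (o + 2 * n) s s' ∧ SetStatic n k c ρ s' := by
  have hSc : S.card ≤ n := by simpa using Finset.card_le_card hSn
  have haxn : ax * n ≤ 1 * n := Nat.mul_le_mul_right _ (by omega)
  have hE := hN.enum ax hax
  have hLa : s.na 0 (o + ax * n + a) < n := by simpa using hSn (hE.mem a ha)
  have hLb : s.na 0 (o + ax * n + b) < n := by simpa using hSn (hE.mem b hb)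
  have hra := hS.rank ax hax _ hLa
  have hrb := hS.rank ax hax _ hLb
  have hρa := hρ _ hLa
  have hρb := hρ _ hLb
  obtain ⟨ia, hia⟩ : ∃ ia, ia = s.na 0 (o + ax * n + a) := ⟨_, rfl⟩
  obtain ⟨ib, hib⟩ : ∃ ib, ib = s.na 0 (o + ax * n + b) := ⟨_, rfl⟩
  rw [← hia] at hLa hra hρa ih ⊢
  rw [← hib] at hLb hrb hρb ih ⊢
  set S' := S.filter fun x => ρ ax ia ≤ ρ ax x ∧ ρ ax x ≤ ρ ax ib with hS'
  have hS'c : S'.card ≤ S.card := Finset.card_le_card (Finset.filter_subset _ _)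
  refine Runs.mono (T := 60 + ((S.card * 60 + 30) + ((S.card * 60 + 30) + (20 + (T + 10))))) ?_
    (by omega) fun _ h => h
  refine Runs.seq' ((Runs.straight (Q := fun s₁ => s₁.nv 46 = ρ ax ia ∧ s₁.nv 47 = ρ ax ib ∧
      s₁.nv 48 = ax * n) (by
    simp only [wp, NExp.eval_mul', NExp.eval_get', NExp.eval_var', NExp.eval_add', State.nv_setN,
      State.na_setN, h2, h3, hS.num, Nat.reduceEqDiff, if_false, if_true]
    rw [hlo (s.setN 48 (ax * n)) rfl (by simp), hhi ((s.setN 48 (ax * n)).setN 46 _) rfl (by simp),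
      ← hia, ← hib, hra, hrb]
    exact ⟨by omega, by omega, by omega, rfl, rfl, trivial⟩) (by
    simp [Cmd.cost]
    omega)).frame hpw) ?_ le_rfl
  rintro s₁ ⟨⟨a46, a47, a48⟩, hf₁⟩
  have hf₁ : Frame [192, 184, 188] s s₁ := hf₁
  have hS₁ := hS.frame hf₁ (by decide)
  have hN₁ := hN.frame hf₁ (by decide) (by decide)
  have b2 : s₁.nv 2 = o := by rw [hf₁.nv 2 (by decide), h2]
  refine Runs.seq' ((filterAxis_runs hpw (e := 0) (by decide) hax hS₁ hN₁ hSn b2 a46 a47 a48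
    (by omega)).frame hpw) ?_ le_rfl
  rintro s₂ ⟨⟨hE₂, -, c0⟩, hf₂⟩
  have hf₂ : Frame [196, 180, 200, 2, 196, 180] s₁ s₂ := hf₂
  have hS₂ := hS₁.frame hf₂ (by decide)
  have hl₂ : ∀ a, a < 6 → ∀ x, x < o + 2 * n → s₂.na a x = s.na a x := by
    intro a ha x hx
    by_cases h0 : a = 0
    · subst h0
      rw [c0 x (by omega), hf₁.na 0 (by decide)]
    · rw [hf₂.na a (by simp; omega), hf₁.na a (by simp; omega)]
  have hN₂ := hN.congr hSc (by omega) hl₂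
  refine Runs.seq' ((filterAxis_runs hpw (e := 1) (by decide) hax hS₂ hN₂ hSn
    (by rw [hf₂.nv 2 (by decide), b2]) (by rw [hf₂.nv 46 (by decide), a46])
    (by rw [hf₂.nv 47 (by decide), a47]) (by rw [hf₂.nv 48 (by decide), a48])
    (by omega)).frame hpw) ?_ le_rfl
  rintro s₃ ⟨⟨hE₃, d49, d0⟩, hf₃⟩
  have hf₃ : Frame [196, 180, 200, 2, 196, 180] s₂ s₃ := hf₃
  have hS₃ := hS₂.frame hf₃ (by decide)
  have e2 : s₃.nv 2 = o := by rw [hf₃.nv 2 (by decide), hf₂.nv 2 (by decide), b2]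
  have er : ∀ i, i < 4 → s₃.rv i = s.rv i := fun i hi => by
    rw [hf₃.rv i (by simp; omega), hf₂.rv i (by simp; omega), hf₁.rv i (by simp; omega)]
  have hl₃ : ∀ a, a < 6 → ∀ x, x < o + 2 * n → s₃.na a x = s.na a x := by
    intro a ha x hx
    by_cases h0 : a = 0
    · subst h0
      rw [d0 x (by omega), hl₂ 0 ha x hx]
    · rw [hf₃.na a (by simp; omega), hl₂ a ha x hx]
  refine Runs.seq' (T' := T + 10) ((Runs.straight (Q := fun s₄ => s₄ =
      (s₃.putN 2 (o + 2 * n) S'.card).setN 2 (o + 2 * n)) (by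
    simp [wp, e2, hS₃.num, d49, ← hS']
    omega) (Nat.le_of_ble_eq_true rfl)).frame hpw) ?_ le_rfl
  rintro s₄ ⟨hs₄, hf₄⟩
  have hf₄ : Frame [10, 8] s₃ s₄ := hf₄
  have hS₄ := hS₃.frame hf₄ (by decide)
  have er₄ : ∀ i, i < 4 → s₄.rv i = s.rv i := fun i hi => by
    rw [hf₄.rv i (by simp; omega), er i hi]
  have hN₄ : SetNode n ρ S' (o + 2 * n) s₄ := by
    refine ⟨by simp [hs₄], fun e he => ?_⟩
    rw [hf₄.na 0 (by decide)]
    interval_cases e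
    · refine hE₂.congr fun i hi => ?_
      rw [← hS'] at hi
      exact d0 _ (by omega)
    · exact hE₃
  have hl₄ : ∀ a, a < 6 → ∀ x, x < o + 2 * n → s₄.na a x = s.na a x := by
    intro a ha x hx
    rw [← hl₃ a ha x hx]
    simp [hs₄]
    omega
  refine Runs.seq' (T' := 10) ((ih s₄ hS₄ hN₄ (by simp [hs₄]) (by
    rw [er₄ 0 (by decide), er₄ 1 (by decide), er₄ 2 (by decide), er₄ 3 (by decide)]
    exact hg)).frame hpw) ?_ le_rfl
  rintro s₅ ⟨hP, hf₅⟩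
  have hf₅ : Frame setWrites s₄ s₅ := hpw1 ▸ hf₅
  have hS₅ := hS₄.frame hf₅ setWrites_avoids
  refine ((Runs.straight (Q := fun s₆ => s₆ = s₅.setN 2 o) (by
    simp [wp, hP.base, hS₅.num]
    omega) (Nat.le_of_ble_eq_true rfl)).frame hpw).mono le_rfl ?_
  rintro s₆ ⟨rfl, hf₆⟩
  have hf₆ : Frame [8] s₅ (s₅.setN 2 o) := hf₆
  refine ⟨⟨⟨hP.best.good, ?_, hP.best.bound⟩, by simp, fun a ha x hx => ?_⟩,
    hS₅.frame hf₆ (by decide)⟩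
  · have := hP.best.le
    simpa only [halfPerim, State.rv_setN, er₄ 0 (by decide), er₄ 1 (by decide), er₄ 2 (by decide),
      er₄ 3 (by decide)] using this
  · rw [← hl₄ a ha x hx]
    exact hP.low a ha x hx

omit hpw1 in
theorem solveSet_leaf_runs {o : ℕ} {S : Finset ℕ} {s : State} (hpr0 : pr[0]? = some solveNode)
    (hpw0 : pw 0 = solveWrites) (hS : SetStatic n k c ρ s) (hN : SetNode n ρ S o s)
    (hSn : S ⊆ Finset.range n) (h2 : s.nv 2 = o) (hk : 1 ≤ k) (hkS : k ≤ S.card)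
    (hSk : S.card < 28800 * k) (hrk : ∀ e, e < 2 → IsRanking (c e) n (ρ e))
    (hB : (n + 4) * ((4 * n + 1) * (4 * n + 1)) ≤ B)
    (hg : IsGood c n k (s.rv 0) (s.rv 1) (s.rv 2) (s.rv 3)) :
    Runs pr B solveSet s (1000000 * (S.card ^ 2 * (Nat.log 2 (2 * S.card) + 1)) + 10)
      (SetPost c n k S o o s) := by
  have hSc : S.card ≤ n := by simpa using Finset.card_le_card hSn
  refine (Runs.cond (T := 1000000 * (S.card ^ 2 * (Nat.log 2 (2 * S.card) + 1))) ?_ ?_).mono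
    (by simp [BExp.size]; omega) fun _ h => h
  · intro _
    refine ((solveLeaf_runs hpw (o := o) hpr0 hk (by omega) hSn hS.num hS.goal h2
      (hS.coord 0 (by decide)) (hS.coord 1 (by decide)) (hrk 0 (by decide)) (hrk 1 (by decide))
      hN.card (by simpa using hN.enum 0 (by decide)) (by simpa using hN.enum 1 (by decide))
      (le_trans (by gcongr) hB) hg).frame hpw).mono le_rfl ?_
    rintro s' ⟨hP, hf⟩
    have hf := hf.mono (solveLeaf_writes hpw0)
    refine ⟨hP, by rw [hf.nv 2 (by decide), h2], fun a ha x _ => ?_⟩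
    interval_cases a
    · rw [hf.na 0 (by decide)]
    · rw [hf.na 1 (by decide)]
    · rw [hf.na 2 (by decide)]
    · rw [hf.na 3 (by decide)]
    · rw [hf.na 4 (by decide)]
    · rw [hf.na 5 (by decide)]
  · intro hb
    exfalso
    apply hb
    simp [hS.goal, h2, hN.card]
    omega

omit hpw hpw1 in
theorem setPoint_runs {o q : ℕ} {S : Finset ℕ} {s : State} (hk : 1 ≤ k) (hS : SetStatic n k c ρ s)
    (hSn : S ⊆ Finset.range n) (h2 : s.nv 2 = o) (h40 : s.nv 40 = q)
    (hg : IsGood c n k (s.rv 0) (s.rv 1) (s.rv 2) (s.rv 3))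
    (hq : k ≤ rectCount c S (c 0 (s.na 0 (o + q))) (c 0 (s.na 0 (o + q)))
      (c 1 (s.na 0 (o + n + q))) (c 1 (s.na 0 (o + n + q)))) :
    Runs pr B setPoint s 40 (SetPost c n k S o o s) := by
  refine Runs.straight ?_ (Nat.le_of_ble_eq_true rfl)
  simp only [setPoint, wp, RExp.eval_get', NExp.eval_get', NExp.eval_add', NExp.eval_var',
    RExp.eval_var', State.nv_setR, State.na_setR, State.ra_setR, h2, h40, hS.num,
    hS.coord 0 (by decide), hS.coord 1 (by decide)]
  refine ⟨⟨?_, ?_, ?_⟩, by simp [h2], fun a ha x _ => rfl⟩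
  · simp
    exact ⟨le_rfl, le_rfl, hq.trans (rectCount_mono hSn _ _ _ _)⟩
  · have h1 := hg.hx
    have h2 := hg.hy
    simp [halfPerim]
    linarith
  · simpa [halfPerim] using isLowerBound_zero hk S

/-- The time bound is left abstract as a function `F` with the two inequalities that the recursion
needs. The bound on `o` pays for memory: a child starts `2 n` addresses further and has at least one
point less. -/
theorem solveSet_runs (hpr0 : pr[0]? = some solveNode) (hpr1 : pr[1]? = some solveSet)
    (hpw0 : pw 0 = solveWrites) (hk : 1 ≤ k) (hrk : ∀ e, e < 2 → IsRanking (c e) n (ρ e))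
    (hρ : ∀ e, e < 2 → ∀ x, x < n → ρ e x < n)
    (hB : (n + 4) * ((4 * n + 1) * (4 * n + 1)) ≤ B) (F : ℕ → ℕ)
    (hleaf : ∀ m, 3600 * k ≤ m → m < 28800 * k →
      1000000 * (m ^ 2 * (Nat.log 2 (2 * m) + 1)) + 11 ≤ F m)
    (hsplit : ∀ m l r d, 28800 * k ≤ m → (d - 1) * (d - 1) ≤ 32 * m * k → l + r = m + d →
      m ≤ 10 * l → m ≤ 10 * r → 10 * l ≤ 9 * m → 10 * r ≤ 9 * m → 3600 * k ≤ l → 3600 * k ≤ r →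
      F l + F r + 1000 * m ≤ F m)
    (m : ℕ) : ∀ (S : Finset ℕ) (o : ℕ) (s : State), S.card = m → 3600 * k ≤ m →
      SetStatic n k c ρ s → SetNode n ρ S o s → S ⊆ Finset.range n → s.nv 2 = o →
      o + 2 * n * m ≤ 2 * n * n → IsGood c n k (s.rv 0) (s.rv 1) (s.rv 2) (s.rv 3) →
      Runs pr B (.call 1) s (F m) (SetPost c n k S o o s) := by
  induction m using Nat.strong_induction_on with
  | _ m ih =>
  intro S o s hm hkm hS hN hSn h2 ho hg
  by_cases hmk : m < 28800 * k
  · have := solveSet_leaf_runs hpw (c := c) (ρ := ρ) (k := k) hpr0 hpw0 hS hN hSn h2 hk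
      (by omega) (by omega) hrk hB hg
    rw [hm] at this
    exact (Runs.call hpr1 this).mono (hleaf m hkm hmk) fun _ h => h
  have hmk' : 28800 * k ≤ m := by omega
  have hSc : m ≤ n := by
    rw [← hm]
    simpa using Finset.card_le_card hSn
  have hB1 : 2 * n * n + 3 * n ≤ B := by nlinarith
  have ho1 : o + 2 * n ≤ 2 * n * n := by
    have : 2 * n * 1 ≤ 2 * n * m := Nat.mul_le_mul_left _ (by omega)
    omega
  set L : ℕ → ℕ → ℕ := fun e i => s.na 0 (o + e * n + i) with hL
  have hE : ∀ e, e < 2 → IsEnum (L e) S (ρ e) := fun e he => hN.enum e he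
  have hmono : ∀ e, e < 2 → ∀ i j, i ≤ j → j < m → c e (L e i) ≤ c e (L e j) :=
    fun e he i j hij hj => (hE e he).key_mono (hrk e he) hSn hij (by omega)
  have hnode : ∃ T, 1000 * m + T ≤ F m ∧
      Runs pr B solveSet s (T + 900 * m) (SetPost c n k S o o s) := by
    have hsz : (BExp.not (.nle (28800 * nvar 1) (.get 2 (nvar 2)))).size = 7 := rfl
    obtain ⟨s₁, t₁, hx₁, ht₁, ⟨d, D, h20, hd, hd', a3, a40, hI, hD, n3, n4, n5, hlow⟩, hf₁⟩ :=
      (splitNode_runs (B := B) hpw hS hN h2 hm hk hmk' (by omega)).frame hpw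
    have hf₁ : Frame [12, 160, 164, 164, 168, 172, 17, 180, 200, 21, 17, 168, 172, 180, 180, 200, 21,
      17, 168, 172, 180, 14, 18, 22] s s₁ := hf₁
    have hS₁ := hS.frame hf₁ (by decide)
    have hN₁ := hN.frame hf₁ (by decide) (by decide)
    have b2 : s₁.nv 2 = o := by rw [hf₁.nv 2 (by decide), h2]
    have bn : s₁.na 0 = s.na 0 := hf₁.na 0 (by decide)
    have er : ∀ i, i < 4 → s₁.rv i = s.rv i := fun i hi => hf₁.rv i (by simp; omega)
    have hg₁ : IsGood c n k (s₁.rv 0) (s₁.rv 1) (s₁.rv 2) (s₁.rv 3) := by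
      rw [er 0 (by decide), er 1 (by decide), er 2 (by decide), er 3 (by decide)]
      exact hg
    have hhp : halfPerim s₁ = halfPerim s := by
      simp only [halfPerim, er 0 (by decide), er 1 (by decide), er 2 (by decide), er 3 (by decide)]
    obtain ⟨ax, hax⟩ : ∃ ax, ax = s₁.nv 42 := ⟨_, rfl⟩
    obtain ⟨p, hp⟩ : ∃ p, p = s₁.nv 43 := ⟨_, rfl⟩
    obtain ⟨g, hgap⟩ : ∃ g, g = s₁.rv 4 := ⟨_, rfl⟩
    obtain ⟨i1, i2, i3, i4, i5⟩ := hI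
    rw [← hax] at i1 i4 n3
    rw [← hp] at i2 i3 i4 n4
    rw [← hgap] at i4 i5
    have hgm : ∀ e, e < 2 → ∀ i, m / 8 ≤ i → i + d + m / 8 < m →
        c e (L e (i + d)) - c e (L e i) ≤ g := fun e he i h1 h2 => i5 e i (hD e i he h1 h2)
    have hd1 : 1 ≤ d := by
      by_contra! h
      obtain rfl : d = 0 := by omega
      have : 0 < m * k := Nat.mul_pos (by omega) (by omega)
      rw [Nat.mul_assoc] at hd
      omega
    have hcond : ¬ (BExp.not (.nle (28800 * nvar 1) (.get 2 (nvar 2)))).eval s := by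
      simp [hS.goal, h2, hN.card, hm]
      omega
    have hrun : ∀ T, Runs pr B (.cond (.rle (rvar 4) 0) setPoint
        (childSet 0 (.get 4 (nvar 2) + .get 5 (nvar 2) - 1) ;;
          childSet (.get 4 (nvar 2)) (.get 2 (nvar 2) - 1))) s₁ T (SetPost c n k S o o s) →
        Runs pr B solveSet s (m * 200 + 200 + T + 10) (SetPost c n k S o o s) := fun T hT =>
      (Runs.cond (T := m * 200 + 200 + T) (fun hb => absurd hb hcond) fun _ =>
        Runs.seq' (Q' := fun s' => s' = s₁) ⟨s₁, t₁, hx₁, ht₁, rfl⟩ (fun s' h => h ▸ hT)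
          le_rfl).mono (by rw [hsz]; omega) fun _ h => h
    have hpost : ∀ s', SetPost c n k S o o s₁ s' → SetPost c n k S o o s s' := fun s' h =>
      ⟨⟨h.best.good, h.best.le.trans hhp.le, h.best.bound⟩, h.base, fun a ha x hx => by
        rw [h.low a ha x hx, hlow a ha x hx]⟩
    -- The gap keeps a margin of `m / 8` on both sides, so each part has between a tenth and nine
    -- tenths of the points. It also has at least `28800 k / 8 = 3600 k` of them.
    have hFm : F (p + d) + F (m - p) + 1000 * m ≤ F m :=
      hsplit m (p + d) (m - p) d hmk' hd' (by omega) (by omega) (by omega) (by omega) (by omega)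
        (by omega) (by omega)
    refine ⟨F (p + d) + F (m - p), by omega, ?_⟩
    refine (hrun (F (p + d) + F (m - p) + (m * 240 + 410)) ?_).mono (by omega) fun _ h => h
    refine (Runs.cond (T := F (p + d) + F (m - p) + (m * 240 + 400)) ?_ ?_).mono
      (by rw [show (BExp.rle (rvar 4) 0).size = 3 from rfl]; omega) hpost
    · intro hb
      have hg0 : g ≤ 0 := by
        rw [hgap]
        simpa using hb
      refine (setPoint_runs hk hS₁ hSn b2 a40 hg₁ ?_).mono (by omega) fun _ h => h
      have := le_rectCount_of_gap_nonpos hm rfl hE hmono hk hmk' hd (by omega) hgm hg0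
      rw [bn]
      simpa [hL] using this
    · intro hb
      have hg0 : 0 < g := by
        rw [hgap]
        simpa using hb
      have hsmall := exists_small_rect hm rfl hE hmono hk hmk' hd (by omega) hgm hg0
      have hEc : ∀ e i, s₁.na 0 (o + e * n + i) = L e i := fun e i => by rw [bn]
      have c1 : (S.filter fun x => ρ ax (L ax 0) ≤ ρ ax x ∧ ρ ax x ≤ ρ ax (L ax (p + d - 1))).card =
          p + d := by
        rw [(hE ax i1).card_filter_Icc (by omega) (by omega)]
        omega
      have c2 : (S.filter fun x => ρ ax (L ax p) ≤ ρ ax x ∧ ρ ax x ≤ ρ ax (L ax (m - 1))).card =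
          m - p := by
        rw [(hE ax i1).card_filter_Icc (by omega) (by omega)]
        omega
      have hoc : ∀ m', m' < m → o + 2 * n + 2 * n * m' ≤ 2 * n * n := fun m' hm' => by
        have : 2 * n * (m' + 1) ≤ 2 * n * m := Nat.mul_le_mul_left _ hm'
        rw [Nat.mul_add] at this
        omega
      refine Runs.seq' (childSet_runs hpw hpw1 (T := F (p + d)) (ax := ax) (a := 0)
        (b := p + d - 1) hS₁ hN₁ hSn b2 i1 n3 (fun _ _ _ => rfl)
        (fun s' h1 h2 => by simp [h1, h2, b2, n4, n5]) (by decide) (by decide) (by omega) (by omega)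
        (hρ ax i1) (by omega) hg₁ ?_) ?_ (T' := m * 120 + F (m - p) + 200) (by omega)
      · intro s₂ hS₂ hN₂ b2' hg₂
        simp only [hEc] at hN₂ ⊢
        exact ih (p + d) (by omega) _ _ s₂ c1 (by omega) hS₂ hN₂
          ((Finset.filter_subset _ _).trans hSn) b2' (hoc _ (by omega)) hg₂
      · rintro s₂ ⟨hP₂, hS₂⟩
        simp only [hEc] at hP₂
        have hN₂ := hN₁.congr (by omega) (by omega) hP₂.low
        have hEc₂ : ∀ e i, e < 2 → i < m → s₂.na 0 (o + e * n + i) = L e i := fun e i he hi => by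
          have : e * n ≤ 1 * n := Nat.mul_le_mul_right _ (by omega)
          rw [hP₂.low 0 (by decide) _ (by omega), hEc]
        refine (childSet_runs hpw hpw1 (T := F (m - p)) (ax := ax) (a := p)
          (b := m - 1) hS₂ hN₂ hSn hP₂.base i1 (by rw [hP₂.low 3 (by decide) o (by omega), n3])
          (fun s' h1 h2 => by
            simp [h1, h2, hP₂.base, hP₂.low 4 (by decide) o (by omega), n4])
          (fun s' h1 h2 => by
            simp [h1, h2, hP₂.base, hN₂.card, hm]) (by decide) (by decide) (by omega) (by omega)
          (hρ ax i1) (by omega) hP₂.best.good ?_).mono (by omega) ?_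
        · intro s₃ hS₃ hN₃ b2' hg₃
          rw [hEc₂ ax p i1 (by omega), hEc₂ ax (m - 1) i1 (by omega)] at hN₃ ⊢
          exact ih (m - p) (by omega) _ _ s₃ c2 (by omega) hS₃ hN₃
            ((Finset.filter_subset _ _).trans hSn) b2' (hoc _ (by omega)) hg₃
        · rintro s₃ ⟨hP₃, -⟩
          rw [hEc₂ ax p i1 (by omega), hEc₂ ax (m - 1) i1 (by omega)] at hP₃
          refine ⟨⟨hP₃.best.good, hP₃.best.le.trans hP₂.best.le, ?_⟩, hP₃.base, fun a ha x hx => by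
            rw [hP₃.low a ha x (by omega), hP₂.low a ha x (by omega)]⟩
          -- The lower bound from the first part persists because the second call can only improve
          -- the rectangle.
          refine isLowerBound_of_split i1 (hE ax i1).surj (fun i j hij hj => hmono ax i1 i j hij
            (by omega)) i4.le ?_ ?_ hsmall (hP₂.best.bound.mono hP₃.best.le) hP₃.best.bound
          · intro i hi
            exact Finset.mem_filter.2 ⟨(hE ax i1).mem i (by omega),
              (hE ax i1).rank_mono (by omega) (by omega), (hE ax i1).rank_mono (by omega) (by omega)⟩
          · intro i hi hi'
            exact Finset.mem_filter.2 ⟨(hE ax i1).mem i (by omega),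
              (hE ax i1).rank_mono (by omega) (by omega), (hE ax i1).rank_mono (by omega) (by omega)⟩
  obtain ⟨T, hT, h⟩ := hnode
  exact (Runs.call hpr1 h).mono (by omega) fun _ h => h

end

end RealRAM

/-! ### Analysis of the running time. -/

section TimeBound

/-- The weight of a node with `m` points in the analysis of the recursion on point sets. -/
noncomputable def nodeWeight (k m : ℕ) : ℝ := 2 * m - 60 * (√m * √k)

/-- For `m ≥ 3600 k` one has `60 √k ≤ √m`, so the correction term costs at most half of `2 m`. -/
theorem le_nodeWeight {k m : ℕ} (h : 3600 * k ≤ m) : (m : ℝ) ≤ nodeWeight k m := by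
  have h1 : (3600 * k : ℝ) ≤ m := by exact_mod_cast h
  have h2 : 60 * √(k : ℝ) ≤ √m := by
    rw [show (60 : ℝ) = √3600 by rw [show (3600 : ℝ) = 60 ^ 2 by norm_num]; simp,
      ← Real.sqrt_mul (by norm_num)]
    exact Real.sqrt_le_sqrt h1
  have h3 : √(m : ℝ) * √m = m := Real.mul_self_sqrt (by positivity)
  have h4 : 0 ≤ √(m : ℝ) := Real.sqrt_nonneg _
  unfold nodeWeight
  nlinarith

theorem nodeWeight_le {k m : ℕ} : nodeWeight k m ≤ 2 * m := by
  have : 0 ≤ √(m : ℝ) * √k := by positivity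
  unfold nodeWeight
  linarith

/-- The overlap raises `2 m` by `2 d ≤ 12 √(mk)`. A balanced split gains on the concave term: `√l +
√r ≥ (6/5) √m`, and `60 * (1/5) = 12` pays for it exactly. -/
theorem nodeWeight_split {k m l r d : ℕ} (hk : 1 ≤ k) (hkm : 28800 * k ≤ m)
    (hd : (d - 1) * (d - 1) ≤ 32 * m * k) (hlr : l + r = m + d) (hl : m ≤ 10 * l)
    (hl' : 10 * l ≤ 9 * m) (hr : m ≤ 10 * r) : nodeWeight k l + nodeWeight k r ≤ nodeWeight k m := by
  have h0 : 0 ≤ √(m : ℝ) := Real.sqrt_nonneg _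
  have h0k : 0 ≤ √(k : ℝ) := Real.sqrt_nonneg _
  have h0l : 0 ≤ √(l : ℝ) := Real.sqrt_nonneg _
  have h0r : 0 ≤ √(r : ℝ) := Real.sqrt_nonneg _
  have e1 : √(m : ℝ) * √m = m := Real.mul_self_sqrt (by positivity)
  have e2 : √(k : ℝ) * √k = k := Real.mul_self_sqrt (by positivity)
  have e3 : √(l : ℝ) * √l = l := Real.mul_self_sqrt (by positivity)
  have e4 : √(r : ℝ) * √r = r := Real.mul_self_sqrt (by positivity)
  have hlr' : (l : ℝ) + r = m + d := by exact_mod_cast hlr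
  have hl1 : (m : ℝ) ≤ 10 * l := by exact_mod_cast hl
  have hl2 : 10 * (l : ℝ) ≤ 9 * m := by exact_mod_cast hl'
  have hr1 : (m : ℝ) ≤ 10 * r := by exact_mod_cast hr
  have hd0 : (0 : ℝ) ≤ d := by positivity
  have hk1 : (1 : ℝ) ≤ k := by exact_mod_cast hk
  have hkm' : 28800 * (k : ℝ) ≤ m := by exact_mod_cast hkm
  have hp : 10 ≤ √(m : ℝ) * √k := by
    rw [← Real.sqrt_mul (by positivity)]
    refine Real.le_sqrt_of_sq_le ?_
    nlinarith
  -- Since `y = √(mk) ≥ 10`, `d > 6 y` would give `d - 1 > 5.9 y`, but `5.9² > 32`.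
  have hd6 : (d : ℝ) ≤ 6 * (√m * √k) := by
    have h1 : ((d : ℝ) - 1) * (d - 1) ≤ 32 * (m * k) ∨ d = 0 := by
      rcases Nat.eq_zero_or_pos d with h | h
      · exact Or.inr h
      · left
        have : (((d - 1) * (d - 1) : ℕ) : ℝ) ≤ ((32 * m * k : ℕ) : ℝ) := by exact_mod_cast hd
        push_cast [Nat.cast_sub h] at this
        linarith
    rcases h1 with h1 | rfl
    · have h2 : (m : ℝ) * k = (√m * √k) * (√m * √k) := by
        calc (m : ℝ) * k = (√m * √m) * (√k * √k) := by rw [e1, e2]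
          _ = _ := by ring
      rw [h2] at h1
      generalize √(m : ℝ) * √k = y at *
      by_contra! h3
      have h4 := mul_self_lt_mul_self (a := 59 / 10 * y) (b := d - 1) (by linarith) (by linarith)
      have h5 := mul_self_nonneg y
      linarith
    · simp
      positivity
  -- Squaring, from `l r ≥ 0.09 m²`: the right side gives at least `m + 0.6 m`, more than `1.44 m`.
  have hsum : 6 / 5 * √(m : ℝ) ≤ √l + √r := by
    have h1 : 9 / 100 * (m : ℝ) * m ≤ l * r := by
      have h2 := mul_nonneg (sub_nonneg.2 hl1) (sub_nonneg.2 hl2)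
      have h3 : 0 ≤ (l : ℝ) * (r - (m - l)) := mul_nonneg (by positivity) (by linarith)
      linarith
    have h2 : 3 / 10 * (m : ℝ) ≤ √l * √r := by
      rw [← Real.sqrt_mul (by positivity)]
      refine Real.le_sqrt_of_sq_le ?_
      linarith
    by_contra! h3
    have h4 := mul_self_lt_mul_self (add_nonneg h0l h0r) h3
    linarith
  have hw := mul_le_mul_of_nonneg_right hsum h0k
  unfold nodeWeight
  linarith

/-- The time bound for a node with `m` points. -/
noncomputable def nodeTime (k m : ℕ) : ℕ :=
  ⌊(10000 * Real.log m + (28800000000 * k * (Nat.log 2 (57600 * k) + 1) + 11 : ℕ)) *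
    nodeWeight k m⌋₊

/-- One factor `m` of the quadratic cost is bounded by `28800 k`, which leaves a cost of `O(k log
k)` per point. -/
theorem leaf_le {k m : ℕ} (hm : 1 ≤ m) (h : m < 28800 * k) :
    1000000 * (m ^ 2 * (Nat.log 2 (2 * m) + 1)) + 11 ≤
      (28800000000 * k * (Nat.log 2 (57600 * k) + 1) + 11) * m := by
  have h1 : Nat.log 2 (2 * m) ≤ Nat.log 2 (57600 * k) := Nat.log_mono_right (by omega)
  have h2 : m ^ 2 * (Nat.log 2 (2 * m) + 1) ≤ 28800 * k * m * (Nat.log 2 (57600 * k) + 1) := by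
    refine Nat.mul_le_mul ?_ (by omega)
    rw [pow_two]
    exact Nat.mul_le_mul_right _ h.le
  have h3 : (28800000000 * k * (Nat.log 2 (57600 * k) + 1) + 11) * m =
      1000000 * (28800 * k * m * (Nat.log 2 (57600 * k) + 1)) + 11 * m := by ring
  omega

theorem leaf_le_nodeTime {k m : ℕ} (hk : 1 ≤ k) (hkm : 3600 * k ≤ m) (h : m < 28800 * k) :
    1000000 * (m ^ 2 * (Nat.log 2 (2 * m) + 1)) + 11 ≤ nodeTime k m := by
  refine (leaf_le (by omega) h).trans (Nat.le_floor ?_)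
  push_cast
  refine mul_le_mul ?_ (le_nodeWeight hkm) (by positivity) ?_
  · have : 0 ≤ Real.log m := Real.log_natCast_nonneg m
    linarith
  · have : 0 ≤ Real.log m := Real.log_natCast_nonneg m
    positivity

/-- Each part has at most `9 m / 10` points, so its logarithm is smaller by `1/10`. This frees
`1000` units per unit of weight, at least `1000 m` for the work at the node. -/
theorem nodeTime_split {k m l r d : ℕ} (hk : 1 ≤ k) (hkm : 28800 * k ≤ m)
    (hd : (d - 1) * (d - 1) ≤ 32 * m * k) (hlr : l + r = m + d) (hl : m ≤ 10 * l)
    (hr : m ≤ 10 * r) (hl' : 10 * l ≤ 9 * m) (hr' : 10 * r ≤ 9 * m) (hl3 : 3600 * k ≤ l)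
    (hr3 : 3600 * k ≤ r) : nodeTime k l + nodeTime k r + 1000 * m ≤ nodeTime k m := by
  have hG := nodeWeight_split hk hkm hd hlr hl hl' hr
  have hGm := le_nodeWeight (k := k) (m := m) (by omega)
  have hGl := le_nodeWeight hl3
  have hGr := le_nodeWeight hr3
  have hm0 : (0 : ℝ) < m := by exact_mod_cast (by omega : 0 < m)
  have hlog : ∀ x : ℕ, 1 ≤ x → 10 * x ≤ 9 * m → Real.log x ≤ Real.log m - 1 / 10 := by
    intro x hx hx'
    have hx0 : (0 : ℝ) < x := by exact_mod_cast hx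
    have h1 := Real.log_le_sub_one_of_pos (div_pos hx0 hm0)
    rw [Real.log_div hx0.ne' hm0.ne'] at h1
    have h2 : (x : ℝ) / m ≤ 9 / 10 := by
      rw [div_le_iff₀ hm0]
      have : 10 * (x : ℝ) ≤ 9 * m := by exact_mod_cast hx'
      linarith
    linarith
  have h1 := hlog l (by omega) hl'
  have h2 := hlog r (by omega) hr'
  have h3 : 0 ≤ Real.log l := Real.log_natCast_nonneg l
  have h4 : 0 ≤ Real.log r := Real.log_natCast_nonneg r
  have h5 : 0 ≤ Real.log m := Real.log_natCast_nonneg m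
  unfold nodeTime
  set D : ℕ := 28800000000 * k * (Nat.log 2 (57600 * k) + 1) + 11 with hD
  have hD0 : (0 : ℝ) ≤ D := by positivity
  have hl0 : (0 : ℝ) ≤ l := by positivity
  have hr0 : (0 : ℝ) ≤ r := by positivity
  refine Nat.le_floor ?_
  push_cast
  have f1 := Nat.floor_le (a := (10000 * Real.log l + D) * nodeWeight k l)
    (mul_nonneg (by positivity) (by linarith))
  have f2 := Nat.floor_le (a := (10000 * Real.log r + D) * nodeWeight k r)
    (mul_nonneg (by positivity) (by linarith))
  have g1 : (10000 * Real.log l + D) * nodeWeight k l ≤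
      (10000 * Real.log m - 1000 + D) * nodeWeight k l :=
    mul_le_mul_of_nonneg_right (by linarith) (by linarith)
  have g2 : (10000 * Real.log r + D) * nodeWeight k r ≤
      (10000 * Real.log m - 1000 + D) * nodeWeight k r :=
    mul_le_mul_of_nonneg_right (by linarith) (by linarith)
  have g3 : (10000 * Real.log m - 1000 + D) * (nodeWeight k l + nodeWeight k r) ≤
      (10000 * Real.log m - 1000 + D) * nodeWeight k m :=
    mul_le_mul_of_nonneg_left hG (by linarith)
  nlinarith

theorem natLog_le {x : ℕ} : (Nat.log 2 x : ℝ) ≤ 3 / 2 * Real.log x := by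
  have h1 := Real.natLog_le_logb x 2
  have h2 := Real.log_two_gt_d9
  have h3 : 0 ≤ Real.log x := Real.log_natCast_nonneg x
  refine h1.trans ?_
  rw [Real.logb, Nat.cast_ofNat, div_le_iff₀ (by linarith)]
  nlinarith

/-- The total running time of the algorithm. -/
theorem total_time_le {n k : ℕ} (hk : 2 ≤ k) (hkn : k ≤ n) :
    ((2 * (n * (Nat.log 2 (2 * n) * 48 + 110) + 18) + 60 : ℕ) : ℝ) +
      (10000 * Real.log n + (28800000000 * k * (Nat.log 2 (57600 * k) + 1) + 11 : ℕ)) * (2 * n) ≤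
      10000000000000 * (n * Real.log n + n * k * Real.log k + 1) := by
  have hn0 : (2 : ℝ) ≤ n := by exact_mod_cast (by omega : 2 ≤ n)
  have hk0 : (2 : ℝ) ≤ k := by exact_mod_cast hk
  have hlog2 := Real.log_two_gt_d9
  have hlog2' := Real.log_two_lt_d9
  have hn : Real.log 2 ≤ Real.log n := Real.log_le_log (by norm_num) hn0
  have hk' : Real.log 2 ≤ Real.log k := Real.log_le_log (by norm_num) hk0
  have h1 : (Nat.log 2 (2 * n) : ℝ) ≤ 3 * Real.log n := by
    refine natLog_le.trans ?_
    push_cast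
    rw [Real.log_mul (by norm_num) (by positivity)]
    linarith
  have h2 : (Nat.log 2 (57600 * k) : ℝ) + 1 ≤ 30 * Real.log k := by
    -- `57600 ≤ 2 ^ 16`. Because `k ≥ 2`, additive constants are absorbed by multiples of `log k`.
    have h3 : Real.log 57600 ≤ 16 * Real.log 2 := by
      rw [← Real.log_rpow (by norm_num)]
      exact Real.log_le_log (by norm_num) (by norm_num)
    have h4 := natLog_le (x := 57600 * k)
    push_cast at h4
    rw [Real.log_mul (by norm_num) (by positivity)] at h4
    linarith
  push_cast
  have h3 : (n : ℝ) * (Nat.log 2 (2 * n) * 48 + 110) ≤ n * (304 * Real.log n) :=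
    mul_le_mul_of_nonneg_left (by linarith) (by positivity)
  have h4 : (n : ℝ) * (k * (Nat.log 2 (57600 * k) + 1)) ≤ n * (k * (30 * Real.log k)) :=
    mul_le_mul_of_nonneg_left (mul_le_mul_of_nonneg_left h2 (by positivity)) (by positivity)
  have h5 : (n : ℝ) ≤ 2 * (n * Real.log n) := by nlinarith
  have h6 : 0 ≤ (n : ℝ) * k * Real.log k := by
    have : 0 ≤ Real.log k := by linarith
    positivity
  linarith

end TimeBound

/-! ### The main program. -/

namespace RealRAM

theorem IsSorting.isEnum {key : ℕ → ℝ} {n : ℕ} {L R : ℕ → ℕ} (h : IsSorting key n L R) :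
    IsEnum L (Finset.range n) R where
  mem i hi := by simpa using h.lt i (by simpa using hi)
  surj x hx := by
    rw [Finset.mem_range] at hx
    exact ⟨R x, by simpa using h.rank_lt x hx, h.list_rank x hx⟩
  lt i j hij hj := by
    rw [Finset.card_range] at hj
    rwa [h.rank_list i (by omega), h.rank_list j hj]

theorem IsSorting.isRanking {key : ℕ → ℝ} {n : ℕ} {L R : ℕ → ℕ} (h : IsSorting key n L R) :
    IsRanking key n R := fun x y hx hy hxy => by
  have := h.mono (R x) (R y) hxy (h.rank_lt y hy)
  rwa [h.list_rank x hx, h.list_rank y hy] at this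

theorem IsSorting.congr {key : ℕ → ℝ} {n : ℕ} {L R L' R' : ℕ → ℕ} (h : IsSorting key n L R)
    (hL : ∀ j, j < n → L' j = L j) (hR : ∀ j, j < n → R' j = R j) : IsSorting key n L' R' where
  lt j hj := by
    rw [hL j hj]
    exact h.lt j hj
  rank_lt x hx := by
    rw [hR x hx]
    exact h.rank_lt x hx
  rank_list j hj := by
    rw [hL j hj, hR _ (h.lt j hj), h.rank_list j hj]
  list_rank x hx := by
    rw [hR x hx, hL _ (h.rank_lt x hx), h.list_rank x hx]
  mono i j hij hj := by
    rw [hL i (by omega), hL j hj]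
    exact h.mono i j hij hj

/-- Start with the bounding box of all points. -/
def initBox : Cmd :=
  .rset 0 (.get 0 (.get 0 0)) ;; .rset 1 (.get 0 (.get 0 (nvar 0 - 1))) ;;
  .rset 2 (.get 1 (.get 0 (nvar 0))) ;; .rset 3 (.get 1 (.get 0 (nvar 0 + (nvar 0 - 1)))) ;;
  .nput 2 0 (nvar 0) ;; .nset 2 0

/-- Output the first point. -/
def firstPoint : Cmd :=
  .rset 0 (.get 0 0) ;; .rset 1 (.get 0 0) ;; .rset 2 (.get 1 0) ;; .rset 3 (.get 1 0)

/-- The main command. -/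
def solve : Cmd :=
  .cond (.nle (nvar 1) 0) .skip
    (.cond (.nle (nvar 1) 1) firstPoint
      (sortPoints 0 ;; sortPoints 1 ;; initBox ;; .call 1))

/-- The program. -/
def solver : Program := ⟨solve, [solveNode, solveSet]⟩

/-- What the procedures of `solver` modify. -/
def solverWrites (j : ℕ) : List ℕ := if j = 0 then solveWrites else if j = 1 then setWrites else []

theorem writesOK_solver : WritesOK [solveNode, solveSet] solverWrites := by
  intro j c hj
  match j with
  | 0 =>
    obtain rfl : solveNode = c := by simpa using hj
    exact solveNode_writes rfl
  | 1 =>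
    obtain rfl : solveSet = c := by simpa using hj
    exact solveSet_writes rfl rfl
  | j + 2 => simp at hj

/-- The recursion only ever improves a rectangle that is already valid. The bounding box, read off
the ends of the two sorted lists, is a valid start because `k ≤ n`. -/
theorem initBox_runs {pr : List Cmd} {B n k : ℕ} {c : ℕ → ℕ → ℝ} {ρ : ℕ → ℕ → ℕ} {s : State}
    (hn : 1 ≤ n) (hkn : k ≤ n) (hS : SetStatic n k c ρ s)
    (hs : ∀ e, e < 2 → IsSorting (c e) n (fun i => s.na 0 (e * n + i)) (ρ e)) (hB : n ≤ B) :
    Runs pr B initBox s 40 fun s' => SetStatic n k c ρ s' ∧ SetNode n ρ (Finset.range n) 0 s' ∧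
      s'.nv 2 = 0 ∧ IsGood c n k (s'.rv 0) (s'.rv 1) (s'.rv 2) (s'.rv 3) := by
  have h0 := hs 0 (by decide)
  have h1 := hs 1 (by decide)
  have hx : ∀ x, x < n → InRect c (c 0 (s.na 0 0)) (c 0 (s.na 0 (n - 1))) (c 1 (s.na 0 n))
      (c 1 (s.na 0 (n + (n - 1)))) x := by
    intro x hx
    have a1 := h0.mono 0 _ (Nat.zero_le _) (h0.rank_lt x hx)
    have a2 := h0.mono _ (n - 1) (Nat.le_sub_one_of_lt (h0.rank_lt x hx)) (by omega)
    have b1 := h1.mono 0 _ (Nat.zero_le _) (h1.rank_lt x hx)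
    have b2 := h1.mono _ (n - 1) (Nat.le_sub_one_of_lt (h1.rank_lt x hx)) (by omega)
    have a3 := h0.list_rank x hx
    have b3 := h1.list_rank x hx
    simp only [Nat.zero_mul, Nat.zero_add, Nat.one_mul, Nat.add_zero] at a1 a2 b1 b2 a3 b3
    rw [a3] at a1 a2
    rw [b3] at b1 b2
    exact ⟨⟨a1, a2⟩, b1, b2⟩
  have hcard : k ≤ rectCount c (Finset.range n) (c 0 (s.na 0 0)) (c 0 (s.na 0 (n - 1)))
      (c 1 (s.na 0 n)) (c 1 (s.na 0 (n + (n - 1)))) := by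
    rw [rectCount, Finset.filter_true_of_mem fun x h => hx x (Finset.mem_range.1 h)]
    simpa using hkn
  have h00 := hx 0 (by omega)
  refine Runs.straight ?_ (Nat.le_of_ble_eq_true rfl)
  simp only [initBox, wp, RExp.eval_get', NExp.eval_get', NExp.eval_add', NExp.eval_var',
    NExp.eval_sub', NExp.eval_ofNat, State.nv_setR, State.na_setR, State.ra_setR, hS.num,
    hS.coord 0 (by decide), hS.coord 1 (by decide), State.nv_setN, State.nv_putN]
  refine ⟨hB, by omega, ⟨by simp [hS.num], by simp [hS.goal], fun e he => ?_, fun e he x hx => ?_⟩,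
    ⟨by simp, fun e he => ?_⟩, by simp, ?_⟩
  · simpa using hS.coord e he
  · simpa using hS.rank e he x hx
  · simpa using (hs e he).isEnum
  · simp
    exact ⟨h00.1.1.trans h00.1.2, h00.2.1.trans h00.2.2, hcard⟩

theorem ncard_eq_rectCount {n : ℕ} (P : Fin n → ℝ × ℝ) (k : ℕ) (R : AxisRect) :
    {i : Fin n | P i ∈ R.toSet}.ncard =
      rectCount (State.input P k).ra (Finset.range n) R.x₁ R.x₂ R.y₁ R.y₂ := by
  rw [← Set.ncard_image_of_injective _ Fin.val_injective, rectCount, ← Set.ncard_coe_finset]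
  congr 1
  ext x
  simp only [Set.mem_image, Set.mem_ofPred_eq, Finset.coe_filter, Finset.mem_range]
  constructor
  · rintro ⟨i, hi, rfl⟩
    refine ⟨i.2, ?_⟩
    simp [InRect, State.input]
    simp only [AxisRect.toSet, Set.mem_prod, Set.mem_Icc] at hi
    exact hi
  · rintro ⟨hx, h⟩
    refine ⟨⟨x, hx⟩, ?_, rfl⟩
    simp [InRect, State.input, hx] at h
    simp only [AxisRect.toSet, Set.mem_prod, Set.mem_Icc]
    exact h

theorem exists_rect_of_isGood {n k : ℕ} {P : Fin n → ℝ × ℝ} {s : State}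
    (hg : IsGood (State.input P k).ra n k (s.rv 0) (s.rv 1) (s.rv 2) (s.rv 3))
    (hb : IsLowerBound (State.input P k).ra k (Finset.range n) (halfPerim s)) :
    ∃ R : AxisRect, s.Outputs R ∧ R.IsSmallestPerimeter P k := by
  refine ⟨⟨_, _, _, _, hg.hx, hg.hy⟩, ⟨rfl, rfl, rfl, rfl⟩, ?_, ?_⟩
  · rw [AxisRect.Encloses, ncard_eq_rectCount P k]
    exact hg.card
  · intro R' hR'
    rw [AxisRect.Encloses, ncard_eq_rectCount P k] at hR'
    have := hb _ _ _ _ hR'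
    simp only [AxisRect.perimeter]
    unfold halfPerim at this
    linarith

theorem solve_runs {n k : ℕ} (P : Fin n → ℝ × ℝ) (hk : 2 ≤ k) (hkn : k ≤ n) :
    Runs [solveNode, solveSet] ((n + 2) ^ 6) solve (State.input P k)
      (2 * (n * (Nat.log 2 (2 * n) * 48 + 110) + 18) + 60 +
        ⌊(10000 * Real.log n + (28800000000 * k * (Nat.log 2 (57600 * k) + 1) + 11 : ℕ)) *
          (2 * n)⌋₊)
      fun s => ∃ R : AxisRect, s.Outputs R ∧ R.IsSmallestPerimeter P k := by
  have hpw := writesOK_solver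
  set B := (n + 2) ^ 6 with hBdef
  set F := ⌊(10000 * Real.log n + (28800000000 * k * (Nat.log 2 (57600 * k) + 1) + 11 : ℕ)) *
          (2 * n)⌋₊ with hF
  have hB : (n + 4) * ((4 * n + 1) * (4 * n + 1)) ≤ B := by
    calc (n + 4) * ((4 * n + 1) * (4 * n + 1))
        ≤ (2 * (n + 2)) * ((4 * (n + 2)) * (4 * (n + 2))) :=
          Nat.mul_le_mul (by omega) (Nat.mul_le_mul (by omega) (by omega))
      _ = 32 * (n + 2) ^ 3 := by ring
      _ ≤ (n + 2) ^ 3 * (n + 2) ^ 3 :=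
          Nat.mul_le_mul_right _ (le_trans (by norm_num) (Nat.pow_le_pow_left (by omega : 4 ≤ n + 2) 3))
      _ = B := by rw [hBdef]; ring
  have hB2 : 2 * n ≤ B := le_trans (by nlinarith) hB
  set s := State.input P k with hs
  have h0 : s.nv 0 = n := rfl
  have h1 : s.nv 1 = k := rfl
  set T₁ := n * (Nat.log 2 (2 * n) * 48 + 110) + 18 with hT₁
  refine (Runs.cond (T := 50 + (2 * T₁ + F)) (fun hb => ?_) fun _ => ?_).mono
    (by rw [show (BExp.nle (nvar 1) 0).size = 3 from rfl]; omega) fun _ h => h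
  · simp [h1] at hb
    omega
  refine (Runs.cond (T := 40 + (2 * T₁ + F)) (fun hb => ?_) fun _ => ?_).mono
    (by rw [show (BExp.nle (nvar 1) 1).size = 3 from rfl]; omega) fun _ h => h
  · simp [h1] at hb
    omega
  refine Runs.seq' ((sortPoints_runs hpw (e := 0) (s := s) (by decide) hB2 h0 (by omega)).frame hpw)
    ?_ (T' := T₁ + (40 + F)) (by omega)
  rintro s₁ ⟨⟨hI₁, -⟩, hf₁⟩
  rw [sortPoints_writes] at hf₁
  refine Runs.seq' ((sortPoints_runs hpw (e := 1) (s := s₁) (by decide) hB2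
    (by rw [hf₁.nv 0 (by decide), h0]) (by omega)).frame hpw) ?_ (T' := 40 + F) (by omega)
  rintro s₂ ⟨⟨hI₂, hl₂⟩, hf₂⟩
  rw [sortPoints_writes] at hf₂
  have hsort : ∀ e, e < 2 → IsSorting (s.ra e) n (fun i => s₂.na 0 (e * n + i))
      (fun x => s₂.na 1 (e * n + x)) := by
    intro e he
    interval_cases e
    · exact hI₁.congr (fun j hj => (hl₂ _ (by omega)).1) fun j hj => (hl₂ _ (by omega)).2
    · rwa [hf₁.ra 1 (by decide)] at hI₂
  have hS₂ : SetStatic n k s.ra (fun e x => s₂.na 1 (e * n + x)) s₂ := by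
    refine ⟨by rw [hf₂.nv 0 (by decide), hf₁.nv 0 (by decide), h0],
      by rw [hf₂.nv 1 (by decide), hf₁.nv 1 (by decide), h1], fun e he => ?_, fun _ _ _ _ => rfl⟩
    rw [hf₂.ra e (by simp; omega), hf₁.ra e (by simp; omega)]
  refine Runs.seq' (initBox_runs (by omega) hkn hS₂ hsort (by omega)) ?_ le_rfl
  rintro s₃ ⟨hS₃, hN₃, h23, hg₃⟩
  have hrk : ∀ e, e < 2 → IsRanking (s.ra e) n (fun x => s₂.na 1 (e * n + x)) :=
    fun e he => (hsort e he).isRanking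
  have key : Runs [solveNode, solveSet] B (.call 1) s₃ F
      (SetPost s.ra n k (Finset.range n) 0 0 s₃) := by
    -- A small input may have fewer than `3600 k` points, where `nodeWeight` need not dominate `n`.
    -- It is treated as a final set outright, against the budget `2 n`.
    by_cases hnk : n < 28800 * k
    · refine (Runs.call (c := solveSet) rfl (solveSet_leaf_runs hpw rfl rfl hS₃ hN₃ subset_rfl h23
        (by omega) (by simpa using hkn) (by simpa using hnk) hrk hB hg₃)).mono ?_ fun _ h => h
      rw [Finset.card_range]
      refine (leaf_le (by omega) hnk).trans (Nat.le_floor ?_)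
      have := Real.log_natCast_nonneg n
      rw [Nat.cast_mul]
      refine mul_le_mul (by linarith) (by linarith [(Nat.cast_nonneg n : (0 : ℝ) ≤ n)])
        (by positivity) (by positivity)
    · refine (solveSet_runs hpw rfl rfl rfl rfl (by omega) hrk (fun e he => (hsort e he).rank_lt) hB
        (nodeTime k) (fun m h1 h2 => leaf_le_nodeTime (by omega) h1 h2)
        (fun m l r d h1 h2 h3 h4 h5 h6 h7 h8 h9 =>
          nodeTime_split (by omega) h1 h2 h3 h4 h5 h6 h7 h8 h9) n _ _ s₃ (by simp) (by omega) hS₃ hN₃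
        subset_rfl h23 (by simp) hg₃).mono ?_ fun _ h => h
      have := Real.log_natCast_nonneg n
      exact Nat.floor_le_floor (mul_le_mul_of_nonneg_left nodeWeight_le (by positivity))
  exact key.mono le_rfl fun s' h => exists_rect_of_isGood h.best.good h.best.bound

/-- One point, or for `k = 0` the origin already present in the zeroed memory, is a rectangle of
perimeter zero. These cases are separate because `log k` vanishes for `k ≤ 1` and could not pay for
terms of order `n k`. -/
theorem solve_runs_of_le_one {n k : ℕ} (P : Fin n → ℝ × ℝ) (hk : k ≤ 1) (hkn : k ≤ n) :
    Runs [solveNode, solveSet] ((n + 2) ^ 6) solve (State.input P k) 60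
      fun s => ∃ R : AxisRect, s.Outputs R ∧ R.IsSmallestPerimeter P k := by
  have hmin : ∀ R : AxisRect, R.x₁ = R.x₂ → R.y₁ = R.y₂ → ∀ R' : AxisRect,
      R.perimeter ≤ R'.perimeter := by
    intro R h1 h2 R'
    have h3 := R'.hx
    have h4 := R'.hy
    simp only [AxisRect.perimeter, h1, h2]
    linarith
  refine (Runs.cond (T := 50) (fun hb => ?_) fun hb => ?_).mono
    (by rw [show (BExp.nle (nvar 1) 0).size = 3 from rfl]; omega) fun _ h => h
  · obtain rfl : k = 0 := by simpa [State.input] using hb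
    exact Runs.straight (c := .skip) ⟨⟨0, 0, 0, 0, le_rfl, le_rfl⟩, ⟨rfl, rfl, rfl, rfl⟩,
      Nat.zero_le _, fun R' _ => hmin _ rfl rfl R'⟩ (Nat.le_of_ble_eq_true rfl)
  · obtain rfl : k = 1 := by
      simp [State.input] at hb
      omega
    refine (Runs.cond (T := 40) (fun hb => ?_) fun hb => ?_).mono
      (by rw [show (BExp.nle (nvar 1) 1).size = 3 from rfl]; omega) fun _ h => h
    · refine Runs.straight ?_ (Nat.le_of_ble_eq_true rfl)
      refine ⟨⟨(P ⟨0, hkn⟩).1, (P ⟨0, hkn⟩).1, (P ⟨0, hkn⟩).2, (P ⟨0, hkn⟩).2, le_rfl, le_rfl⟩, ?_, ?_,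
        fun R' _ => hmin _ rfl rfl R'⟩
      · simp [State.Outputs, State.input, Nat.lt_of_succ_le hkn]
      · refine (Set.ncard_pos (Set.toFinite _)).2 ⟨⟨0, hkn⟩, ?_⟩
        simp [AxisRect.toSet]
    · simp [State.input] at hb

end RealRAM

theorem mainTheorem11 :
    ∃ (p : RealRAM.Program) (w : ℕ) (C : ℝ),
      ∀ (n k : ℕ) (P : Fin n → ℝ × ℝ), k ≤ n →
        ∃ (s : RealRAM.State) (t : ℕ) (R : AxisRect),
          p.RunsTo ((n + 2) ^ w) (RealRAM.State.input P k) s t ∧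
          (t : ℝ) ≤ C * ((n : ℝ) * Real.log n + (n : ℝ) * k * Real.log k + 1) ∧
          s.Outputs R ∧ R.IsSmallestPerimeter P k := by
  -- Addresses reach about `(n + 4) (4 n + 1)²`, which is below `(n + 2) ^ 6` as soon as `n ≥ 2`.
  -- The last number is the constant of `total_time_le`.
  refine ⟨RealRAM.solver, 6, 10000000000000, fun n k P hkn => ?_⟩
  have hn := Real.log_natCast_nonneg n
  have hk := Real.log_natCast_nonneg k
  by_cases hk2 : 2 ≤ k
  · obtain ⟨s, t, h, ht, R, hR, hR'⟩ := RealRAM.solve_runs P hk2 hkn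
    refine ⟨s, t, R, h, le_trans ?_ (total_time_le hk2 hkn), hR, hR'⟩
    refine (Nat.cast_le.2 ht).trans ?_
    rw [Nat.cast_add]
    gcongr
    exact Nat.floor_le (by positivity)
  · obtain ⟨s, t, h, ht, R, hR, hR'⟩ := RealRAM.solve_runs_of_le_one P (by omega) hkn
    refine ⟨s, t, R, h, ?_, hR, hR'⟩
    have h1 : (t : ℝ) ≤ 60 := by exact_mod_cast ht
    have h2 : 0 ≤ (n : ℝ) * Real.log n + n * k * Real.log k := by positivity
    linarith
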